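/- **Theorem 3 (strong consistency of the sequential least squares estimators, one-component chirp-like model).** Consider $$y(t)=A^0\cos(\alpha^0t)+B^0\sin(\alpha^0t)+C^0\cos(\beta^0t^2)+D^0\sin(\beta^0t^2)+X(t),\qquad t=1,2,\dots,$$ where $X(t)=\sum_{j=-\infty}^{\infty}a(j)e(t-j)$, the $a(j)$ are real constants with $\sum_j|a(j)|<\infty$, and $\{e(t)\}_{t\in\mathbb Z}$ are i.i.d. random variables with $E\,e(t)=0$ and $V(e(t))=\sigma^2<\infty$. Let $M>0$, $\Theta^{(1)}=\Theta^{(2)}=[-M,M]\times[-M,M]\times[0,\pi]$, assume that $(A^0,B^0,\alpha^0,C^0,D^0,\beta^0)$ is an interior point of $\Theta^{(1)}\times\Theta^{(2)}$, and assume that $\beta^0/\pi$ is irrational (this excludes only countably many values of $\beta^0$). Let $\mathbf Y=(y(1),\dots,y(n))^T$, let $\mathbf Z^{(1)}(\alpha)$ be the $n\times2$ matrix with rows $(\cos\alpha t,\ \sin\alpha t)$ and $\mathbf Z^{(2)}(\beta)$ the $n\times2$ matrix with rows $(\cos\beta t^2,\ \sin\beta t^2)$, $t=1,\dots,n$. For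 a family $\mathbf Z(\gamma)$ of $n\times 2$ matrices, $\gamma\in[0,\pi]$, and a data vector $\mathbf V\in\mathbb R^n$, *fitting $\mathbf Z$ to $\mathbf V$* means choosing $(\mu_1,\mu_2,\gamma)$ in one of the following two ways: (i) (separable regression) $\gamma$ minimises $\mathbf V^T\big(\mathbf I-\mathbf Z(\gamma)[\mathbf Z(\gamma)^T\mathbf Z(\gamma)]^{-1}\mathbf Z(\gamma)^T\big)\mathbf V$ over the $\gamma\in[0,\pi]$ for which $\mathbf Z(\gamma)^T\mathbf Z(\gamma)$ is invertible, and $(\mu_1,\mu_2)^T=[\mathbf Z(\gamma)^T\mathbf Z(\gamma)]^{-1}\mathbf Z(\gamma)^T\mathbf V$; or (ii) (minimisation over the compact parameter space) $(\mu_1,\mu_2,\gamma)$ minimises $\|\mathbf V-\mathbf Z(\gamma)(\mu_1,\mu_2)^T\|^2$ over $[-M,M]\times[-M,M]\times[0,\pi]$. Suppose that, almost surely, for all sufficiently large $n$, $(\tilde A,\tilde B,\tilde\alpha)$ is obtained by fitting $\mathbf Z^{(1)}$ to $\mathbf Y$. Then, with the same method (i) or (ii) used in both steps: (a) if ${A^0}^2+{B^0}^2>0$,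 then $(\tilde A,\tilde B,\tilde\alpha)\to(A^0,B^0,\alpha^0)$ almost surely as $n\to\infty$; (b) if ${C^0}^2+{D^0}^2>0$ and, almost surely, for all sufficiently large $n$, $(\tilde C,\tilde D,\tilde\beta)$ is obtained by fitting $\mathbf Z^{(2)}$ to the residual vector $\mathbf Y_1=\mathbf Y-\mathbf Z^{(1)}(\tilde\alpha)(\tilde A,\tilde B)^T$, then $(\tilde C,\tilde D,\tilde\beta)\to(C^0,D^0,\beta^0)$ almost surely as $n\to\infty$. -/

import Mathlib

open MeasureTheory ProbabilityTheory Filter Topology Set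
open scoped Matrix

/-- The noise: `X(t) = ∑_{j ∈ ℤ} a(j) e(t - j)` (almost surely convergent series), with
`∑ |a(j)| < ∞` and `e(t)`, `t ∈ ℤ`, i.i.d. with mean `0` and finite variance `σ²`. -/
structure IsLinearProcess {Ω : Type*} [MeasurableSpace Ω] (P : Measure Ω) (σ : ℝ)
    (a : ℤ → ℝ) (e X : ℤ → Ω → ℝ) : Prop where
  indep : iIndepFun e P
  ident : ∀ t, IdentDistrib (e t) (e 0) P P
  memLp : ∀ t, MemLp (e t) 2 P
  mean : ∀ t, ∫ ω, e t ω ∂P = 0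
  var : ∀ t, Var[e t; P] = σ ^ 2
  summable : Summable fun j => |a j|
  hasSum : ∀ t, ∀ᵐ ω ∂P, HasSum (fun j => a j * e (t - j) ω) (X t ω)

/-- The parameter space `[-M, M] × [-M, M] × [0, π]` of one block `(A, B, α)` or `(C, D, β)`. -/
def blockSpace (M : ℝ) : Set (ℝ × ℝ × ℝ) :=
  Icc (-M) M ×ˢ Icc (-M) M ×ˢ Icc 0 Real.pi

/-- The signal `A cos(α t) + B sin(α t) + C cos(β t²) + D sin(β t²)` plus the noise, where
`θ₁ = (A, B, α)` and `θ₂ = (C, D, β)`. -/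
noncomputable def chirpLike {Ω : Type*} (θ₁ θ₂ : ℝ × ℝ × ℝ) (X : ℤ → Ω → ℝ) (t : ℕ) (ω : Ω) : ℝ :=
  θ₁.1 * Real.cos (θ₁.2.2 * t) + θ₁.2.1 * Real.sin (θ₁.2.2 * t)
    + θ₂.1 * Real.cos (θ₂.2.2 * (t : ℝ) ^ 2) + θ₂.2.1 * Real.sin (θ₂.2.2 * (t : ℝ) ^ 2)
    + X (t : ℤ) ω

/-- The data vector `(y(1), …, y(n))`. -/
noncomputable def dataVec {Ω : Type*} (θ₁ θ₂ : ℝ × ℝ × ℝ) (X : ℤ → Ω → ℝ) (n : ℕ) (ω : Ω) :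
    Fin n → ℝ :=
  fun i => chirpLike θ₁ θ₂ X ((i : ℕ) + 1) ω

/-- The `n × 2` matrix with rows `(cos(α t), sin(α t))`, `t = 1, …, n`. -/
noncomputable def sinusoidDesign (n : ℕ) (α : ℝ) : Matrix (Fin n) (Fin 2) ℝ :=
  Matrix.of fun i =>
    ![Real.cos (α * ((i : ℕ) + 1 : ℝ)), Real.sin (α * ((i : ℕ) + 1 : ℝ))]

/-- The `n × 2` matrix with rows `(cos(β t²), sin(β t²))`, `t = 1, …, n`. -/
noncomputable def chirpDesign (n : ℕ) (β : ℝ) : Matrix (Fin n) (Fin 2) ℝ :=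
  Matrix.of fun i =>
    ![Real.cos (β * ((i : ℕ) + 1 : ℝ) ^ 2), Real.sin (β * ((i : ℕ) + 1 : ℝ) ^ 2)]

/-- The fitted signal `Z(γ) μ` for `θ = (μ₁, μ₂, γ)`. -/
noncomputable def fitted {n : ℕ} (Z : ℝ → Matrix (Fin n) (Fin 2) ℝ) (θ : ℝ × ℝ × ℝ) :
    Fin n → ℝ :=
  Z θ.2.2 *ᵥ ![θ.1, θ.2.1]

/-- The error sum of squares `(Y - Z(γ) μ)ᵀ (Y - Z(γ) μ)`. -/
noncomputable def errorSS {n : ℕ} (Z : ℝ → Matrix (Fin n) (Fin 2) ℝ) (Y : Fin n → ℝ)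
    (θ : ℝ × ℝ × ℝ) : ℝ :=
  (Y - fitted Z θ) ⬝ᵥ (Y - fitted Z θ)

/-- The linear parameter estimate `[ZᵀZ]⁻¹ Zᵀ Y`. -/
noncomputable def linearEst {n : ℕ} (Z : Matrix (Fin n) (Fin 2) ℝ) (Y : Fin n → ℝ) : Fin 2 → ℝ :=
  ((Zᵀ * Z)⁻¹ * Zᵀ) *ᵥ Y

/-- The profiled error sum of squares `Yᵀ (I - Z [ZᵀZ]⁻¹ Zᵀ) Y`. -/
noncomputable def profileSS {n : ℕ} (Z : Matrix (Fin n) (Fin 2) ℝ) (Y : Fin n → ℝ) : ℝ :=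
  Y ⬝ᵥ ((1 - Z * (Zᵀ * Z)⁻¹ * Zᵀ) *ᵥ Y)

/-- The `γ ∈ [0, π]` at which `Z(γ)ᵀ Z(γ)` is invertible, so that the formulas above make sense. -/
def regularSet {n : ℕ} (Z : ℝ → Matrix (Fin n) (Fin 2) ℝ) : Set ℝ :=
  {γ ∈ Icc 0 Real.pi | ((Z γ)ᵀ * Z γ).det ≠ 0}

/-- `θ = (μ₁, μ₂, γ)` is obtained by separable regression: `γ` minimises the profiled error sum of
squares and `(μ₁, μ₂)` is the linear parameter estimate at `γ`. -/
structure IsSeparableLSE {n : ℕ} (Z : ℝ → Matrix (Fin n) (Fin 2) ℝ) (Y : Fin n → ℝ)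
    (θ : ℝ × ℝ × ℝ) : Prop where
  mem : θ.2.2 ∈ regularSet Z
  isMin : IsMinOn (fun γ => profileSS (Z γ) Y) (regularSet Z) θ.2.2
  linear : ![θ.1, θ.2.1] = linearEst (Z θ.2.2) Y

/-- `θ` minimises the error sum of squares over the compact parameter space. -/
structure IsConstrainedLSE {n : ℕ} (M : ℝ) (Z : ℝ → Matrix (Fin n) (Fin 2) ℝ) (Y : Fin n → ℝ)
    (θ : ℝ × ℝ × ℝ) : Prop where
  mem : θ ∈ blockSpace M
  isMin : IsMinOn (errorSS Z Y) (blockSpace M) θ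

/-! ### Van der Corput's inequality -/

/-! Both ways of fitting yield, for large n, a triple with frequency in `[0, π]` whose error sum of
squares is at most that of the true triple; for separable regression this uses that the true
frequency is eventually regular. Nothing else about the estimators is used, so amplitudes are a
priori unbounded. Write the data as f₀ + r + ρ, with f₀ the block to be recovered, r a nuisance and
ρ of mean square o(1). The inequality becomes ∑ (f - f₀)² ≤ 2 ∑ r (f - f₀) + 2 ∑ ρ (f - f₀), and the
left side is o(n) once (∑ r f)² ≤ ε n ∑ f² holds uniformly over candidate signals f
(`tendsto_mean_sq_of_errorSS_le`). In the first stage r is chirp plus noise and ρ = 0; in the second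
r is noise and ρ is the first-stage error.

The noise is handled by `IsLinearProcess.quadraticNull`: two van der Corput steps remove a quadratic
phase and leave fourfold correlations of the innovations, at distinct indices, so that second
moments suffice. The bound has mean O(n^(7/8)); summing along n = (k + 1)^16 and filling the gaps
crudely gives o(n) almost surely, uniformly in the phase. The chirp is uniformly orthogonal to
sinusoids by van der Corput and the irrationality of β⁰/π.

Near the end points of `[0, π]` cosine and sine are almost collinear and the energy ∑ f² does not
bound the amplitudes. There Abel summation works instead: partial sums of r are o(n), and the
variation of f is controlled by its energy. Elsewhere ∑ f² ≥ c n (p² + q²)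
(`exists_energy_lower_bound`).

Finally ∑ (f - f₀)² = o(n) forces convergence of the parameters (`Identifiable.tendsto`): amplitudes
are bounded, frequencies converge along subsequences, and wherever the interference terms average
out, the real signals can be replaced by complex exponentials, whose products at a few well-chosen
times isolate amplitude and frequency. -/

theorem sum_shift_eq {n H r : ℕ} (x : ℕ → ℂ) (h0 : x 0 = 0) (hn : ∀ t, n < t → x t = 0)
    (hr : r < H) :
    ∑ m ∈ Finset.range (n + H), x (m - r) = ∑ t ∈ Finset.Icc 1 n, x t := by
  have h1 : ∑ m ∈ Finset.range (n + H), x (m - r) = ∑ m ∈ Finset.Ico r (n + H), x (m - r) := by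
    symm
    apply Finset.sum_subset
    · intro m; simp
    · intro m hm hm'
      have : m - r = 0 := by simp at hm hm'; omega
      rw [this, h0]
  rw [h1, Finset.sum_Ico_eq_sum_range]
  simp only [Nat.add_sub_cancel_left]
  symm
  apply Finset.sum_subset
  · intro m; simp; omega
  · intro m hm hm'
    rcases Nat.eq_zero_or_pos m with h | h
    · rw [h, h0]
    · apply hn; simp at hm'; omega

theorem sum_shift_mul_conj {n H r s : ℕ} (x : ℕ → ℂ) (h0 : x 0 = 0) (hn : ∀ t, n < t → x t = 0)
    (hrs : r ≤ s) (hs : s < H) :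
    ∑ m ∈ Finset.range (n + H), x (m - r) * star (x (m - s))
      = ∑ t ∈ Finset.Icc 1 n, x (t + (s - r)) * star (x t) := by
  have h1 := sum_shift_eq (n := n) (H := H) (r := s) (fun t => x (t + (s - r)) * star (x t))
    (by simp [h0]) (fun t ht => by simp [hn t ht]) hs
  rw [← h1]
  apply Finset.sum_congr rfl
  intro m _
  by_cases hm : s ≤ m
  · have : m - s + (s - r) = m - r := by omega
    rw [this]
  -- Truncated subtraction sends every index below s to 0, where x vanishes.
  · have : m - s = 0 := by omega
    simp [this, h0]

/-- Each distance h ≥ 1 from s is attained at most twice, once on each side. -/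
theorem sum_dist_le (c : ℕ → ℝ) (hc : ∀ h, 0 ≤ c h) (H s : ℕ) (hs : s < H) :
    ∑ r ∈ Finset.range H, c (Nat.dist r s) ≤ c 0 + 2 * ∑ h ∈ Finset.Ico 1 H, c h := by
  have hsplit : Finset.range H = Finset.range s ∪ ({s} ∪ Finset.Ico (s + 1) H) := by
    ext r; simp; omega
  rw [hsplit, Finset.sum_union, Finset.sum_union]
  · have h1 : ∑ r ∈ Finset.range s, c (Nat.dist r s) ≤ ∑ h ∈ Finset.Ico 1 H, c h := by
      have : ∑ r ∈ Finset.range s, c (Nat.dist r s)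
          = ∑ h ∈ (Finset.range s).image (fun r => s - r), c h := by
        rw [Finset.sum_image]
        · apply Finset.sum_congr rfl
          intro r hr
          simp at hr
          rw [Nat.dist_eq_sub_of_le hr.le]
        · intro a ha b hb hab; simp at ha hb hab; omega
      rw [this]
      apply Finset.sum_le_sum_of_subset_of_nonneg
      · intro h hh; simp at hh ⊢; obtain ⟨a, ha, rfl⟩ := hh; omega
      · intros; apply hc
    have h2 : ∑ r ∈ Finset.Ico (s + 1) H, c (Nat.dist r s) ≤ ∑ h ∈ Finset.Ico 1 H, c h := by
      have : ∑ r ∈ Finset.Ico (s + 1) H, c (Nat.dist r s)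
          = ∑ h ∈ (Finset.Ico (s + 1) H).image (fun r => r - s), c h := by
        rw [Finset.sum_image]
        · apply Finset.sum_congr rfl
          intro r hr
          simp at hr
          rw [Nat.dist_eq_sub_of_le_right (by omega)]
        · intro a ha b hb hab; simp at ha hb hab; omega
      rw [this]
      apply Finset.sum_le_sum_of_subset_of_nonneg
      · intro h hh; simp at hh ⊢; obtain ⟨a, ha, rfl⟩ := hh; omega
      · intros; apply hc
    have h3 : ∑ r ∈ ({s} : Finset ℕ), c (Nat.dist r s) = c 0 := by simp [Nat.dist_self]
    linarith
  · rw [Finset.disjoint_left]; intro a; simp; omega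
  · rw [Finset.disjoint_left]; intro a; simp; omega

/-- H times the sum equals the sum of x over all n + H windows of length H. Cauchy–Schwarz over the
windows, followed by expansion of the squares, leaves only correlations at lags |r - s| < H. -/
theorem van_der_corput {n H : ℕ} (hH : 1 ≤ H) (x : ℕ → ℂ) (h0 : x 0 = 0)
    (hn : ∀ t, n < t → x t = 0) :
    ‖∑ t ∈ Finset.Icc 1 n, x t‖ ^ 2 ≤ ((n + H : ℕ) : ℝ) / H *
      (∑ t ∈ Finset.Icc 1 n, ‖x t‖ ^ 2
        + 2 * ∑ h ∈ Finset.Ico 1 H, ‖∑ t ∈ Finset.Icc 1 n, x (t + h) * star (x t)‖) := by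
  set c : ℕ → ℝ := fun h => ‖∑ t ∈ Finset.Icc 1 n, x (t + h) * star (x t)‖ with hc
  have hc0 : c 0 = ∑ t ∈ Finset.Icc 1 n, ‖x t‖ ^ 2 := by
    have : ∑ t ∈ Finset.Icc 1 n, x (t + 0) * star (x t)
        = ((∑ t ∈ Finset.Icc 1 n, ‖x t‖ ^ 2 : ℝ) : ℂ) := by
      push_cast
      apply Finset.sum_congr rfl
      intro t _
      simpa using Complex.mul_conj' (x t)
    rw [hc]; simp only; rw [this, Complex.norm_real, Real.norm_of_nonneg]
    positivity
  have hcorr : ∀ r < H, ∀ s < H,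
      ‖∑ m ∈ Finset.range (n + H), x (m - r) * star (x (m - s))‖ = c (Nat.dist r s) := by
    intro r hr s hs
    rcases le_total r s with h | h
    · rw [sum_shift_mul_conj x h0 hn h hs, Nat.dist_eq_sub_of_le h]
    · rw [Nat.dist_eq_sub_of_le_right h]
      simp only [hc]
      rw [← sum_shift_mul_conj x h0 hn h hr, ← norm_star (∑ m ∈ _, _), star_sum]
      congr 1
      apply Finset.sum_congr rfl
      intro m _
      rw [star_mul, star_star]
  have h1 : (H : ℂ) * ∑ t ∈ Finset.Icc 1 n, x t
      = ∑ m ∈ Finset.range (n + H), ∑ r ∈ Finset.range H, x (m - r) := by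
    rw [Finset.sum_comm, Finset.sum_congr rfl
      (fun r hr => sum_shift_eq x h0 hn (Finset.mem_range.mp hr))]
    simp
  have h2 : (H : ℝ) ^ 2 * ‖∑ t ∈ Finset.Icc 1 n, x t‖ ^ 2 ≤
      ((n + H : ℕ) : ℝ) * ∑ m ∈ Finset.range (n + H), ‖∑ r ∈ Finset.range H, x (m - r)‖ ^ 2 := by
    have e1 : (H : ℝ) ^ 2 * ‖∑ t ∈ Finset.Icc 1 n, x t‖ ^ 2
        = ‖∑ m ∈ Finset.range (n + H), ∑ r ∈ Finset.range H, x (m - r)‖ ^ 2 := by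
      rw [← h1, norm_mul, mul_pow]; simp
    rw [e1]
    calc _ ≤ (∑ m ∈ Finset.range (n + H), ‖∑ r ∈ Finset.range H, x (m - r)‖) ^ 2 := by
          gcongr; exact norm_sum_le _ _
      _ ≤ _ := by
          have := sq_sum_le_card_mul_sum_sq (s := Finset.range (n + H))
            (f := fun m => ‖∑ r ∈ Finset.range H, x (m - r)‖)
          simpa using this
  have h3 : ∑ m ∈ Finset.range (n + H), ‖∑ r ∈ Finset.range H, x (m - r)‖ ^ 2 ≤
      H * (c 0 + 2 * ∑ h ∈ Finset.Ico 1 H, c h) := by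
    have e2 : ((∑ m ∈ Finset.range (n + H), ‖∑ r ∈ Finset.range H, x (m - r)‖ ^ 2 : ℝ) : ℂ)
        = ∑ s ∈ Finset.range H, ∑ r ∈ Finset.range H,
          ∑ m ∈ Finset.range (n + H), x (m - r) * star (x (m - s)) := by
      push_cast
      have : ∀ m, ((‖∑ r ∈ Finset.range H, x (m - r)‖ : ℂ)) ^ 2
          = ∑ s ∈ Finset.range H, ∑ r ∈ Finset.range H, x (m - r) * star (x (m - s)) := by
        intro m
        rw [← Complex.mul_conj']
        rw [map_sum, Finset.mul_sum]
        apply Finset.sum_congr rfl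
        intro s _
        rw [Finset.sum_mul]; rfl
      rw [Finset.sum_congr rfl (fun m _ => this m), Finset.sum_comm]
      apply Finset.sum_congr rfl
      intro s _
      rw [Finset.sum_comm]
    have e3 : ∑ m ∈ Finset.range (n + H), ‖∑ r ∈ Finset.range H, x (m - r)‖ ^ 2
        = ‖((∑ m ∈ Finset.range (n + H), ‖∑ r ∈ Finset.range H, x (m - r)‖ ^ 2 : ℝ) : ℂ)‖ := by
      rw [Complex.norm_real, Real.norm_of_nonneg]; positivity
    rw [e3, e2]
    calc _ ≤ ∑ s ∈ Finset.range H, ∑ r ∈ Finset.range H, c (Nat.dist r s) := by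
          refine (norm_sum_le _ _).trans (Finset.sum_le_sum fun s hs => ?_)
          refine (norm_sum_le _ _).trans (Finset.sum_le_sum fun r hr => ?_)
          exact (hcorr r (Finset.mem_range.mp hr) s (Finset.mem_range.mp hs)).le
      _ ≤ ∑ s ∈ Finset.range H, (c 0 + 2 * ∑ h ∈ Finset.Ico 1 H, c h) :=
          Finset.sum_le_sum fun s hs =>
            sum_dist_le c (fun h => norm_nonneg _) H s (Finset.mem_range.mp hs)
      _ = _ := by simp; ring
  rw [← hc0]
  have hHpos : (0 : ℝ) < H := by exact_mod_cast hH
  have h4 := h2.trans (mul_le_mul_of_nonneg_left h3 (Nat.cast_nonneg (n + H)))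
  rw [div_mul_eq_mul_div, le_div_iff₀ hHpos]
  have : (H : ℝ) * (‖∑ t ∈ Finset.Icc 1 n, x t‖ ^ 2 * H)
      ≤ H * (((n + H : ℕ) : ℝ) * (c 0 + 2 * ∑ h ∈ Finset.Ico 1 H, c h)) := by
    nlinarith
  exact le_of_mul_le_mul_left this hHpos

/-! ### The complex exponential `e^{iθ}` -/

/-- `e^{iθ}` -/
noncomputable def cis (θ : ℝ) : ℂ := Complex.exp (θ * Complex.I)

@[simp] theorem norm_cis (θ : ℝ) : ‖cis θ‖ = 1 := Complex.norm_exp_ofReal_mul_I θ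

theorem cis_add (x y : ℝ) : cis (x + y) = cis x * cis y := by
  simp [cis, add_mul, Complex.exp_add]

@[simp] theorem cis_zero : cis 0 = 1 := by simp [cis]

theorem cis_ne_zero (θ : ℝ) : cis θ ≠ 0 := Complex.exp_ne_zero _

theorem star_cis (θ : ℝ) : star (cis θ) = cis (-θ) := by
  change (starRingEnd ℂ) _ = _
  simp [cis, ← Complex.exp_conj]

theorem cis_mul_star (x y : ℝ) : cis x * star (cis y) = cis (x - y) := by
  rw [star_cis, ← cis_add, sub_eq_add_neg]

theorem cis_nat_mul (n : ℕ) (θ : ℝ) : cis (n * θ) = cis θ ^ n := by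
  simp only [cis, ← Complex.exp_nat_mul]; push_cast; ring_nf

theorem cis_re (θ : ℝ) : (cis θ).re = Real.cos θ := Complex.exp_ofReal_mul_I_re θ

theorem cis_im (θ : ℝ) : (cis θ).im = Real.sin θ := Complex.exp_ofReal_mul_I_im θ

theorem continuous_cis : Continuous cis := by unfold cis; fun_prop

/-! ### Bounding quadratic exponential sums by correlations -/

/-- AM–GM, with c the expected size of z. It replaces the square roots in nested estimates by
polynomials, whose expectations can be taken term by term. -/
theorem abs_le_half_div_add (z c : ℝ) (hc : 0 < c) : |z| ≤ (z ^ 2 / c + c) / 2 := by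
  rw [le_div_iff₀ two_pos, div_add' _ _ _ hc.ne', le_div_iff₀ hc]
  nlinarith [sq_nonneg (|z| - c), sq_abs z]

/-- The fourfold correlation of a sequence. -/
def quadCorr (n h k : ℕ) (x : ℕ → ℝ) : ℝ :=
  ∑ t ∈ Finset.Icc 1 n, x t * x (t + h) * x (t + k) * x (t + h + k)

theorem van_der_corput_self {n : ℕ} (x : ℕ → ℂ) (h0 : x 0 = 0)
    (hn : ∀ t, n < t → x t = 0) :
    ‖∑ t ∈ Finset.Icc 1 n, x t‖ ^ 2 ≤ 2 * (∑ t ∈ Finset.Icc 1 n, ‖x t‖ ^ 2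
        + 2 * ∑ h ∈ Finset.Ico 1 n, ‖∑ t ∈ Finset.Icc 1 n, x (t + h) * star (x t)‖) := by
  rcases Nat.eq_zero_or_pos n with rfl | hpos
  · simp
  · have := van_der_corput hpos x h0 hn
    have h2 : ((n + n : ℕ) : ℝ) / n = 2 := by
      have : (n : ℝ) ≠ 0 := by positivity
      push_cast; field_simp; norm_num
    rwa [h2] at this

/-- At lag k the linear phase contributes only the unimodular constant `cis (θ * k)`, so the bound
is free of θ. The lag k = h is set apart because t + h and t + k then coincide; it is bounded by the
energy, whence 6 = 2 + 4. -/
theorem norm_sum_linear_phase_sq_le {n h : ℕ} (x : ℕ → ℝ) (h0 : x 0 = 0)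
    (hn : ∀ t, n < t → x t = 0) (hh : h ∈ Finset.Ico 1 n) (θ : ℝ) :
    ‖∑ t ∈ Finset.Icc 1 n, ((x t * x (t + h) : ℝ) : ℂ) * cis (θ * t)‖ ^ 2 ≤
      6 * ∑ t ∈ Finset.Icc 1 n, (x t * x (t + h)) ^ 2
        + 4 * ∑ k ∈ (Finset.Ico 1 n).erase h, |quadCorr n h k x| := by
  set y : ℕ → ℝ := fun t => x t * x (t + h) with hy
  have hy0 : y 0 = 0 := by simp [hy, h0]
  have hyn : ∀ t, n < t → y t = 0 := fun t ht => by simp [hy, hn t ht]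
  have hv := van_der_corput_self (n := n) (fun t => (y t : ℂ) * cis (θ * t)) (by simp [hy0])
    (fun t ht => by simp [hyn t ht])
  have hcorr : ∀ k : ℕ, ‖∑ t ∈ Finset.Icc 1 n,
      ((y (t + k) : ℂ) * cis (θ * (t + k : ℕ))) * star ((y t : ℂ) * cis (θ * t))‖
      = |∑ t ∈ Finset.Icc 1 n, y t * y (t + k)| := by
    intro k
    have : ∀ t : ℕ, ((y (t + k) : ℂ) * cis (θ * (t + k : ℕ))) * star ((y t : ℂ) * cis (θ * t))
        = cis (θ * k) * ((y t * y (t + k) : ℝ) : ℂ) := by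
      intro t
      rw [star_mul, mul_mul_mul_comm, ← mul_assoc, mul_comm]
      have h3 : cis (θ * (t + k : ℕ)) = cis (θ * k) * cis (θ * t) := by
        rw [← cis_add]; congr 1; push_cast; ring
      have h4 : cis (θ * t) * star (cis (θ * t)) = 1 := by rw [cis_mul_star]; simp
      have h5 : star (y t : ℂ) = y t := Complex.conj_ofReal _
      rw [h3, h5]; push_cast
      linear_combination ((y t : ℂ) * y (t + k) * cis (θ * k)) * h4
    rw [Finset.sum_congr rfl (fun t _ => this t), ← Finset.mul_sum, norm_mul, norm_cis, one_mul,
      ← Complex.ofReal_sum, Complex.norm_real, Real.norm_eq_abs]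
  simp only [hcorr] at hv
  rw [← Finset.add_sum_erase _ _ hh] at hv
  have hdiag : |∑ t ∈ Finset.Icc 1 n, y t * y (t + h)| ≤ ∑ t ∈ Finset.Icc 1 n, y t ^ 2 := by
    have h1 : |∑ t ∈ Finset.Icc 1 n, y t * y (t + h)|
        ≤ ∑ t ∈ Finset.Icc 1 n, (y t ^ 2 + y (t + h) ^ 2) / 2 := by
      refine (Finset.abs_sum_le_sum_abs _ _).trans (Finset.sum_le_sum fun t _ => ?_)
      rw [abs_mul]
      nlinarith [sq_nonneg (|y t| - |y (t + h)|), sq_abs (y t), sq_abs (y (t + h))]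
    have h2 : ∑ t ∈ Finset.Icc 1 n, y (t + h) ^ 2 ≤ ∑ t ∈ Finset.Icc 1 n, y t ^ 2 := by
      have : ∑ t ∈ Finset.Icc 1 n, y (t + h) ^ 2
          = ∑ t ∈ (Finset.Icc 1 n).image (· + h), y t ^ 2 := by
        rw [Finset.sum_image]; intro a _ b _ hab; simpa using hab
      rw [this]
      rw [← Finset.sum_filter_add_sum_filter_not _ (fun t => t ≤ n)]
      rw [Finset.sum_eq_zero (s := Finset.filter (fun t => ¬ t ≤ n) _)
        (fun t ht => by rw [hyn t (by simp at ht; omega)]; norm_num), add_zero]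
      apply Finset.sum_le_sum_of_subset_of_nonneg
      · intro t ht
        simp only [Finset.mem_filter, Finset.mem_image, Finset.mem_Icc] at ht ⊢
        omega
      · intros; positivity
    rw [← Finset.sum_div, Finset.sum_add_distrib] at h1
    linarith
  have hq : ∀ k, ∑ t ∈ Finset.Icc 1 n, y t * y (t + k) = quadCorr n h k x := by
    intro k
    apply Finset.sum_congr rfl
    intro t _
    simp only [hy]
    rw [show t + k + h = t + h + k by ring]; ring
  have hs : ∑ t ∈ Finset.Icc 1 n, ‖(y t : ℂ) * cis (θ * t)‖ ^ 2
      = ∑ t ∈ Finset.Icc 1 n, y t ^ 2 := by simp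
  rw [hs] at hv
  simp only [← hq]
  simp only [hy] at *
  linarith

/-- A bound, polynomial in `x`, for all quadratic exponential sums with weights `x` of length
`q ^ 8`. -/
noncomputable def phaseMajorant (q : ℕ) (x : ℕ → ℝ) : ℝ :=
  ((2 * ∑ t ∈ Finset.Icc 1 (q ^ 8), x t ^ 2 + 2 * ∑ h ∈ Finset.Ico 1 (q ^ 8),
    ((6 * ∑ t ∈ Finset.Icc 1 (q ^ 8), (x t * x (t + h)) ^ 2
        + 2 * ∑ k ∈ (Finset.Ico 1 (q ^ 8)).erase h, (quadCorr (q ^ 8) h k x ^ 2 / (q : ℝ) ^ 4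
          + (q : ℝ) ^ 4)) / (q : ℝ) ^ 6 + (q : ℝ) ^ 6)) / (q : ℝ) ^ 7 + (q : ℝ) ^ 7) / 2

/-- Correlation at lag h turns the quadratic phase into a linear one of frequency 2γh, to which the
previous bound applies. With n = q^8 the AM–GM scales are √n = q^4 for fourfold correlations, then
√(n q^4) = q^6, then √(n q^6) = q^7. -/
theorem norm_sum_quadratic_phase_le {q : ℕ} (hq : 0 < q) (x : ℕ → ℝ) (h0 : x 0 = 0)
    (hn : ∀ t, q ^ 8 < t → x t = 0) (γ η : ℝ) :
    ‖∑ t ∈ Finset.Icc 1 (q ^ 8), (x t : ℂ) * cis (γ * t ^ 2 + η * t)‖ ≤ phaseMajorant q x := by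
  have hq' : (0 : ℝ) < q := by exact_mod_cast hq
  set n := q ^ 8 with hndef
  have hv := van_der_corput_self (n := n) (fun t => (x t : ℂ) * cis (γ * t ^ 2 + η * t))
    (by simp [h0]) (fun t ht => by simp [hn t ht])
  have hcorr : ∀ h ∈ Finset.Ico 1 n, ‖∑ t ∈ Finset.Icc 1 n,
      ((x (t + h) : ℂ) * cis (γ * (t + h : ℕ) ^ 2 + η * (t + h : ℕ)))
        * star ((x t : ℂ) * cis (γ * t ^ 2 + η * t))‖
      ≤ ((6 * ∑ t ∈ Finset.Icc 1 n, (x t * x (t + h)) ^ 2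
        + 2 * ∑ k ∈ (Finset.Ico 1 n).erase h, (quadCorr n h k x ^ 2 / (q : ℝ) ^ 4
          + (q : ℝ) ^ 4)) / (q : ℝ) ^ 6 + (q : ℝ) ^ 6) / 2 := by
    intro h hh
    have : ∀ t : ℕ, ((x (t + h) : ℂ) * cis (γ * (t + h : ℕ) ^ 2 + η * (t + h : ℕ)))
        * star ((x t : ℂ) * cis (γ * t ^ 2 + η * t))
        = cis (γ * h ^ 2 + η * h) * (((x t * x (t + h) : ℝ) : ℂ) * cis (2 * γ * h * t)) := by
      intro t
      have h3 : cis (γ * (t + h : ℕ) ^ 2 + η * (t + h : ℕ))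
          = cis (γ * h ^ 2 + η * h) * cis (2 * γ * h * t) * cis (γ * t ^ 2 + η * t) := by
        rw [← cis_add, ← cis_add]; congr 1; push_cast; ring
      have h4 : cis (γ * t ^ 2 + η * t) * star (cis (γ * t ^ 2 + η * t)) = 1 := by
        rw [cis_mul_star]; simp
      have h5 : star (x t : ℂ) = x t := Complex.conj_ofReal _
      rw [star_mul, h3, h5]; push_cast
      linear_combination (cis (γ * h ^ 2 + η * h) * (x t * x (t + h)) * cis (2 * γ * h * t)) * h4
    rw [Finset.sum_congr rfl (fun t _ => this t), ← Finset.mul_sum, norm_mul, norm_cis, one_mul]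
    have h6 := norm_sum_linear_phase_sq_le x h0 hn hh (2 * γ * h)
    have h7 := abs_le_half_div_add
      (‖∑ t ∈ Finset.Icc 1 n, ((x t * x (t + h) : ℝ) : ℂ) * cis (2 * γ * h * t)‖)
      ((q : ℝ) ^ 6) (by positivity)
    rw [abs_norm] at h7
    refine h7.trans ?_
    have h8 : ∑ k ∈ (Finset.Ico 1 n).erase h, |quadCorr n h k x| ≤
        ∑ k ∈ (Finset.Ico 1 n).erase h, (quadCorr n h k x ^ 2 / (q : ℝ) ^ 4
          + (q : ℝ) ^ 4) / 2 :=
      Finset.sum_le_sum fun k _ => abs_le_half_div_add _ _ (by positivity)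
    rw [← Finset.sum_div] at h8
    gcongr
    linarith
  have hs : ∑ t ∈ Finset.Icc 1 n, ‖(x t : ℂ) * cis (γ * t ^ 2 + η * t)‖ ^ 2
      = ∑ t ∈ Finset.Icc 1 n, x t ^ 2 := by simp
  rw [hs] at hv
  have h9 := Finset.sum_le_sum hcorr
  rw [← Finset.sum_div] at h9
  have h10 := abs_le_half_div_add
    (‖∑ t ∈ Finset.Icc 1 n, (x t : ℂ) * cis (γ * t ^ 2 + η * t)‖) ((q : ℝ) ^ 7) (by positivity)
  rw [abs_norm] at h10
  refine h10.trans ?_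
  unfold phaseMajorant
  gcongr
  linarith

/-! ### Moments of correlations of independent variables -/

section Moments

variable {Ω : Type*} [MeasurableSpace Ω] {P : Measure Ω}
  {f : ℕ → Ω → ℝ} {v : ℝ}

theorem integral_mul_eq_zero_of_iIndepFun (hf : iIndepFun f P) (hm : ∀ t, AEMeasurable (f t) P)
    {t : ℕ} {T : Finset ℕ} (ht : t ∉ T) (h0 : ∫ ω, f t ω ∂P = 0) (φ : (T → ℝ) → ℝ)
    (hφ : Measurable φ) : ∫ ω, f t ω * φ (fun i => f i ω) ∂P = 0 := by
  have hind := hf.indepFun_finset₀ {t} T (by simpa using ht) hm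
  have hproj : Measurable (fun u : ({t} : Finset ℕ) → ℝ => u ⟨t, by simp⟩) := measurable_pi_apply _
  have h2 := hind.comp hproj hφ
  have hφm : AEMeasurable (fun ω => φ (fun i : T => f i ω)) P :=
    hφ.comp_aemeasurable (aemeasurable_pi_lambda _ fun i => hm i)
  have h3 := h2.integral_mul_eq_mul_integral (hm t).aestronglyMeasurable hφm.aestronglyMeasurable
  change ∫ ω, f t ω * φ (fun i => f i ω) ∂P = (∫ ω, f t ω ∂P) * _ at h3
  rw [h3, h0, zero_mul]

theorem integrable_sq_mul_sq (hf : iIndepFun f P) (hL : ∀ t, MemLp (f t) 2 P) {i j : ℕ}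
    (hij : i ≠ j) : Integrable (fun ω => (f i ω * f j ω) ^ 2) P := by
  have hg : iIndepFun (fun i ω => f i ω ^ 2) P :=
    hf.comp (fun _ x => x ^ 2) (fun _ => by fun_prop)
  have := (hg.indepFun hij).integrable_mul (hL i).integrable_sq (hL j).integrable_sq
  refine this.congr (Eventually.of_forall fun ω => ?_)
  simp [mul_pow]

theorem integral_sq_mul_sq_le (hf : iIndepFun f P) (hL : ∀ t, MemLp (f t) 2 P)
    (hv : ∀ t, ∫ ω, f t ω ^ 2 ∂P ≤ v) {i j : ℕ} (hij : i ≠ j) :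
    ∫ ω, (f i ω * f j ω) ^ 2 ∂P ≤ v ^ 2 := by
  have hg : iIndepFun (fun i ω => f i ω ^ 2) P :=
    hf.comp (fun _ x => x ^ 2) (fun _ => by fun_prop)
  have := (hg.indepFun hij).integral_mul_eq_mul_integral
    (hL i).integrable_sq.aestronglyMeasurable (hL j).integrable_sq.aestronglyMeasurable
  have h2 : ∫ ω, (f i ω * f j ω) ^ 2 ∂P = (∫ ω, f i ω ^ 2 ∂P) * ∫ ω, f j ω ^ 2 ∂P := by
    rw [← this]; congr 1; ext ω; simp [mul_pow]
  rw [h2, sq]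
  have hnn : ∀ t, 0 ≤ ∫ ω, f t ω ^ 2 ∂P := fun t => integral_nonneg fun ω => sq_nonneg _
  exact mul_le_mul (hv i) (hv j) (hnn j) ((hnn i).trans (hv i))

/-- Distinct indices split the product into independent pairs, so no moment beyond the second is
needed. -/
theorem fourfold_sq (hf : iIndepFun f P) (hL : ∀ t, MemLp (f t) 2 P)
    (hv : ∀ t, ∫ ω, f t ω ^ 2 ∂P ≤ v) {i j k l : ℕ} (hij : i ≠ j) (hik : i ≠ k) (hil : i ≠ l)
    (hjk : j ≠ k) (hjl : j ≠ l) (hkl : k ≠ l) :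
    Integrable (fun ω => (f i ω * f j ω * f k ω * f l ω) ^ 2) P ∧
      ∫ ω, (f i ω * f j ω * f k ω * f l ω) ^ 2 ∂P ≤ v ^ 4 := by
  have hm : ∀ t, AEMeasurable (f t) P := fun t => (hL t).aestronglyMeasurable.aemeasurable
  have h1 := (hf.indepFun_mul_mul₀ hm i j k l hik hil hjk hjl).comp
    (φ := fun x => x ^ 2) (ψ := fun x => x ^ 2) (by fun_prop) (by fun_prop)
  have e : (fun ω => (f i ω * f j ω * f k ω * f l ω) ^ 2)
      = ((fun x : ℝ => x ^ 2) ∘ (f i * f j)) * ((fun x : ℝ => x ^ 2) ∘ (f k * f l)) := by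
    ext ω; simp [mul_pow]; ring
  have i1 : Integrable ((fun x : ℝ => x ^ 2) ∘ (f i * f j)) P := integrable_sq_mul_sq hf hL hij
  have i2 : Integrable ((fun x : ℝ => x ^ 2) ∘ (f k * f l)) P := integrable_sq_mul_sq hf hL hkl
  constructor
  · rw [e]; exact h1.integrable_mul i1 i2
  · have h2 := h1.integral_mul_eq_mul_integral i1.aestronglyMeasurable i2.aestronglyMeasurable
    rw [e, h2]
    have l1 : ∫ ω, ((fun x : ℝ => x ^ 2) ∘ (f i * f j)) ω ∂P ≤ v ^ 2 :=
      integral_sq_mul_sq_le hf hL hv hij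
    have l2 : ∫ ω, ((fun x : ℝ => x ^ 2) ∘ (f k * f l)) ω ∂P ≤ v ^ 2 :=
      integral_sq_mul_sq_le hf hL hv hkl
    calc _ ≤ v ^ 2 * v ^ 2 := mul_le_mul l1 l2 (integral_nonneg fun ω => sq_nonneg _) (sq_nonneg _)
      _ = v ^ 4 := by ring

/-- The index t is smaller than all the others, so `f t` is a centred factor independent of the
rest. -/
theorem integral_fourfold_mul_eq_zero (hf : iIndepFun f P) (hm : ∀ t, AEMeasurable (f t) P)
    (h0 : ∀ t, ∫ ω, f t ω ∂P = 0) {h k s t : ℕ} (hh : 0 < h) (hk : 0 < k) (hts : t < s) :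
    ∫ ω, (f t ω * f (t + h) ω * f (t + k) ω * f (t + h + k) ω)
      * (f s ω * f (s + h) ω * f (s + k) ω * f (s + h + k) ω) ∂P = 0 := by
  let T : Finset ℕ := Finset.Ioc t (s + h + k)
  have hT : ∀ i, t < i → i ≤ s + h + k → i ∈ T := fun i h1 h2 => Finset.mem_Ioc.mpr ⟨h1, h2⟩
  have := integral_mul_eq_zero_of_iIndepFun hf hm (t := t) (T := T) (by simp [T]) (h0 t)
    (fun u => (u ⟨t + h, hT _ (by omega) (by omega)⟩ * u ⟨t + k, hT _ (by omega) (by omega)⟩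
      * u ⟨t + h + k, hT _ (by omega) (by omega)⟩) * (u ⟨s, hT _ (by omega) (by omega)⟩
      * u ⟨s + h, hT _ (by omega) (by omega)⟩ * u ⟨s + k, hT _ (by omega) (by omega)⟩
      * u ⟨s + h + k, hT _ (by omega) (by omega)⟩)) (by fun_prop)
  rw [← this]
  congr 1; ext ω; ring

/-- The summands at different t are orthogonal, so only the n diagonal terms contribute to the
second moment. -/
theorem quadCorr_sq (hf : iIndepFun f P) (hL : ∀ t, MemLp (f t) 2 P)
    (h0 : ∀ t, ∫ ω, f t ω ∂P = 0) (hv : ∀ t, ∫ ω, f t ω ^ 2 ∂P ≤ v) {h k : ℕ} (n : ℕ)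
    (hh : 0 < h) (hk : 0 < k) (hhk : k ≠ h) :
    Integrable (fun ω => quadCorr n h k (fun t => f t ω) ^ 2) P ∧
      ∫ ω, quadCorr n h k (fun t => f t ω) ^ 2 ∂P ≤ n * v ^ 4 := by
  have hm : ∀ t, AEMeasurable (f t) P := fun t => (hL t).aestronglyMeasurable.aemeasurable
  set p : ℕ → Ω → ℝ := fun t ω => f t ω * f (t + h) ω * f (t + k) ω * f (t + h + k) ω with hp
  have hsq : ∀ t, Integrable (fun ω => p t ω ^ 2) P ∧ ∫ ω, p t ω ^ 2 ∂P ≤ v ^ 4 := fun t =>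
    fourfold_sq hf hL hv (by omega) (by omega) (by omega) (by omega) (by omega) (by omega)
  have hpm : ∀ t, AEStronglyMeasurable (p t) P := fun t =>
    ((((hm t).mul (hm (t + h))).mul (hm (t + k))).mul (hm (t + h + k))).aestronglyMeasurable
  have hpL : ∀ t, MemLp (p t) 2 P := fun t => (memLp_two_iff_integrable_sq (hpm t)).mpr (hsq t).1
  have hpp : ∀ s t, Integrable (fun ω => p s ω * p t ω) P := fun s t =>
    (hpL s).integrable_mul (hpL t)
  have horth : ∀ s t, s ≠ t → ∫ ω, p s ω * p t ω ∂P = 0 := by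
    intro s t hst
    rcases lt_or_gt_of_ne hst with hlt | hlt
    · exact integral_fourfold_mul_eq_zero hf hm h0 hh hk hlt
    · rw [← integral_fourfold_mul_eq_zero hf hm h0 hh hk hlt]
      congr 1; ext ω; simp only [hp]; ring
  have e : (fun ω => quadCorr n h k (fun t => f t ω) ^ 2)
      = fun ω => ∑ s ∈ Finset.Icc 1 n, ∑ t ∈ Finset.Icc 1 n, p s ω * p t ω := by
    ext ω; rw [sq, quadCorr, Finset.sum_mul_sum]
  rw [e]
  refine ⟨integrable_finsetSum _ fun s _ => integrable_finsetSum _ fun t _ => hpp s t, ?_⟩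
  rw [integral_finsetSum _ fun s _ => integrable_finsetSum _ fun t _ => hpp s t]
  have : ∀ s ∈ Finset.Icc 1 n, ∫ ω, ∑ t ∈ Finset.Icc 1 n, p s ω * p t ω ∂P ≤ v ^ 4 := by
    intro s hs
    rw [integral_finsetSum _ fun t _ => hpp s t, Finset.sum_eq_single_of_mem s hs
      (fun t _ hts => horth s t hts.symm)]
    simpa [sq] using (hsq s).2
  refine (Finset.sum_le_sum this).trans ?_
  simp

/-- Layer by layer the means are of order q^4, then q^8 · q^4 / q^6 = q^6, then q^8 · q^6 / q^7 =
q^7, which is n^(7/8). -/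
theorem phaseMajorant_integral_le [IsProbabilityMeasure P] (hf : iIndepFun f P)
    (hL : ∀ t, MemLp (f t) 2 P)
    (h0 : ∀ t, ∫ ω, f t ω ∂P = 0) (hv : ∀ t, ∫ ω, f t ω ^ 2 ∂P ≤ v) {q : ℕ} (hq : 0 < q) :
    Integrable (fun ω => phaseMajorant q (fun t => f t ω)) P ∧
      ∫ ω, phaseMajorant q (fun t => f t ω) ∂P
        ≤ (2 * v + 12 * v ^ 2 + 4 * v ^ 4 + 7) * (q : ℝ) ^ 7 := by
  have hq1 : (1 : ℝ) ≤ q := by exact_mod_cast hq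
  have hq0 : (0 : ℝ) < q := by linarith
  have hvnn : 0 ≤ v := (integral_nonneg fun ω => sq_nonneg _).trans (hv 0)
  have hcard : ∀ s ⊆ Finset.Icc 1 (q ^ 8), (s.card : ℝ) ≤ (q : ℝ) ^ 8 := by
    intro s hs
    have := Finset.card_le_card hs
    simp at this
    exact_mod_cast this
  have hA : Integrable (fun ω => ∑ t ∈ Finset.Icc 1 (q ^ 8), f t ω ^ 2) P ∧
      ∫ ω, ∑ t ∈ Finset.Icc 1 (q ^ 8), f t ω ^ 2 ∂P ≤ (q : ℝ) ^ 8 * v := by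
    refine ⟨integrable_finsetSum _ fun t _ => (hL t).integrable_sq, ?_⟩
    rw [integral_finsetSum _ fun t _ => (hL t).integrable_sq]
    refine (Finset.sum_le_card_nsmul _ _ v fun t _ => hv t).trans ?_
    rw [nsmul_eq_mul]
    exact mul_le_mul_of_nonneg_right (hcard _ subset_rfl) hvnn
  have hY : ∀ h ∈ Finset.Ico 1 (q ^ 8),
      Integrable (fun ω => ∑ t ∈ Finset.Icc 1 (q ^ 8), (f t ω * f (t + h) ω) ^ 2) P ∧
      ∫ ω, ∑ t ∈ Finset.Icc 1 (q ^ 8), (f t ω * f (t + h) ω) ^ 2 ∂P ≤ (q : ℝ) ^ 8 * v ^ 2 := by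
    intro h hh
    have hne : ∀ t, t ≠ t + h := fun t => by simp at hh; omega
    have hi := fun t => integrable_sq_mul_sq hf hL (hne t)
    refine ⟨integrable_finsetSum _ fun t _ => hi t, ?_⟩
    rw [integral_finsetSum _ fun t _ => hi t]
    refine (Finset.sum_le_card_nsmul _ _ (v ^ 2)
      fun t _ => integral_sq_mul_sq_le hf hL hv (hne t)).trans ?_
    rw [nsmul_eq_mul]
    exact mul_le_mul_of_nonneg_right (hcard _ subset_rfl) (by positivity)
  have hQ : ∀ h ∈ Finset.Ico 1 (q ^ 8), ∀ k ∈ (Finset.Ico 1 (q ^ 8)).erase h,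
      Integrable (fun ω => quadCorr (q ^ 8) h k (fun t => f t ω) ^ 2 / (q : ℝ) ^ 4 + (q : ℝ) ^ 4) P
      ∧ ∫ ω, (quadCorr (q ^ 8) h k (fun t => f t ω) ^ 2 / (q : ℝ) ^ 4 + (q : ℝ) ^ 4) ∂P
        ≤ (q : ℝ) ^ 4 * (v ^ 4 + 1) := by
    intro h hh k hk
    simp only [Finset.mem_erase, Finset.mem_Ico] at hh hk
    obtain ⟨i1, i2⟩ := quadCorr_sq hf hL h0 hv (q ^ 8) (h := h) (k := k) (by omega) (by omega) hk.1
    refine ⟨(i1.div_const _).add (integrable_const _), ?_⟩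
    rw [integral_add (i1.div_const _) (integrable_const _), integral_div]
    simp only [integral_const, probReal_univ, one_smul]
    rw [div_add' _ _ _ (by positivity), div_le_iff₀ (by positivity)]
    push_cast at i2
    nlinarith
  have hB : ∀ h ∈ Finset.Ico 1 (q ^ 8),
      Integrable (fun ω => (6 * ∑ t ∈ Finset.Icc 1 (q ^ 8), (f t ω * f (t + h) ω) ^ 2
        + 2 * ∑ k ∈ (Finset.Ico 1 (q ^ 8)).erase h,
          (quadCorr (q ^ 8) h k (fun t => f t ω) ^ 2 / (q : ℝ) ^ 4 + (q : ℝ) ^ 4)) / (q : ℝ) ^ 6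
          + (q : ℝ) ^ 6) P
      ∧ ∫ ω, ((6 * ∑ t ∈ Finset.Icc 1 (q ^ 8), (f t ω * f (t + h) ω) ^ 2
        + 2 * ∑ k ∈ (Finset.Ico 1 (q ^ 8)).erase h,
          (quadCorr (q ^ 8) h k (fun t => f t ω) ^ 2 / (q : ℝ) ^ 4 + (q : ℝ) ^ 4)) / (q : ℝ) ^ 6
          + (q : ℝ) ^ 6) ∂P ≤ (q : ℝ) ^ 6 * (6 * v ^ 2 + 2 * v ^ 4 + 3) := by
    intro h hh
    have j2 := integrable_finsetSum _ fun k hk => (hQ h hh k hk).1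
    have j1 := (hY h hh).1.const_mul 6
    have j3 := (j1.add (j2.const_mul 2)).div_const ((q : ℝ) ^ 6)
    refine ⟨j3.add (integrable_const _), ?_⟩
    have e2 : ∫ ω, ∑ k ∈ (Finset.Ico 1 (q ^ 8)).erase h,
        (quadCorr (q ^ 8) h k (fun t => f t ω) ^ 2 / (q : ℝ) ^ 4 + (q : ℝ) ^ 4) ∂P
        ≤ (q : ℝ) ^ 8 * ((q : ℝ) ^ 4 * (v ^ 4 + 1)) := by
      rw [integral_finsetSum _ fun k hk => (hQ h hh k hk).1]
      refine (Finset.sum_le_card_nsmul _ _ _ fun k hk => (hQ h hh k hk).2).trans ?_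
      rw [nsmul_eq_mul]
      refine mul_le_mul_of_nonneg_right (hcard _ ?_) (by positivity)
      exact (Finset.erase_subset _ _).trans Finset.Ico_subset_Icc_self
    have e1 := (hY h hh).2
    rw [integral_add (f := fun ω => (6 * ∑ t ∈ Finset.Icc 1 (q ^ 8), (f t ω * f (t + h) ω) ^ 2
        + 2 * ∑ k ∈ (Finset.Ico 1 (q ^ 8)).erase h,
          (quadCorr (q ^ 8) h k (fun t => f t ω) ^ 2 / (q : ℝ) ^ 4 + (q : ℝ) ^ 4)) / (q : ℝ) ^ 6)
        j3 (integrable_const _), integral_div, integral_add j1 (j2.const_mul 2),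
      integral_const_mul, integral_const_mul]
    simp only [integral_const, probReal_univ, one_smul]
    rw [div_add' _ _ _ (by positivity), div_le_iff₀ (by positivity)]
    have h12 : (q : ℝ) ^ 8 ≤ (q : ℝ) ^ 12 := pow_le_pow_right₀ hq1 (by norm_num)
    have h13 : (q : ℝ) ^ 8 * v ^ 2 ≤ (q : ℝ) ^ 12 * v ^ 2 :=
      mul_le_mul_of_nonneg_right h12 (by positivity)
    calc _ ≤ 6 * ((q : ℝ) ^ 12 * v ^ 2) + 2 * ((q : ℝ) ^ 8 * ((q : ℝ) ^ 4 * (v ^ 4 + 1)))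
          + (q : ℝ) ^ 6 * (q : ℝ) ^ 6 := by gcongr; exact e1.trans h13
      _ = _ := by ring
  have j2 := integrable_finsetSum _ fun h hh => (hB h hh).1
  have j1 := hA.1.const_mul 2
  have j3 := (j1.add (j2.const_mul 2)).div_const ((q : ℝ) ^ 7)
  have j4 := (j3.add (integrable_const ((q : ℝ) ^ 7))).div_const 2
  refine ⟨j4, ?_⟩
  have e2 : ∫ ω, ∑ h ∈ Finset.Ico 1 (q ^ 8),
      ((6 * ∑ t ∈ Finset.Icc 1 (q ^ 8), (f t ω * f (t + h) ω) ^ 2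
        + 2 * ∑ k ∈ (Finset.Ico 1 (q ^ 8)).erase h,
          (quadCorr (q ^ 8) h k (fun t => f t ω) ^ 2 / (q : ℝ) ^ 4 + (q : ℝ) ^ 4)) / (q : ℝ) ^ 6
          + (q : ℝ) ^ 6) ∂P
      ≤ (q : ℝ) ^ 8 * ((q : ℝ) ^ 6 * (6 * v ^ 2 + 2 * v ^ 4 + 3)) := by
    rw [integral_finsetSum _ fun h hh => (hB h hh).1]
    refine (Finset.sum_le_card_nsmul _ _ _ fun h hh => (hB h hh).2).trans ?_
    rw [nsmul_eq_mul]
    exact mul_le_mul_of_nonneg_right (hcard _ Finset.Ico_subset_Icc_self) (by positivity)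
  have hdef : ∀ ω, phaseMajorant q (fun t => f t ω) = ((2 * ∑ t ∈ Finset.Icc 1 (q ^ 8), f t ω ^ 2
      + 2 * ∑ h ∈ Finset.Ico 1 (q ^ 8),
      ((6 * ∑ t ∈ Finset.Icc 1 (q ^ 8), (f t ω * f (t + h) ω) ^ 2
        + 2 * ∑ k ∈ (Finset.Ico 1 (q ^ 8)).erase h,
          (quadCorr (q ^ 8) h k (fun t => f t ω) ^ 2 / (q : ℝ) ^ 4 + (q : ℝ) ^ 4)) / (q : ℝ) ^ 6
          + (q : ℝ) ^ 6)) / (q : ℝ) ^ 7 + (q : ℝ) ^ 7) / 2 := fun ω => rfl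
  simp only [hdef]
  rw [integral_div, integral_add (f := fun ω => (2 * ∑ t ∈ Finset.Icc 1 (q ^ 8), f t ω ^ 2
      + 2 * ∑ h ∈ Finset.Ico 1 (q ^ 8),
      ((6 * ∑ t ∈ Finset.Icc 1 (q ^ 8), (f t ω * f (t + h) ω) ^ 2
        + 2 * ∑ k ∈ (Finset.Ico 1 (q ^ 8)).erase h,
          (quadCorr (q ^ 8) h k (fun t => f t ω) ^ 2 / (q : ℝ) ^ 4 + (q : ℝ) ^ 4)) / (q : ℝ) ^ 6
          + (q : ℝ) ^ 6)) / (q : ℝ) ^ 7) j3 (integrable_const _), integral_div,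
    integral_add j1 (j2.const_mul 2), integral_const_mul, integral_const_mul]
  simp only [integral_const, probReal_univ, one_smul]
  have h14 : (q : ℝ) ^ 8 ≤ (q : ℝ) ^ 14 := pow_le_pow_right₀ hq1 (by norm_num)
  have e1 : ∫ ω, ∑ t ∈ Finset.Icc 1 (q ^ 8), f t ω ^ 2 ∂P ≤ (q : ℝ) ^ 14 * v :=
    hA.2.trans (mul_le_mul_of_nonneg_right h14 hvnn)
  rw [div_add' _ _ _ (by positivity), div_div, div_le_iff₀ (by positivity)]
  calc _ ≤ 2 * ((q : ℝ) ^ 14 * v) + 2 * ((q : ℝ) ^ 8 * ((q : ℝ) ^ 6 *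
          (6 * v ^ 2 + 2 * v ^ 4 + 3))) + (q : ℝ) ^ 7 * (q : ℝ) ^ 7 := by gcongr
    _ = (q : ℝ) ^ 14 * (2 * v + 2 * (6 * v ^ 2 + 2 * v ^ 4 + 3) + 1) := by ring
    _ ≤ (q : ℝ) ^ 14 * ((2 * v + 12 * v ^ 2 + 4 * v ^ 4 + 7) * 2) := by
        gcongr
        nlinarith [sq_nonneg v, sq_nonneg (v ^ 2)]
    _ = _ := by ring

end Moments

/-! ### Exponential sums weighted by a linear process -/

/-- The innovations shifted by `j` and restricted to the window `1, …, n`. -/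
noncomputable def windowed {Ω : Type*} (e : ℤ → Ω → ℝ) (j : ℤ) (n t : ℕ) (ω : Ω) : ℝ :=
  if t ∈ Finset.Icc 1 n then e (t - j) ω else 0

/-- The integers between consecutive sixteenth powers. -/
def gapBlock (k : ℕ) : Finset ℕ := Finset.Ioc ((k + 1) ^ 16) ((k + 2) ^ 16)

theorem sum_windowed {Ω : Type*} (e : ℤ → Ω → ℝ) (j : ℤ) (n : ℕ) (ω : Ω) (g : ℕ → ℂ) :
    ∑ t ∈ Finset.Icc 1 n, (windowed e j n t ω : ℂ) * g t
      = ∑ t ∈ Finset.Icc 1 n, (e (t - j) ω : ℂ) * g t :=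
  Finset.sum_congr rfl fun t ht => by rw [windowed, if_pos ht]

theorem hasSum_sum_mul {Ω : Type*} {a : ℤ → ℝ} {e X : ℤ → Ω → ℝ} {ω : Ω}
    (h : ∀ t : ℤ, HasSum (fun j => a j * e (t - j) ω) (X t ω)) (s : Finset ℕ) (g : ℕ → ℂ) :
    HasSum (fun j => (a j : ℂ) * ∑ t ∈ s, (e ((t : ℤ) - j) ω : ℂ) * g t)
      (∑ t ∈ s, (X t ω : ℂ) * g t) := by
  have h1 : HasSum (fun j => ∑ t ∈ s, ((a j * e ((t : ℤ) - j) ω : ℝ) : ℂ) * g t)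
      (∑ t ∈ s, (X t ω : ℂ) * g t) :=
    hasSum_sum fun t _ => (Complex.hasSum_ofReal.mpr (h t)).mul_right (g t)
  convert h1 using 2 with j
  rw [Finset.mul_sum]
  exact Finset.sum_congr rfl fun t _ => by push_cast; ring

theorem enorm_hasSum_mul_le {a : ℤ → ℝ} {z : ℤ → ℂ} {S : ℂ} {m : ℤ → ℝ}
    (h : HasSum (fun j => (a j : ℂ) * z j) S) (hz : ∀ j, ‖z j‖ ≤ m j) :
    ‖S‖ₑ ≤ ∑' j, ENNReal.ofReal (|a j| * m j) := by
  rw [← h.tsum_eq]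
  refine enorm_tsum_le_tsum_enorm.trans (ENNReal.tsum_le_tsum fun j => ?_)
  rw [← ofReal_norm]
  apply ENNReal.ofReal_le_ofReal
  rw [norm_mul, Complex.norm_real, Real.norm_eq_abs]
  exact mul_le_mul_of_nonneg_left (hz j) (abs_nonneg _)

theorem norm_sum_mul_cis_le (s : Finset ℕ) (x θ : ℕ → ℝ) {c : ℝ} (hc : 0 < c) :
    ‖∑ t ∈ s, (x t : ℂ) * cis (θ t)‖ ≤ (s.card * ∑ t ∈ s, x t ^ 2) / c / 2 + c / 2 := by
  have h1 : ‖∑ t ∈ s, (x t : ℂ) * cis (θ t)‖ ^ 2 ≤ s.card * ∑ t ∈ s, x t ^ 2 := by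
    calc _ ≤ (∑ t ∈ s, |x t|) ^ 2 := by
          gcongr
          refine (norm_sum_le _ _).trans (le_of_eq ?_)
          simp
      _ ≤ s.card * ∑ t ∈ s, |x t| ^ 2 := sq_sum_le_card_mul_sum_sq
      _ = _ := by simp
  have h2 := abs_le_half_div_add ‖∑ t ∈ s, (x t : ℂ) * cis (θ t)‖ c hc
  rw [abs_norm] at h2
  calc _ ≤ _ := h2
    _ ≤ ((s.card * ∑ t ∈ s, x t ^ 2) / c + c) / 2 := by gcongr
    _ = _ := by ring

theorem phaseMajorant_nonneg (q : ℕ) (x : ℕ → ℝ) : 0 ≤ phaseMajorant q x := by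
  unfold phaseMajorant; positivity

/-- AM–GM at scale N l: the first term is quadratic in the innovations and has a computable mean,
the second is deterministic and small with l. The larger set s' lets one bound serve every n inside
a gap. -/
theorem enorm_sum_subset_le {Ω : Type*} {a : ℤ → ℝ} {e X : ℤ → Ω → ℝ} {ω : Ω}
    (ha : Summable fun j => |a j|)
    (h : ∀ t : ℤ, HasSum (fun j => a j * e (t - j) ω) (X t ω)) {s s' : Finset ℕ} (hs : s ⊆ s')
    (θ : ℕ → ℝ) {N l : ℝ} (hN : 0 < N) (hl : 0 < l) :
    ‖∑ t ∈ s, (X t ω : ℂ) * cis (θ t)‖ₑ ≤ ENNReal.ofReal N * (ENNReal.ofReal (1 / (2 * l)) *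
      (∑' j, ENNReal.ofReal (|a j| * ((s'.card : ℝ) * ∑ t ∈ s', e ((t : ℤ) - j) ω ^ 2 / N ^ 2)))
        + ENNReal.ofReal ((∑' j, |a j|) * (l / 2))) := by
  have hle := enorm_hasSum_mul_le (hasSum_sum_mul h s (fun t => cis (θ t)))
    (m := fun j => N * (1 / (2 * l) *
      ((s'.card : ℝ) * ∑ t ∈ s', e ((t : ℤ) - j) ω ^ 2 / N ^ 2) + l / 2)) (by
      intro j
      refine (norm_sum_mul_cis_le _ (fun t => e ((t : ℤ) - j) ω) _ (mul_pos hN hl)).trans ?_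
      rw [← Finset.sum_div]
      have h1 : (s.card : ℝ) * ∑ t ∈ s, e ((t : ℤ) - j) ω ^ 2 ≤
          (s'.card : ℝ) * ∑ t ∈ s', e ((t : ℤ) - j) ω ^ 2 := by
        apply mul_le_mul
        · exact_mod_cast Finset.card_le_card hs
        · exact Finset.sum_le_sum_of_subset_of_nonneg hs fun _ _ _ => sq_nonneg _
        · positivity
        · positivity
      calc _ ≤ ((s'.card : ℝ) * ∑ t ∈ s', e ((t : ℤ) - j) ω ^ 2) / (N * l) / 2
            + N * l / 2 := by gcongr
        _ = _ := by field_simp)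
  refine hle.trans (le_of_eq ?_)
  rw [← tsum_mul_right, ENNReal.ofReal_tsum_of_nonneg
    (fun j => mul_nonneg (abs_nonneg _) (by positivity)) (ha.mul_right _),
    ← ENNReal.tsum_mul_left, ← ENNReal.tsum_add, ← ENNReal.tsum_mul_left]
  congr 1; ext j
  rw [← ENNReal.ofReal_mul (by positivity), ← ENNReal.ofReal_add (by positivity) (by positivity),
    ← ENNReal.ofReal_mul hN.le]
  congr 1; ring

theorem enorm_sum_window_le {Ω : Type*} {a : ℤ → ℝ} {e X : ℤ → Ω → ℝ} {ω : Ω}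
    (h : ∀ t : ℤ, HasSum (fun j => a j * e (t - j) ω) (X t ω)) {q : ℕ} (hq : 0 < q) (γ η : ℝ)
    {N : ℝ} (hN : 0 < N) :
    ‖∑ t ∈ Finset.Icc 1 (q ^ 8), (X t ω : ℂ) * cis (γ * t ^ 2 + η * t)‖ₑ ≤ ENNReal.ofReal N *
      ∑' j, ENNReal.ofReal (|a j| * (phaseMajorant q (fun t => windowed e j (q ^ 8) t ω) / N)) := by
  have hle := enorm_hasSum_mul_le (hasSum_sum_mul h (Finset.Icc 1 (q ^ 8))
    (fun t => cis (γ * t ^ 2 + η * t))) (m := fun j => N *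
      (phaseMajorant q (fun t => windowed e j (q ^ 8) t ω) / N)) (by
      intro j
      rw [mul_div_cancel₀ _ hN.ne']
      have := norm_sum_quadratic_phase_le hq (fun t => windowed e j (q ^ 8) t ω)
        (by simp [windowed]) (fun t ht => by
          simp only [windowed, Finset.mem_Icc]
          rw [if_neg (by omega)]) γ η
      rwa [sum_windowed] at this)
  refine hle.trans (le_of_eq ?_)
  rw [← ENNReal.tsum_mul_left]
  congr 1; ext j
  rw [← ENNReal.ofReal_mul hN.le]
  congr 1; ring

/-! ### Almost sure bounds: sixteenth powers, gaps, and their combination. -/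

section Noise

variable {Ω : Type*} [MeasurableSpace Ω] {P : Measure Ω}

/-- By Tonelli the double sum over k and j has expectation at most ∑ |a j| · ∑ b k; it is therefore
almost surely finite, and its terms in k tend to 0. -/
theorem ae_tendsto_tsum_ofReal_zero {a : ℤ → ℝ} (ha : Summable fun j => |a j|)
    {G : ℕ → ℤ → Ω → ℝ} {b : ℕ → ℝ} (hG : ∀ k j ω, 0 ≤ G k j ω)
    (hi : ∀ k j, Integrable (G k j) P) (hb : ∀ k j, ∫ ω, G k j ω ∂P ≤ b k) (hsb : Summable b) :
    ∀ᵐ ω ∂P, Tendsto (fun k => ∑' j, ENNReal.ofReal (|a j| * G k j ω)) atTop (𝓝 0) := by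
  have hb0 : ∀ k, 0 ≤ b k := fun k => (integral_nonneg fun ω => hG k 0 ω).trans (hb k 0)
  have hm : ∀ k j, AEMeasurable (fun ω => ENNReal.ofReal (|a j| * G k j ω)) P := fun k j =>
    ((hi k j).const_mul _).aestronglyMeasurable.aemeasurable.ennreal_ofReal
  have hle : ∀ k j, ∫⁻ ω, ENNReal.ofReal (|a j| * G k j ω) ∂P ≤
      ENNReal.ofReal |a j| * ENNReal.ofReal (b k) := by
    intro k j
    rw [← ofReal_integral_eq_lintegral_ofReal ((hi k j).const_mul _)
      (Eventually.of_forall fun ω => mul_nonneg (abs_nonneg _) (hG k j ω)), integral_const_mul,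
      ← ENNReal.ofReal_mul (abs_nonneg _)]
    exact ENNReal.ofReal_le_ofReal (mul_le_mul_of_nonneg_left (hb k j) (abs_nonneg _))
  have hfin : ∫⁻ ω, ∑' k, ∑' j, ENNReal.ofReal (|a j| * G k j ω) ∂P ≠ ⊤ := by
    rw [lintegral_tsum fun k => AEMeasurable.tsum fun j => hm k j]
    have h1 : ∀ k, ∫⁻ ω, ∑' j, ENNReal.ofReal (|a j| * G k j ω) ∂P ≤
        ENNReal.ofReal (∑' j, |a j|) * ENNReal.ofReal (b k) := by
      intro k
      rw [lintegral_tsum fun j => hm k j]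
      refine (ENNReal.tsum_le_tsum fun j => hle k j).trans ?_
      rw [ENNReal.tsum_mul_right, ENNReal.ofReal_tsum_of_nonneg (fun j => abs_nonneg _) ha]
    refine ne_top_of_le_ne_top ?_ (ENNReal.tsum_le_tsum h1)
    rw [ENNReal.tsum_mul_left, ← ENNReal.ofReal_tsum_of_nonneg hb0 hsb]
    exact ENNReal.mul_ne_top ENNReal.ofReal_ne_top ENNReal.ofReal_ne_top
  have hae := ae_lt_top' (AEMeasurable.tsum fun k => AEMeasurable.tsum fun j => hm k j) hfin
  filter_upwards [hae] with ω hω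
  exact ENNReal.tendsto_atTop_zero_of_tsum_ne_top hω.ne

/-- `x` annihilates all quadratic phases, uniformly: `∑_{t ≤ n} x(t) e^{i(γ t² + η t)} = o(n)`. -/
def QuadraticNull (x : ℕ → ℝ) : Prop :=
  ∀ ε > 0, ∀ᶠ n : ℕ in atTop, ∀ γ η : ℝ,
    ‖∑ t ∈ Finset.Icc 1 n, (x t : ℂ) * cis (γ * t ^ 2 + η * t)‖ ≤ ε * n

theorem succ_pow_sub_pow_le (k m : ℕ) (hk : 0 < k) :
    ((k + 1) ^ (m + 1) - k ^ (m + 1) : ℝ) ≤ (m + 1) * 2 ^ m * k ^ m := by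
  have hk1 : (1 : ℝ) ≤ k := by exact_mod_cast hk
  have h1 : ∀ m : ℕ, ((k + 1) ^ (m + 1) - k ^ (m + 1) : ℝ) ≤ (m + 1) * (k + 1) ^ m := by
    intro m
    induction m with
    | zero => simp
    | succ m ih =>
      have h3 : (k : ℝ) ^ (m + 1) ≤ (k + 1) ^ (m + 1) := by gcongr; linarith
      have h4 : (k : ℝ) * ((k + 1) ^ (m + 1) - k ^ (m + 1))
        ≤ (k + 1) * ((m + 1) * (k + 1) ^ m) := by
        apply mul_le_mul (by linarith) ih (by linarith) (by linarith)
      push_cast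
      calc _ = (k : ℝ) * ((k + 1) ^ (m + 1) - k ^ (m + 1)) + (k + 1) ^ (m + 1) := by ring
        _ ≤ (k + 1) * ((m + 1) * (k + 1) ^ m) + (k + 1) ^ (m + 1) := by linarith
        _ = _ := by ring
  have h2 : ((k : ℝ) + 1) ^ m ≤ (2 * k) ^ m := by gcongr; linarith
  calc _ ≤ ((m : ℝ) + 1) * (k + 1) ^ m := h1 m
    _ ≤ (m + 1) * (2 * k) ^ m := by gcongr
    _ = _ := by rw [mul_pow]; ring

theorem IsLinearProcess.integral_sq {σ : ℝ} {a : ℤ → ℝ} {e X : ℤ → Ω → ℝ}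
    [IsProbabilityMeasure P] (hX : IsLinearProcess P σ a e X) (t : ℤ) :
    ∫ ω, e t ω ^ 2 ∂P = σ ^ 2 := by
  have h := hX.var t
  rw [variance_eq_sub (hX.memLp t), hX.mean t] at h
  simpa using h

theorem phaseMajorant_windowed [IsProbabilityMeasure P] {σ : ℝ} {a : ℤ → ℝ} {e X : ℤ → Ω → ℝ}
    (hX : IsLinearProcess P σ a e X) {q : ℕ} (hq : 0 < q) (j : ℤ) :
    Integrable (fun ω => phaseMajorant q (fun t => windowed e j (q ^ 8) t ω)) P ∧
      ∫ ω, phaseMajorant q (fun t => windowed e j (q ^ 8) t ω) ∂P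
        ≤ (2 * σ ^ 2 + 12 * (σ ^ 2) ^ 2 + 4 * (σ ^ 2) ^ 4 + 7) * (q : ℝ) ^ 7 := by
  have hind : iIndepFun (fun t => windowed e j (q ^ 8) t) P := by
    have h1 : iIndepFun (fun t : ℕ => e (t - j)) P :=
      hX.indep.precomp (g := fun t : ℕ => (t : ℤ) - j) (fun s t h => by simpa using h)
    have h2 := h1.comp (fun t x => if t ∈ Finset.Icc 1 (q ^ 8) then x else 0)
      (fun t => by split_ifs <;> fun_prop)
    exact h2
  have hz : ∀ t, t ∉ Finset.Icc 1 (q ^ 8) → windowed e j (q ^ 8) t = fun _ => (0 : ℝ) := by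
    intro t ht; ext ω; rw [windowed, if_neg ht]
  have hnz : ∀ t, t ∈ Finset.Icc 1 (q ^ 8) → windowed e j (q ^ 8) t = e (t - j) := by
    intro t ht; ext ω; rw [windowed, if_pos ht]
  apply phaseMajorant_integral_le hind _ _ _ hq
  · intro t
    by_cases ht : t ∈ Finset.Icc 1 (q ^ 8)
    · rw [hnz t ht]; exact hX.memLp _
    · rw [hz t ht]; exact MemLp.zero'
  · intro t
    by_cases ht : t ∈ Finset.Icc 1 (q ^ 8)
    · rw [hnz t ht]; exact hX.mean _
    · rw [hz t ht]; simp
  · intro t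
    by_cases ht : t ∈ Finset.Icc 1 (q ^ 8)
    · rw [hnz t ht]; exact (hX.integral_sq _).le
    · rw [hz t ht]; simp; positivity

/-- With q = (k + 1)² the mean is of order (k + 1)^14 against a window of length (k + 1)^16, and the
quotients (k + 1)^(-2) are summable. -/
theorem ae_tendsto_phaseMajorant [IsProbabilityMeasure P] {σ : ℝ} {a : ℤ → ℝ} {e X : ℤ → Ω → ℝ}
    (hX : IsLinearProcess P σ a e X) :
    ∀ᵐ ω ∂P, Tendsto (fun k : ℕ => ∑' j, ENNReal.ofReal (|a j| *
      (phaseMajorant ((k + 1) ^ 2) (fun t => windowed e j (((k + 1) ^ 2) ^ 8) t ω)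
        / ((k : ℝ) + 1) ^ 16))) atTop (𝓝 0) := by
  set C := 2 * σ ^ 2 + 12 * (σ ^ 2) ^ 2 + 4 * (σ ^ 2) ^ 4 + 7
  apply ae_tendsto_tsum_ofReal_zero hX.summable (b := fun k : ℕ => C * (1 / ((k : ℝ) + 1) ^ 2))
  · intro k j ω
    exact div_nonneg (phaseMajorant_nonneg _ _) (by positivity)
  · intro k j
    exact (phaseMajorant_windowed hX (by positivity) j).1.div_const _
  · intro k j
    rw [integral_div, div_le_iff₀ (by positivity)]
    refine (phaseMajorant_windowed hX (by positivity) j).2.trans (le_of_eq ?_)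
    push_cast
    have : (k : ℝ) + 1 ≠ 0 := by positivity
    field_simp
    ring
  · apply Summable.mul_left
    exact_mod_cast (summable_nat_add_iff 1).mpr
      (Real.summable_one_div_nat_pow.mpr (by norm_num : 1 < 2))

/-- A gap has O(k^15) elements, so the mean is of order k^30 / k^32, again summable. -/
theorem ae_tendsto_gap [IsProbabilityMeasure P] {σ : ℝ} {a : ℤ → ℝ} {e X : ℤ → Ω → ℝ}
    (hX : IsLinearProcess P σ a e X) :
    ∀ᵐ ω ∂P, Tendsto (fun k : ℕ => ∑' j, ENNReal.ofReal (|a j| *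
      (((gapBlock k).card : ℝ) *
        ∑ t ∈ gapBlock k, e ((t : ℤ) - j) ω ^ 2
          / (((k : ℝ) + 1) ^ 16) ^ 2))) atTop (𝓝 0) := by
  set C : ℝ := (((15 : ℕ) + 1) * 2 ^ 15) ^ 2 * σ ^ 2
  apply ae_tendsto_tsum_ofReal_zero hX.summable (b := fun k : ℕ => C * (1 / ((k : ℝ) + 1) ^ 2))
  · intro k j ω; positivity
  · intro k j
    exact (integrable_finsetSum _ fun t _ => (hX.memLp _).integrable_sq.div_const _).const_mul _
  · intro k j
    rw [integral_const_mul, integral_finsetSum _ fun t _ => (hX.memLp _).integrable_sq.div_const _]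
    simp only [integral_div, hX.integral_sq]
    rw [Finset.sum_const, nsmul_eq_mul]
    have hc : ((gapBlock k).card : ℝ)
        ≤ ((15 : ℕ) + 1) * 2 ^ 15 * ((k : ℝ) + 1) ^ 15 := by
      have := succ_pow_sub_pow_le (k + 1) 15 (by omega)
      rw [gapBlock, Nat.card_Ioc, Nat.cast_sub (by gcongr; omega)]
      push_cast at this ⊢
      convert this using 2
      ring
    calc _ ≤ (((15 : ℕ) + 1) * 2 ^ 15 * ((k : ℝ) + 1) ^ 15) *
          ((((15 : ℕ) + 1) * 2 ^ 15 * ((k : ℝ) + 1) ^ 15) * (σ ^ 2 / (((k : ℝ) + 1) ^ 16) ^ 2)) := by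
          gcongr
      _ = _ := by
          have : (k : ℝ) + 1 ≠ 0 := by positivity
          simp only [C]
          field_simp
  · apply Summable.mul_left
    exact_mod_cast (summable_nat_add_iff 1).mpr
      (Real.summable_one_div_nat_pow.mpr (by norm_num : 1 < 2))

theorem exists_pow_le_lt_pow (m : ℕ) (hm : 0 < m) (n : ℕ) (hn : 0 < n) :
    ∃ k : ℕ, (k + 1) ^ m ≤ n ∧ n < (k + 2) ^ m := by
  have h1 : (1 : ℕ) ^ m ≤ n := by rw [one_pow]; exact hn
  set K := Nat.findGreatest (fun k => k ^ m ≤ n) n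
  have hK : K ^ m ≤ n := Nat.findGreatest_spec (P := fun k => k ^ m ≤ n) hn h1
  have hK1 : 1 ≤ K := Nat.le_findGreatest hn h1
  have hK2 : n < (K + 1) ^ m := by
    by_contra hcon
    push Not at hcon
    have : K + 1 ≤ n := (Nat.le_self_pow hm.ne' _).trans hcon
    have := Nat.le_findGreatest (P := fun k => k ^ m ≤ n) this hcon
    omega
  exact ⟨K - 1, by rwa [Nat.sub_add_cancel hK1], by
    rwa [show K - 1 + 2 = K + 1 by omega]⟩

theorem IsLinearProcess.quadraticNull [IsProbabilityMeasure P] {σ : ℝ} {a : ℤ → ℝ}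
    {e X : ℤ → Ω → ℝ} (hX : IsLinearProcess P σ a e X) :
    ∀ᵐ ω ∂P, QuadraticNull (fun t => X t ω) := by
  filter_upwards [ae_tendsto_phaseMajorant hX, ae_tendsto_gap hX, ae_all_iff.mpr hX.hasSum]
    with ω hU hV hS ε hε
  set U : ℕ → ENNReal := fun k : ℕ => ∑' j, ENNReal.ofReal (|a j| *
      (phaseMajorant ((k + 1) ^ 2) (fun t => windowed e j (((k + 1) ^ 2) ^ 8) t ω)
        / ((k : ℝ) + 1) ^ 16)) with hUdef
  set V : ℕ → ENNReal := fun k : ℕ => ∑' j, ENNReal.ofReal (|a j| *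
      (((gapBlock k).card : ℝ) *
        ∑ t ∈ gapBlock k, e ((t : ℤ) - j) ω ^ 2
          / (((k : ℝ) + 1) ^ 16) ^ 2)) with hVdef
  set A := ∑' j, |a j| with hA
  have hA0 : 0 ≤ A := tsum_nonneg fun j => abs_nonneg _
  -- This l makes the deterministic part of the gap bound cost at most ε / 2; the two random parts
  -- cost ε / 4 each.
  obtain ⟨l, hl, hlA⟩ : ∃ l : ℝ, 0 < l ∧ A * (l / 2) ≤ ε / 2 := by
    refine ⟨ε / (A + 1), by positivity, ?_⟩
    rw [div_div, mul_div_assoc', div_le_iff₀ (by positivity)]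
    nlinarith
  have hV2 : Tendsto (fun k => ENNReal.ofReal (1 / (2 * l)) * V k) atTop (𝓝 0) := by
    have := ENNReal.Tendsto.const_mul hV (Or.inr (ENNReal.ofReal_ne_top (r := 1 / (2 * l))))
    simpa using this
  have hε4 : (0 : ENNReal) < ENNReal.ofReal (ε / 4) := by simpa using by linarith
  obtain ⟨K, hK⟩ := eventually_atTop.mp
    ((hU.eventually_le_const hε4).and (hV2.eventually_le_const hε4))
  filter_upwards [eventually_ge_atTop ((K + 2) ^ 16)] with n hn γ η
  obtain ⟨k, hk1, hk2⟩ := exists_pow_le_lt_pow 16 (by norm_num) n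
    (lt_of_lt_of_le (by positivity) hn)
  have hkK : K ≤ k := by
    by_contra hcon
    have : (k + 2) ^ 16 ≤ (K + 2) ^ 16 := by gcongr; omega
    omega
  obtain ⟨hKU, hKV⟩ := hK k hkK
  have hN : (0 : ℝ) < ((k : ℝ) + 1) ^ 16 := by positivity
  set N : ℝ := ((k : ℝ) + 1) ^ 16 with hNdef
  have hmain : ‖∑ t ∈ (Finset.Icc 1 (((k + 1) ^ 2) ^ 8) : Finset ℕ),
      (X t ω : ℂ) * cis (γ * t ^ 2 + η * t)‖ₑ ≤ ENNReal.ofReal N * U k :=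
    enorm_sum_window_le (N := N) hS (q := (k + 1) ^ 2) (pow_pos k.succ_pos 2) γ η hN
  rw [show ((k + 1) ^ 2) ^ 8 = (k + 1) ^ 16 by ring] at hmain
  have hsub : (Finset.Ioc ((k + 1) ^ 16) n : Finset ℕ) ⊆ gapBlock k := by
    intro t
    rw [gapBlock, Finset.mem_Ioc, Finset.mem_Ioc]
    exact fun h => ⟨h.1, h.2.trans hk2.le⟩
  have hgap : ‖∑ t ∈ (Finset.Ioc ((k + 1) ^ 16) n : Finset ℕ),
      (X t ω : ℂ) * cis (γ * t ^ 2 + η * t)‖ₑ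
      ≤ ENNReal.ofReal N * (ENNReal.ofReal (1 / (2 * l)) * V k + ENNReal.ofReal (A * (l / 2))) :=
    enorm_sum_subset_le hX.summable hS (s := Finset.Ioc ((k + 1) ^ 16) n) (s' := gapBlock k)
      hsub (fun t => γ * t ^ 2 + η * t) hN hl
  have hunion : Finset.Icc 1 n = Finset.Icc 1 ((k + 1) ^ 16) ∪ Finset.Ioc ((k + 1) ^ 16) n := by
    have : 1 ≤ (k + 1) ^ 16 := Nat.one_le_pow _ _ (by omega)
    ext t; simp only [Finset.mem_union, Finset.mem_Icc, Finset.mem_Ioc]; omega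
  rw [hunion, Finset.sum_union (by
    rw [Finset.disjoint_left]; intro t; simp only [Finset.mem_Icc, Finset.mem_Ioc]; omega)]
  have hfin : ‖∑ t ∈ (Finset.Icc 1 ((k + 1) ^ 16) : Finset ℕ), (X t ω : ℂ) * cis (γ * t ^ 2 + η * t)
      + ∑ t ∈ (Finset.Ioc ((k + 1) ^ 16) n : Finset ℕ), (X t ω : ℂ) * cis (γ * t ^ 2 + η * t)‖ₑ
      ≤ ENNReal.ofReal (N * ε) := by
    refine (enorm_add_le _ _).trans ((add_le_add hmain hgap).trans ?_)
    rw [← mul_add, ENNReal.ofReal_mul hN.le]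
    gcongr
    calc _ ≤ ENNReal.ofReal (ε / 4) + (ENNReal.ofReal (ε / 4) + ENNReal.ofReal (ε / 2)) := by
          gcongr
      _ = ENNReal.ofReal ε := by
          rw [← ENNReal.ofReal_add (by positivity) (by positivity),
            ← ENNReal.ofReal_add (by positivity) (by positivity)]
          congr 1; ring
  rw [← ofReal_norm, ENNReal.ofReal_le_ofReal_iff (mul_pos hN hε).le] at hfin
  have hNn : N ≤ n := by rw [hNdef]; exact_mod_cast hk1
  refine hfin.trans ?_
  rw [mul_comm]
  exact mul_le_mul_of_nonneg_left hNn hε.le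

end Noise

/-! ### Choosing a time at which a small mean is small -/

theorem sum_comp_le_of_injOn {v : ℕ → ℝ} (hv : ∀ t, 0 ≤ v t) {m n : ℕ} (g : ℕ → ℕ)
    (hg : Function.Injective g) (hmap : ∀ t ∈ Finset.Icc 1 m, g t ∈ Finset.Icc 1 n) :
    ∑ t ∈ Finset.Icc 1 m, v (g t) ≤ ∑ t ∈ Finset.Icc 1 n, v t := by
  rw [← Finset.sum_image (f := v) (g := g) (fun a _ b _ h => hg h)]
  apply Finset.sum_le_sum_of_subset_of_nonneg
  · intro t ht
    obtain ⟨s, hs, rfl⟩ := Finset.mem_image.mp ht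
    exact hmap s hs
  · intros; apply hv

/-- Average the sum of the five values over t ≤ n / 8: each contributes at most κ n ≤ 16 κ ⌊n / 8⌋,
and 5 · 16 = 80. At these five times the phases can be combined so that t cancels. -/
theorem exists_small_of_sum_le {v : ℕ → ℝ} (hv : ∀ t, 0 ≤ v t) {n s : ℕ} {κ : ℝ} (hn : 8 ≤ n)
    (hs : 8 * s ≤ n) (hsum : ∑ t ∈ Finset.Icc 1 n, v t ≤ κ * n) :
    ∃ t, 1 ≤ t ∧ v t ≤ 80 * κ ∧ v (t + s) ≤ 80 * κ ∧ v (2 * t) ≤ 80 * κ ∧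
      v (2 * t + s) ≤ 80 * κ ∧ v (3 * t) ≤ 80 * κ := by
  set m := n / 8 with hm
  have hm1 : 1 ≤ m := by omega
  have key : ∃ t ∈ Finset.Icc 1 m,
      v t + v (t + s) + v (2 * t) + v (2 * t + s) + v (3 * t) ≤ 80 * κ := by
    apply Finset.exists_le_of_sum_le (Finset.nonempty_Icc.mpr hm1)
    simp only [Finset.sum_add_distrib]
    have h1 := sum_comp_le_of_injOn hv (m := m) (n := n) (fun t => t) (fun a b h => h)
      (by intro t; simp; omega)
    have h2 := sum_comp_le_of_injOn hv (m := m) (n := n) (fun t => t + s)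
      (fun a b h => by simpa using h) (by intro t; simp; omega)
    have h3 := sum_comp_le_of_injOn hv (m := m) (n := n) (fun t => 2 * t)
      (fun a b h => by simpa using h) (by intro t; simp; omega)
    have h4 := sum_comp_le_of_injOn hv (m := m) (n := n) (fun t => 2 * t + s)
      (fun a b h => by simpa using h) (by intro t; simp; omega)
    have h5 := sum_comp_le_of_injOn hv (m := m) (n := n) (fun t => 3 * t)
      (fun a b h => by simpa using h) (by intro t; simp; omega)
    have hk : 0 ≤ κ * n := (Finset.sum_nonneg fun t _ => hv t).trans hsum
    have hκ : 0 ≤ κ := by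
      have : (0 : ℝ) < n := by exact_mod_cast (by omega : 0 < n)
      exact nonneg_of_mul_nonneg_left hk this
    have hmn : (n : ℝ) ≤ 16 * m := by exact_mod_cast (by omega : n ≤ 16 * m)
    rw [Finset.sum_const, Nat.card_Icc, nsmul_eq_mul]
    simp only [add_tsub_cancel_right]
    nlinarith
  obtain ⟨t, ht, hle⟩ := key
  have a1 := hv t
  have a2 := hv (t + s)
  have a3 := hv (2 * t)
  have a4 := hv (2 * t + s)
  have a5 := hv (3 * t)
  exact ⟨t, (Finset.mem_Icc.mp ht).1, by linarith, by linarith, by linarith, by linarith,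
    by linarith⟩

/-! ### The signals `p cos(γ t^d) + q sin(γ t^d)` -/

/-- The signal `p cos(γ t^d) + q sin(γ t^d)`. -/
noncomputable def trigSignal (d : ℕ) (p q γ : ℝ) (t : ℕ) : ℝ :=
  p * Real.cos (γ * (t : ℝ) ^ d) + q * Real.sin (γ * (t : ℝ) ^ d)

/-- The complex amplitude `p - i q`. -/
noncomputable def amplitude (p q : ℝ) : ℂ := ⟨p, -q⟩

theorem trigSignal_eq_re (d : ℕ) (p q γ : ℝ) (t : ℕ) :
    trigSignal d p q γ t = (amplitude p q * cis (γ * (t : ℝ) ^ d)).re := by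
  simp [trigSignal, amplitude, Complex.mul_re, cis_re, cis_im]

theorem norm_amplitude_sq (p q : ℝ) : ‖amplitude p q‖ ^ 2 = p ^ 2 + q ^ 2 := by
  rw [← Complex.normSq_eq_norm_sq, Complex.normSq_apply]; simp [amplitude]; ring

theorem norm_sq_add_norm_sq (z : ℂ) : ‖z ^ 2 + (‖z‖ : ℂ) ^ 2‖ = 2 * ‖z‖ * |z.re| := by
  have : z ^ 2 + (‖z‖ : ℂ) ^ 2 = z * ((2 * z.re : ℝ) : ℂ) := by
    rw [← Complex.mul_conj', ← Complex.add_conj]; ring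
  rw [this, norm_mul, Complex.norm_real, Real.norm_eq_abs, abs_mul]; norm_num; ring

theorem norm_cis_two_mul_sub_one (x : ℝ) : ‖cis (2 * x) - 1‖ = 2 * |Real.sin x| := by
  have h : cis (2 * x) - 1 = cis x * ((2 * Real.sin x : ℝ) * Complex.I) := by
    have h1 : cis (2 * x) = cis x * cis x := by rw [← cis_add]; ring_nf
    have h2 : (1 : ℂ) = cis x * star (cis x) := by rw [cis_mul_star]; simp
    have h3 : cis x - star (cis x) = (2 * Real.sin x : ℝ) * Complex.I := by
      change cis x - (starRingEnd ℂ) (cis x) = _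
      rw [Complex.sub_conj, cis_im]
    rw [← h3, mul_sub, ← h1, ← h2]
  rw [h, norm_mul, norm_cis, one_mul, norm_mul, Complex.norm_I, mul_one, Complex.norm_real,
    Real.norm_eq_abs, abs_mul]; norm_num

theorem norm_mul_sub_mul_le {a b a' b' : ℂ} (hb : ‖b‖ = 1) (ha' : ‖a'‖ = 1) {r s : ℝ}
    (h1 : ‖a - a'‖ ≤ r) (h2 : ‖b - b'‖ ≤ s) : ‖a * b - a' * b'‖ ≤ r + s := by
  have : a * b - a' * b' = (a - a') * b + a' * (b - b') := by ring
  rw [this]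
  refine (norm_add_le _ _).trans ?_
  rw [norm_mul, norm_mul, hb, ha', mul_one, one_mul]
  exact add_le_add h1 h2

/-- If `b e^{iδ t^d}` is close to `1` on average, then all `e^{iδ s^d}` with small `s` are close
to `1`. -/
theorem norm_cis_pow_sub_one_le {d : ℕ} (hd : d = 1 ∨ d = 2) {n : ℕ} (hn : 8 ≤ n) {b : ℂ} {δ τ : ℝ}
    (hb : ‖b‖ = 1) (hτ : 0 ≤ τ)
    (h : ∑ t ∈ Finset.Icc 1 n, ‖b * cis (δ * (t : ℝ) ^ d) - 1‖ ^ 2 ≤ τ ^ 2 / 80 * n)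
    {s : ℕ} (hs : 8 * s ≤ n) : ‖cis (δ * (s : ℝ) ^ d) - 1‖ ≤ 6 * τ := by
  obtain ⟨t, -, h1, h2, h3, h4, -⟩ := exists_small_of_sum_le
    (v := fun t => ‖b * cis (δ * (t : ℝ) ^ d) - 1‖ ^ 2) (fun t => sq_nonneg _) hn hs h
  set u : ℕ → ℂ := fun t => b * cis (δ * (t : ℝ) ^ d) with hu
  have hu1 : ∀ t, ‖u t‖ = 1 := fun t => by simp [hu, hb]
  have hsq : ∀ {t}, ‖u t - 1‖ ^ 2 ≤ 80 * (τ ^ 2 / 80) → ‖u t - 1‖ ≤ τ := by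
    intro t ht
    rw [mul_div_cancel₀ _ (by norm_num : (80 : ℝ) ≠ 0)] at ht
    exact (sq_le_sq₀ (norm_nonneg _) hτ).mp ht
  have h1' := hsq h1
  have h2' := hsq h2
  have h3' := hsq h3
  have h4' := hsq h4
  rcases hd with rfl | rfl
  · have e : u (t + s) - u t = u t * (cis (δ * (s : ℝ) ^ 1) - 1) := by
      have : cis (δ * ((t + s : ℕ) : ℝ) ^ 1) = cis (δ * (t : ℝ) ^ 1) * cis (δ * (s : ℝ) ^ 1) := by
        rw [← cis_add]; congr 1; push_cast; ring
      simp only [hu, this]; ring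
    have e2 : ‖u (t + s) - u t‖ = ‖cis (δ * (s : ℝ) ^ 1) - 1‖ := by rw [e, norm_mul, hu1, one_mul]
    rw [← e2]
    calc ‖u (t + s) - u t‖ = ‖(u (t + s) - 1) - (u t - 1)‖ := by ring_nf
      _ ≤ τ + τ := (norm_sub_le _ _).trans (add_le_add h2' h1')
      _ ≤ 6 * τ := by linarith
  -- The identity (2t)² + 2(t + s)² = (2t + s)² + 2t² + s² isolates s². Both sides have three
  -- factors, so b³ cancels, and the three differences cost 2τ each.
  · have e : u (2 * t) * (u (t + s) * u (t + s)) - u (2 * t + s) * (u t * u t)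
        = (u (2 * t + s) * (u t * u t)) * (cis (δ * (s : ℝ) ^ 2) - 1) := by
      have : cis (δ * ((2 * t : ℕ) : ℝ) ^ 2) *
          (cis (δ * ((t + s : ℕ) : ℝ) ^ 2) * cis (δ * ((t + s : ℕ) : ℝ) ^ 2))
          = cis (δ * ((2 * t + s : ℕ) : ℝ) ^ 2) *
            (cis (δ * (t : ℝ) ^ 2) * cis (δ * (t : ℝ) ^ 2)) * cis (δ * (s : ℝ) ^ 2) := by
        simp only [← cis_add]; congr 1; push_cast; ring
      simp only [hu]
      linear_combination b ^ 3 * this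
    have e2 : ‖u (2 * t) * (u (t + s) * u (t + s)) - u (2 * t + s) * (u t * u t)‖
        = ‖cis (δ * (s : ℝ) ^ 2) - 1‖ := by
      simp only [e, norm_mul _ (cis (δ * (s : ℝ) ^ 2) - 1), norm_mul (u _), hu1, one_mul]
    rw [← e2]
    have d1 : ∀ {x y}, ‖u x - 1‖ ≤ τ → ‖u y - 1‖ ≤ τ → ‖u x - u y‖ ≤ τ + τ := by
      intro x y hx hy
      calc ‖u x - u y‖ = ‖(u x - 1) - (u y - 1)‖ := by ring_nf
        _ ≤ _ := (norm_sub_le _ _).trans (add_le_add hx hy)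
    have := norm_mul_sub_mul_le (by rw [norm_mul, hu1, one_mul]) (hu1 _) (d1 h3' h4')
      (norm_mul_sub_mul_le (hu1 _) (hu1 _) (d1 h2' h1') (d1 h2' h1'))
    linarith

/-- Induction on s: since (s + 1)^d ≤ 4 s^d, the next argument is at most 8δ ≤ π / 2, so it has not
left the first quadrant and a small sine still means a small argument. -/
theorem mul_pow_le_of_abs_sin_le {d : ℕ} (hd : d = 1 ∨ d = 2) {γ δ : ℝ} (h0 : 0 ≤ γ)
    (h1 : γ ≤ Real.pi / 2) (hδ : 8 * δ ≤ Real.pi / 2) {m : ℕ}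
    (h : ∀ s : ℕ, s ≤ m → |Real.sin (γ * (s : ℝ) ^ d)| ≤ δ) :
    ∀ s : ℕ, 1 ≤ s → s ≤ m → γ * (s : ℝ) ^ d ≤ 2 * δ := by
  have key : ∀ x : ℝ, 0 ≤ x → x ≤ Real.pi / 2 → |Real.sin x| ≤ δ → x ≤ 2 * δ := by
    intro x hx0 hx1 hx
    have h2 := Real.mul_le_sin hx0 hx1
    have h3 := (le_abs_self _).trans hx
    have h4 : x ≤ δ * (Real.pi / 2) := by
      have := h2.trans h3
      rw [div_mul_eq_mul_div, div_le_iff₀ Real.pi_pos] at this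
      linarith
    have hδ0 : 0 ≤ δ := (abs_nonneg _).trans hx
    nlinarith [Real.pi_le_four]
  intro s hs
  induction s, hs using Nat.le_induction with
  | base =>
    intro hm
    have := h 1 hm
    simp only [Nat.cast_one, one_pow, mul_one] at this ⊢
    exact key γ h0 h1 this
  | succ s hs ih =>
    intro hm
    have ih' := ih (by omega)
    have hs1 : (1 : ℝ) ≤ s := by exact_mod_cast hs
    apply key _ (by positivity) _ (h _ hm)
    have h4 : ((s + 1 : ℕ) : ℝ) ^ d ≤ 4 * (s : ℝ) ^ d := by
      push_cast
      rcases hd with rfl | rfl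
      · simp only [pow_one]; linarith
      · nlinarith
    calc γ * ((s + 1 : ℕ) : ℝ) ^ d ≤ γ * (4 * (s : ℝ) ^ d) := by gcongr
      _ ≤ _ := by linarith

/-- `γ` is so close to an end point of `[0, π]` that `cos(γ t^d)` and `sin(γ t^d)` are nearly
collinear up to time `n`. -/
def NearEndpoint (d n : ℕ) (γ : ℝ) : Prop :=
  γ * (n : ℝ) ^ d ≤ 1 / 2 ∨ (Real.pi - γ) * (n : ℝ) ^ d ≤ 1 / 2

theorem abs_sin_pi_sub_mul (γ : ℝ) (m : ℕ) :
    |Real.sin ((Real.pi - γ) * m)| = |Real.sin (γ * m)| := by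
  have h : (Real.pi - γ) * m = m * Real.pi - γ * m := by ring
  rw [h, Real.sin_sub, Real.sin_nat_mul_pi, zero_mul, zero_sub, abs_neg, abs_mul,
    Real.cos_nat_mul_pi]
  simp

/-- For z = w e^{iγ t^d} one has |z² + |z|²| = 2 |z| |Re z|, so a signal of small energy makes b
e^{2iγ t^d} close to 1 on average, with b = -w² / |w|². Then sin(γ s^d) is small for all s ≤ n / 8,
which pins γ to an end point. -/
theorem exists_energy_lower_bound {d : ℕ} (hd : d = 1 ∨ d = 2) :
    ∃ c > 0, ∀ n ≥ 8, ∀ γ ∈ Icc 0 Real.pi, NearEndpoint d n γ ∨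
      ∀ p q : ℝ, c * n * (p ^ 2 + q ^ 2) ≤ ∑ t ∈ Finset.Icc 1 n, trigSignal d p q γ t ^ 2 := by
  -- Chosen so that 6τ = 2 / 1024: the sines are at most 1 / 1024, the arguments up to n / 8 at most
  -- 2 / 1024, and n^d ≤ 256 ⌊n / 8⌋^d yields 1 / 2.
  set τ : ℝ := 1 / 3072 with hτ
  refine ⟨τ ^ 2 / 80 / 4, by positivity, fun n hn γ hγ => ?_⟩
  by_contra hcon
  push Not at hcon
  obtain ⟨hne, p, q, hlt⟩ := hcon
  have hpq : 0 < p ^ 2 + q ^ 2 := by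
    rcases (by positivity : 0 ≤ p ^ 2 + q ^ 2).eq_or_lt with h | h
    · rw [← h, mul_zero] at hlt
      exact absurd hlt (not_lt.mpr (by positivity))
    · exact h
  set w := amplitude p q with hw
  have hw0 : 0 < ‖w‖ := by
    rcases (norm_nonneg w).eq_or_lt with h | h
    · have h2 := norm_amplitude_sq p q
      rw [← hw, ← h] at h2
      linarith
    · exact h
  have hwc : (‖w‖ : ℂ) ≠ 0 := by exact_mod_cast hw0.ne'
  set b : ℂ := -(w ^ 2 / (‖w‖ : ℂ) ^ 2) with hb
  have hb1 : ‖b‖ = 1 := by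
    rw [hb, norm_neg, norm_div, norm_pow, norm_pow, Complex.norm_real, norm_norm, div_self]
    positivity
  have hterm : ∀ t : ℕ, ‖b * cis (2 * γ * (t : ℝ) ^ d) - 1‖ ^ 2
      = 4 * trigSignal d p q γ t ^ 2 / (p ^ 2 + q ^ 2) := by
    intro t
    set z := w * cis (γ * (t : ℝ) ^ d) with hz
    have hz1 : ‖z‖ = ‖w‖ := by simp [hz]
    have e1 : b * cis (2 * γ * (t : ℝ) ^ d) - 1 = -(z ^ 2 + (‖z‖ : ℂ) ^ 2) / (‖w‖ : ℂ) ^ 2 := by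
      have : cis (2 * γ * (t : ℝ) ^ d) = cis (γ * (t : ℝ) ^ d) ^ 2 := by
        rw [← cis_nat_mul]; congr 1; push_cast; ring
      rw [this, hz1, hb, hz]
      field_simp
      ring
    rw [e1, norm_div, norm_neg, norm_sq_add_norm_sq, hz1, trigSignal_eq_re, ← hz, norm_pow,
      Complex.norm_real, norm_norm, ← norm_amplitude_sq, ← hw]
    have hw' := hw0.ne'
    field_simp
    rw [sq_abs]; ring
  have hsum : ∑ t ∈ Finset.Icc 1 n, ‖b * cis (2 * γ * (t : ℝ) ^ d) - 1‖ ^ 2 ≤ τ ^ 2 / 80 * n := by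
    rw [Finset.sum_congr rfl fun t _ => hterm t, ← Finset.sum_div, ← Finset.mul_sum,
      div_le_iff₀ hpq]
    linarith
  have hsin : ∀ s : ℕ, s ≤ n / 8 → |Real.sin (γ * (s : ℝ) ^ d)| ≤ 1 / 1024 := by
    intro s hs
    have h1 := norm_cis_pow_sub_one_le hd hn hb1 (by positivity) hsum (s := s) (by omega)
    rw [mul_assoc, norm_cis_two_mul_sub_one] at h1
    rw [hτ] at h1
    linarith
  have hend : ∀ γ' : ℝ, 0 ≤ γ' → γ' ≤ Real.pi / 2 →
      (∀ s : ℕ, s ≤ n / 8 → |Real.sin (γ' * (s : ℝ) ^ d)| ≤ 1 / 1024) →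
      γ' * (n : ℝ) ^ d ≤ 1 / 2 := by
    intro γ' h0 h1 hs
    have h2 := mul_pow_le_of_abs_sin_le hd h0 h1 (by linarith [Real.pi_gt_three]) hs (n / 8)
      (by omega) le_rfl
    have h3 : (n : ℝ) ≤ 16 * ((n / 8 : ℕ) : ℝ) := by exact_mod_cast (by omega : n ≤ 16 * (n / 8))
    have h4 : (n : ℝ) ^ d ≤ 256 * ((n / 8 : ℕ) : ℝ) ^ d := by
      have h5 : (0 : ℝ) ≤ ((n / 8 : ℕ) : ℝ) := Nat.cast_nonneg _
      rcases hd with rfl | rfl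
      · simp only [pow_one]; linarith
      · nlinarith [Nat.cast_nonneg (α := ℝ) n]
    calc γ' * (n : ℝ) ^ d ≤ γ' * (256 * ((n / 8 : ℕ) : ℝ) ^ d) := by gcongr
      _ ≤ 1 / 2 := by linarith
  apply hne
  rcases le_total γ (Real.pi / 2) with h | h
  · exact Or.inl (hend γ hγ.1 h hsin)
  · refine Or.inr (hend (Real.pi - γ) (by linarith [hγ.2]) (by linarith) fun s hs => ?_)
    have := abs_sin_pi_sub_mul γ (s ^ d)
    push_cast at this
    rw [this]; exact hsin s hs

/-! ### Nearly collinear regressors -/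

theorem sum_mul_eq_sub_sum_partial (r f : ℕ → ℝ) (n : ℕ) :
    ∑ t ∈ Finset.Icc 1 n, r t * f t = (∑ t ∈ Finset.Icc 1 n, r t) * f n
      - ∑ k ∈ Finset.range n, (∑ t ∈ Finset.Icc 1 k, r t) * (f (k + 1) - f k) := by
  induction n with
  | zero => simp
  | succ n ih =>
    rw [Finset.sum_Icc_succ_top (by omega), Finset.sum_Icc_succ_top (by omega),
      Finset.sum_range_succ, ih]
    ring

theorem abs_sum_mul_le_of_partial {r f : ℕ → ℝ} {n : ℕ} {B : ℝ}
    (hB : ∀ k ≤ n, |∑ t ∈ Finset.Icc 1 k, r t| ≤ B) :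
    |∑ t ∈ Finset.Icc 1 n, r t * f t| ≤
      B * (|f n| + ∑ k ∈ Finset.range n, |f (k + 1) - f k|) := by
  rw [sum_mul_eq_sub_sum_partial]
  refine (abs_sub _ _).trans ?_
  rw [abs_mul, mul_add, Finset.mul_sum]
  gcongr
  · exact hB n le_rfl
  · refine (Finset.abs_sum_le_sum_abs _ _).trans (Finset.sum_le_sum fun k hk => ?_)
    rw [abs_mul]
    gcongr
    exact hB k (Finset.mem_range.mp hk).le

theorem abs_cos_sub_cos_le (x y : ℝ) : |Real.cos x - Real.cos y| ≤ |x - y| := by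
  have := Real.lipschitzWith_cos.dist_le_mul x y
  simpa [Real.dist_eq] using this

theorem abs_sin_sub_sin_le (x y : ℝ) : |Real.sin x - Real.sin y| ≤ |x - y| := by
  have := Real.lipschitzWith_sin.dist_le_mul x y
  simpa [Real.dist_eq] using this

/-- Below argument Γ = γ n^d the sine varies only by Γ, hence the weight on |q|. The quantity |p| +
|q| Γ is what the energy still controls when p and q themselves escape. -/
theorem trigSignal_variation_le {d n : ℕ} (hd : 0 < d) {p q γ : ℝ} (h0 : 0 ≤ γ)
    (h1 : γ * (n : ℝ) ^ d ≤ 1 / 2) :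
    |trigSignal d p q γ n| + ∑ k ∈ Finset.range n,
      |trigSignal d p q γ (k + 1) - trigSignal d p q γ k| ≤ 2 * (|p| + |q| * (γ * (n : ℝ) ^ d)) := by
  have hΓ : 0 ≤ γ * (n : ℝ) ^ d := by positivity
  have hn : |trigSignal d p q γ n| ≤ |p| + |q| * (γ * (n : ℝ) ^ d) := by
    unfold trigSignal
    refine (abs_add_le _ _).trans ?_
    rw [abs_mul, abs_mul]
    gcongr
    · exact mul_le_of_le_one_right (abs_nonneg _) (Real.abs_cos_le_one _)
    · have := abs_sin_sub_sin_le (γ * (n : ℝ) ^ d) 0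
      rwa [Real.sin_zero, sub_zero, sub_zero, abs_of_nonneg hΓ] at this
  have hk : ∀ k : ℕ, |trigSignal d p q γ (k + 1) - trigSignal d p q γ k|
      ≤ (|p| + |q|) * (γ * ((k + 1 : ℕ) : ℝ) ^ d - γ * (k : ℝ) ^ d) := by
    intro k
    have hm : γ * (k : ℝ) ^ d ≤ γ * ((k + 1 : ℕ) : ℝ) ^ d := by
      gcongr; omega
    have e : trigSignal d p q γ (k + 1) - trigSignal d p q γ k
        = p * (Real.cos (γ * ((k + 1 : ℕ) : ℝ) ^ d) - Real.cos (γ * (k : ℝ) ^ d))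
          + q * (Real.sin (γ * ((k + 1 : ℕ) : ℝ) ^ d) - Real.sin (γ * (k : ℝ) ^ d)) := by
      unfold trigSignal; ring
    rw [e, add_mul]
    refine (abs_add_le _ _).trans ?_
    rw [abs_mul, abs_mul, ← abs_of_nonneg (sub_nonneg.mpr hm)]
    exact add_le_add (mul_le_mul_of_nonneg_left (abs_cos_sub_cos_le _ _) (abs_nonneg _))
      (mul_le_mul_of_nonneg_left (abs_sin_sub_sin_le _ _) (abs_nonneg _))
  have hs : ∑ k ∈ Finset.range n, |trigSignal d p q γ (k + 1) - trigSignal d p q γ k|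
      ≤ (|p| + |q|) * (γ * (n : ℝ) ^ d) := by
    refine (Finset.sum_le_sum fun k _ => hk k).trans (le_of_eq ?_)
    rw [← Finset.mul_sum, Finset.sum_range_sub (fun k : ℕ => γ * (k : ℝ) ^ d)]
    simp [hd.ne']
  nlinarith [abs_nonneg p, abs_nonneg q, mul_nonneg (abs_nonneg p) hΓ]

/-- Eliminating p gives q sin(b - a) = g cos a - f cos b with sin(b - a) ≥ Γ / 4, so |q| Γ ≤ 4 S for
S = |f| + |g|; then |p| ≤ 10 S because cos a ≥ 1 / 2. The constant is 2 · 14². -/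
theorem amplitudes_le_of_two_values {p q a b Γ : ℝ} (ha : 0 ≤ a) (haΓ : a ≤ Γ) (hbΓ : b ≤ Γ)
    (hΓ : Γ ≤ 1 / 2) (hab : Γ / 2 ≤ b - a) :
    (|p| + |q| * Γ) ^ 2 ≤ 392 * ((p * Real.cos a + q * Real.sin a) ^ 2
      + (p * Real.cos b + q * Real.sin b) ^ 2) := by
  set f := p * Real.cos a + q * Real.sin a with hf
  set g := p * Real.cos b + q * Real.sin b with hg
  set S := |f| + |g| with hS
  have hΓ0 : 0 ≤ Γ := ha.trans haΓ
  have hpi := Real.pi_gt_three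
  have h1 : q * Real.sin (b - a) = g * Real.cos a - f * Real.cos b := by
    rw [Real.sin_sub, hf, hg]; ring
  have h2 : |q * Real.sin (b - a)| ≤ S := by
    rw [h1]
    refine (abs_sub _ _).trans ?_
    rw [abs_mul, abs_mul, hS, add_comm]
    gcongr
    · exact mul_le_of_le_one_right (abs_nonneg _) (Real.abs_cos_le_one _)
    · exact mul_le_of_le_one_right (abs_nonneg _) (Real.abs_cos_le_one _)
  have h3 : Γ / 4 ≤ Real.sin (b - a) := by
    have := Real.mul_le_sin (x := b - a) (by linarith) (by linarith)
    refine le_trans ?_ this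
    rw [div_mul_eq_mul_div, le_div_iff₀ Real.pi_pos]
    nlinarith [Real.pi_le_four]
  have h4 : |q| * Γ ≤ 4 * S := by
    rw [abs_mul, abs_of_nonneg (by linarith : 0 ≤ Real.sin (b - a))] at h2
    nlinarith [abs_nonneg q]
  have h5 : 1 / 2 ≤ Real.cos a := by
    have := Real.one_sub_sq_div_two_le_cos (x := a)
    nlinarith
  have h6 : |p * Real.cos a| ≤ S + |q| * Γ := by
    have : p * Real.cos a = f - q * Real.sin a := by rw [hf]; ring
    rw [this]
    refine (abs_sub _ _).trans ?_
    rw [abs_mul]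
    have h7 : |Real.sin a| ≤ Γ := by
      have := abs_sin_sub_sin_le a 0
      rw [Real.sin_zero, sub_zero, sub_zero, abs_of_nonneg ha] at this
      exact this.trans haΓ
    have h8 := mul_le_mul_of_nonneg_left h7 (abs_nonneg q)
    have h9 := abs_nonneg g
    linarith
  have h10 : |p| ≤ 10 * S := by
    rw [abs_mul, abs_of_nonneg (by linarith : 0 ≤ Real.cos a)] at h6
    nlinarith [abs_nonneg p]
  have hS2 : S ^ 2 ≤ 2 * (f ^ 2 + g ^ 2) := by
    rw [hS]
    nlinarith [sq_nonneg (|f| - |g|), sq_abs f, sq_abs g]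
  have hK : |p| + |q| * Γ ≤ 14 * S := by linarith
  have hK0 : 0 ≤ |p| + |q| * Γ := by positivity
  calc (|p| + |q| * Γ) ^ 2 ≤ (14 * S) ^ 2 := by gcongr
    _ ≤ _ := by nlinarith

/-- Pair t ≤ n / 4 with n + 1 - t: the two arguments differ by at least half of γ n^d. The constant
is 2 · 8 · 392. -/
theorem amplitudes_le_energy {d n : ℕ} (hd : d = 1 ∨ d = 2) (hn : 8 ≤ n) {p q γ : ℝ}
    (h0 : 0 ≤ γ) (h1 : γ * (n : ℝ) ^ d ≤ 1 / 2) :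
    n * (|p| + |q| * (γ * (n : ℝ) ^ d)) ^ 2
      ≤ 6272 * ∑ t ∈ Finset.Icc 1 n, trigSignal d p q γ t ^ 2 := by
  set m := n / 4 with hm
  set K := |p| + |q| * (γ * (n : ℝ) ^ d) with hK
  have hterm : ∀ t ∈ Finset.Icc 1 m, K ^ 2 ≤
      392 * (trigSignal d p q γ t ^ 2 + trigSignal d p q γ (n + 1 - t) ^ 2) := by
    intro t ht
    simp only [Finset.mem_Icc] at ht
    have htn : t ≤ n + 1 := by omega
    have hc : ((n + 1 - t : ℕ) : ℝ) = n + 1 - t := by push_cast [Nat.cast_sub htn]; ring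
    have ht1 : (1 : ℝ) ≤ t := by exact_mod_cast ht.1
    have ht4 : 4 * (t : ℝ) ≤ n := by exact_mod_cast (by omega : 4 * t ≤ n)
    have hn0 : (0 : ℝ) ≤ n := Nat.cast_nonneg n
    refine amplitudes_le_of_two_values (by positivity) ?_ ?_ h1 ?_
    · gcongr; omega
    · gcongr; omega
    · rw [← mul_sub, mul_div_assoc]
      apply mul_le_mul_of_nonneg_left _ h0
      rw [hc]
      rcases hd with rfl | rfl
      · simp only [pow_one]; linarith
      · nlinarith
  have hsum := Finset.sum_le_sum hterm
  rw [Finset.sum_const, Nat.card_Icc, nsmul_eq_mul, ← Finset.mul_sum, Finset.sum_add_distrib]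
    at hsum
  have s1 : ∑ t ∈ Finset.Icc 1 m, trigSignal d p q γ t ^ 2
      ≤ ∑ t ∈ Finset.Icc 1 n, trigSignal d p q γ t ^ 2 :=
    Finset.sum_le_sum_of_subset_of_nonneg (Finset.Icc_subset_Icc_right (by omega))
      fun _ _ _ => sq_nonneg _
  have s2 : ∑ t ∈ Finset.Icc 1 m, trigSignal d p q γ (n + 1 - t) ^ 2
      ≤ ∑ t ∈ Finset.Icc 1 n, trigSignal d p q γ t ^ 2 := by
    rw [← Finset.sum_image (f := fun t => trigSignal d p q γ t ^ 2) (g := fun t => n + 1 - t)]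
    · apply Finset.sum_le_sum_of_subset_of_nonneg
      · intro t; simp only [Finset.mem_image, Finset.mem_Icc]; omega
      · intros; positivity
    · intro a ha b hb h
      simp at ha hb h; omega
  have hmn : (n : ℝ) ≤ 8 * m := by exact_mod_cast (by omega : n ≤ 8 * m)
  have : ((m + 1 - 1 : ℕ) : ℝ) = m := by simp
  rw [this] at hsum
  nlinarith [sq_nonneg K]

/-- Abel summation bounds the sum by B times the variation of the signal, and the variation is
bounded by the energy. -/
theorem sum_mul_trigSignal_sq_le {d n : ℕ} (hd : d = 1 ∨ d = 2) (hn : 8 ≤ n) {p q γ : ℝ}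
    (h0 : 0 ≤ γ) (h1 : γ * (n : ℝ) ^ d ≤ 1 / 2) {r : ℕ → ℝ} {B : ℝ}
    (hB : ∀ k ≤ n, |∑ t ∈ Finset.Icc 1 k, r t| ≤ B) :
    n * (∑ t ∈ Finset.Icc 1 n, r t * trigSignal d p q γ t) ^ 2
      ≤ 25088 * B ^ 2 * ∑ t ∈ Finset.Icc 1 n, trigSignal d p q γ t ^ 2 := by
  have hB0 : 0 ≤ B := (abs_nonneg _).trans (hB 0 (Nat.zero_le _))
  have h2 := abs_sum_mul_le_of_partial (f := trigSignal d p q γ) hB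
  have h3 := trigSignal_variation_le (p := p) (q := q) (by omega : 0 < d) h0 h1
  have h4 := h2.trans (mul_le_mul_of_nonneg_left h3 hB0)
  have h5 := amplitudes_le_energy (p := p) (q := q) hd hn h0 h1
  rw [← sq_abs]
  calc _ ≤ (n : ℝ) * (B * (2 * (|p| + |q| * (γ * (n : ℝ) ^ d)))) ^ 2 := by gcongr
    _ = 4 * B ^ 2 * (n * (|p| + |q| * (γ * (n : ℝ) ^ d)) ^ 2) := by ring
    _ ≤ 4 * B ^ 2 * (6272 * ∑ t ∈ Finset.Icc 1 n, trigSignal d p q γ t ^ 2) := by gcongr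
    _ = _ := by ring

/-! ### Reflection of frequencies γ ↦ π - γ. -/

theorem cos_pi_mul_sub (m : ℕ) (x : ℝ) : Real.cos (m * Real.pi - x) = (-1) ^ m * Real.cos x := by
  rw [Real.cos_sub, Real.sin_nat_mul_pi, Real.cos_nat_mul_pi]; ring

theorem sin_pi_mul_sub (m : ℕ) (x : ℝ) : Real.sin (m * Real.pi - x) = -((-1) ^ m * Real.sin x) := by
  rw [Real.sin_sub, Real.sin_nat_mul_pi, Real.cos_nat_mul_pi]; ring

theorem neg_one_pow_pow {d : ℕ} (hd : 0 < d) (t : ℕ) : (-1 : ℝ) ^ (t ^ d) = (-1) ^ t := by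
  rcases Nat.even_or_odd t with h | h
  · rw [h.neg_one_pow, (h.pow_of_ne_zero hd.ne').neg_one_pow]
  · rw [h.neg_one_pow, h.pow.neg_one_pow]

/-- Since t^d and t have the same parity, e^{iπ t^d} = (-1)^t. The end point π thus reduces to 0 at
the price of an alternating sign. -/
theorem trigSignal_pi_sub {d : ℕ} (hd : 0 < d) (p q γ : ℝ) (t : ℕ) :
    trigSignal d p q γ t = (-1) ^ t * trigSignal d p (-q) (Real.pi - γ) t := by
  have e : γ * (t : ℝ) ^ d = ((t ^ d : ℕ) : ℝ) * Real.pi - (Real.pi - γ) * (t : ℝ) ^ d := by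
    push_cast; ring
  rw [trigSignal, e, cos_pi_mul_sub, sin_pi_mul_sub, neg_one_pow_pow hd, trigSignal]
  ring

/-! ### Sequences that are asymptotically orthogonal to all regressors -/

/-- `∑_{t ≤ n} r(t) = o(n)` -/
def NullSums (r : ℕ → ℝ) : Prop :=
  ∀ ε > 0, ∀ᶠ n : ℕ in atTop, |∑ t ∈ Finset.Icc 1 n, r t| ≤ ε * n

/-- `∑_{t ≤ n} r(t) e^{iγ t^d} = o(n)` uniformly in `γ`. -/
def PowerNull (d : ℕ) (r : ℕ → ℝ) : Prop :=
  ∀ ε > 0, ∀ᶠ n : ℕ in atTop, ∀ γ : ℝ,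
    ‖∑ t ∈ Finset.Icc 1 n, (r t : ℂ) * cis (γ * (t : ℝ) ^ d)‖ ≤ ε * n

theorem QuadraticNull.powerNull {d : ℕ} (hd : d = 1 ∨ d = 2) {r : ℕ → ℝ} (h : QuadraticNull r) :
    PowerNull d r := by
  intro ε hε
  filter_upwards [h ε hε] with n hn γ
  rcases hd with rfl | rfl
  · simpa using hn 0 γ
  · simpa using hn γ 0

theorem PowerNull.add {d : ℕ} {r s : ℕ → ℝ} (hr : PowerNull d r) (hs : PowerNull d s) :
    PowerNull d (fun t => r t + s t) := by
  intro ε hε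
  filter_upwards [hr (ε / 2) (by positivity), hs (ε / 2) (by positivity)] with n h1 h2 γ
  simp only [Complex.ofReal_add, add_mul, Finset.sum_add_distrib]
  refine (norm_add_le _ _).trans ?_
  linarith [h1 γ, h2 γ]

theorem PowerNull.nullSums {d : ℕ} {r : ℕ → ℝ} (h : PowerNull d r) : NullSums r := by
  intro ε hε
  filter_upwards [h ε hε] with n hn
  have := hn 0
  simp only [zero_mul, cis_zero, mul_one] at this
  rwa [← Complex.ofReal_sum, Complex.norm_real, Real.norm_eq_abs] at this

theorem cis_pi_mul_pow {d : ℕ} (hd : 0 < d) (t : ℕ) :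
    cis (Real.pi * (t : ℝ) ^ d) = (((-1) ^ t : ℝ) : ℂ) := by
  have e : Real.pi * (t : ℝ) ^ d = ((t ^ d : ℕ) : ℝ) * Real.pi := by push_cast; ring
  apply Complex.ext
  · rw [cis_re, e, Real.cos_nat_mul_pi, neg_one_pow_pow hd, Complex.ofReal_re]
  · rw [cis_im, e, Real.sin_nat_mul_pi, Complex.ofReal_im]

theorem PowerNull.nullSums_alternating {d : ℕ} (hd : 0 < d) {r : ℕ → ℝ} (h : PowerNull d r) :
    NullSums (fun t => (-1) ^ t * r t) := by
  intro ε hε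
  filter_upwards [h ε hε] with n hn
  have := hn Real.pi
  simp only [cis_pi_mul_pow hd, ← Complex.ofReal_mul] at this
  rw [← Complex.ofReal_sum, Complex.norm_real, Real.norm_eq_abs] at this
  simpa only [mul_comm] using this

/-- Abel summation needs all partial sums up to n at scale n: the finitely many early ones are
bounded by a constant, which ε n eventually exceeds. -/
theorem NullSums.partial_le {r : ℕ → ℝ} (h : NullSums r) {ε : ℝ} (hε : 0 < ε) :
    ∀ᶠ n : ℕ in atTop, ∀ k ≤ n, |∑ t ∈ Finset.Icc 1 k, r t| ≤ ε * n := by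
  obtain ⟨N, hN⟩ := eventually_atTop.mp (h ε hε)
  set C := ∑ k ∈ Finset.range N, |∑ t ∈ Finset.Icc 1 k, r t| with hC
  filter_upwards [eventually_ge_atTop ⌈C / ε⌉₊] with n hn k hk
  rcases lt_or_ge k N with hkN | hkN
  · have h1 : |∑ t ∈ Finset.Icc 1 k, r t| ≤ C :=
      Finset.single_le_sum (f := fun k => |∑ t ∈ Finset.Icc 1 k, r t|)
        (fun _ _ => abs_nonneg _) (Finset.mem_range.mpr hkN)
    have h2 : C / ε ≤ n := (Nat.le_ceil _).trans (by exact_mod_cast hn)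
    rw [div_le_iff₀ hε] at h2
    linarith
  · refine (hN k hkN).trans ?_
    gcongr

theorem NullSums.near_endpoint {d : ℕ} (hd : d = 1 ∨ d = 2) {r : ℕ → ℝ} (h : NullSums r)
    (h' : NullSums (fun t => (-1) ^ t * r t)) {ε : ℝ} (hε : 0 < ε) :
    ∀ᶠ n : ℕ in atTop, ∀ γ ∈ Icc 0 Real.pi, NearEndpoint d n γ → ∀ p q : ℝ,
      (∑ t ∈ Finset.Icc 1 n, r t * trigSignal d p q γ t) ^ 2
        ≤ ε * n * ∑ t ∈ Finset.Icc 1 n, trigSignal d p q γ t ^ 2 := by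
  set δ := Real.sqrt (ε / 25088) with hδ
  have hδ0 : 0 < δ := Real.sqrt_pos.mpr (by positivity)
  have hδ2 : δ ^ 2 = ε / 25088 := Real.sq_sqrt (by positivity)
  filter_upwards [h.partial_le hδ0, h'.partial_le hδ0, eventually_ge_atTop 8]
    with n h1 h2 hn γ hγ hne p q
  have hd0 : 0 < d := by omega
  have hn0 : (0 : ℝ) < n := by exact_mod_cast (by omega : 0 < n)
  have key : ∀ S E : ℝ, n * S ^ 2 ≤ 25088 * (δ * n) ^ 2 * E → S ^ 2 ≤ ε * n * E := by
    intro S E hle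
    have : n * S ^ 2 ≤ n * (ε * n * E) := by
      refine hle.trans (le_of_eq ?_)
      rw [mul_pow, hδ2]; ring
    exact le_of_mul_le_mul_left this hn0
  rcases hne with hne | hne
  · exact key _ _ (sum_mul_trigSignal_sq_le hd hn hγ.1 hne h1)
  · have h3 := key _ _ (sum_mul_trigSignal_sq_le (p := p) (q := -q) hd hn
      (by linarith [hγ.2] : 0 ≤ Real.pi - γ) hne h2)
    have e1 : ∀ t, trigSignal d p q γ t ^ 2 = trigSignal d p (-q) (Real.pi - γ) t ^ 2 := by
      intro t
      rw [trigSignal_pi_sub hd0, mul_pow, ← pow_mul, mul_comm t 2, pow_mul]; norm_num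
    have e2 : ∀ t, r t * trigSignal d p q γ t
        = (-1) ^ t * r t * trigSignal d p (-q) (Real.pi - γ) t := by
      intro t; rw [trigSignal_pi_sub hd0]; ring
    simp only [e1, e2]
    exact h3

/-- A sequence which is asymptotically orthogonal to all `e^{iγ t^d}` is so to all normalised
regressors, including nearly degenerate ones. -/
theorem PowerNull.sum_mul_trigSignal_sq_le {d : ℕ} (hd : d = 1 ∨ d = 2) {r : ℕ → ℝ}
    (h : PowerNull d r) {ε : ℝ} (hε : 0 < ε) :
    ∀ᶠ n : ℕ in atTop, ∀ γ ∈ Icc 0 Real.pi, ∀ p q : ℝ,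
      (∑ t ∈ Finset.Icc 1 n, r t * trigSignal d p q γ t) ^ 2
        ≤ ε * n * ∑ t ∈ Finset.Icc 1 n, trigSignal d p q γ t ^ 2 := by
  obtain ⟨c, hc, hdich⟩ := exists_energy_lower_bound hd
  set δ := Real.sqrt (ε * c) with hδ
  have hδ0 : 0 < δ := Real.sqrt_pos.mpr (by positivity)
  have hδ2 : δ ^ 2 = ε * c := Real.sq_sqrt (by positivity)
  filter_upwards [h.nullSums.near_endpoint hd (h.nullSums_alternating (by omega)) hε, h δ hδ0,
    eventually_ge_atTop 8] with n h1 h2 hn γ hγ p q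
  rcases hdich n hn γ hγ with hne | hlow
  · exact h1 γ hγ hne p q
  · set S := ∑ t ∈ Finset.Icc 1 n, (r t : ℂ) * cis (γ * (t : ℝ) ^ d) with hS
    have e : ∑ t ∈ Finset.Icc 1 n, r t * trigSignal d p q γ t = (amplitude p q * S).re := by
      rw [hS, Finset.mul_sum, Complex.re_sum]
      apply Finset.sum_congr rfl
      intro t _
      rw [trigSignal_eq_re, ← Complex.re_ofReal_mul]
      congr 1; ring
    rw [e, ← sq_abs]
    have h3 : |(amplitude p q * S).re| ≤ ‖amplitude p q‖ * ‖S‖ :=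
      (Complex.abs_re_le_norm _).trans (norm_mul_le _ _)
    calc _ ≤ (‖amplitude p q‖ * ‖S‖) ^ 2 := by gcongr
      _ ≤ (‖amplitude p q‖ * (δ * n)) ^ 2 := by gcongr; exact h2 γ
      _ = ε * n * (c * n * (p ^ 2 + q ^ 2)) := by
          rw [mul_pow, mul_pow, norm_amplitude_sq, hδ2]; ring
      _ ≤ _ := by gcongr; exact hlow p q

/-! ### Exponential sums along convergent frequencies -/

theorem cis_eq_one_iff (x : ℝ) : cis x = 1 ↔ ∃ m : ℤ, x = m * (2 * Real.pi) := by
  unfold cis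
  rw [Complex.exp_eq_one_iff]
  refine exists_congr fun m => ?_
  constructor
  · intro h
    have := congrArg Complex.im h
    simpa using this
  · intro h
    rw [h]; push_cast; ring

theorem norm_sum_cis_le {θ : ℝ} (h : cis θ ≠ 1) (n : ℕ) :
    ‖∑ t ∈ Finset.Icc 1 n, cis (θ * t)‖ ≤ 2 / ‖cis θ - 1‖ := by
  have h1 : (cis θ - 1) * ∑ t ∈ Finset.Icc 1 n, cis (θ * t) = cis (θ * (n + 1 : ℕ)) - cis θ := by
    induction n with
    | zero => simp
    | succ n ih =>
      rw [Finset.sum_Icc_succ_top (by omega), mul_add, ih, sub_mul, ← cis_add]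
      have : θ + θ * ((n + 1 : ℕ) : ℝ) = θ * ((n + 1 + 1 : ℕ) : ℝ) := by push_cast; ring
      rw [this]; ring
  have h2 : 0 < ‖cis θ - 1‖ := norm_pos_iff.mpr (sub_ne_zero.mpr h)
  rw [le_div_iff₀ h2, mul_comm, ← norm_mul, h1]
  refine (norm_sub_le _ _).trans ?_
  rw [norm_cis, norm_cis]; norm_num

/-- Along every sequence of frequencies converging to `γ`, the means of `e^{iγ t^d}` over growing
ranges tend to zero. -/
def MeanNull (d : ℕ) (γ : ℝ) : Prop :=
  ∀ (ns : ℕ → ℕ) (γs : ℕ → ℝ), Tendsto ns atTop atTop → Tendsto γs atTop (𝓝 γ) →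
    Tendsto (fun k => ‖∑ t ∈ Finset.Icc 1 (ns k), cis (γs k * (t : ℝ) ^ d)‖ / ns k) atTop (𝓝 0)

theorem MeanNull.neg {d : ℕ} {γ : ℝ} (h : MeanNull d γ) : MeanNull d (-γ) := by
  intro ns γs hns hγs
  have := h ns (fun k => -γs k) hns (by simpa using hγs.neg)
  convert this using 3 with k
  rw [← norm_star, star_sum]
  congr 1
  apply Finset.sum_congr rfl
  intro t _
  rw [star_cis, neg_mul]

theorem tendsto_const_div_cast {ns : ℕ → ℕ} (hns : Tendsto ns atTop atTop) {c : ℕ → ℝ} {l : ℝ}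
    (hc : Tendsto c atTop (𝓝 l)) : Tendsto (fun k => c k / ns k) atTop (𝓝 0) :=
  hc.div_atTop (tendsto_natCast_atTop_atTop.comp hns)

theorem tendsto_norm_cis_sub_one {γs : ℕ → ℝ} {γ : ℝ} (h : Tendsto γs atTop (𝓝 γ)) :
    Tendsto (fun k => ‖cis (γs k) - 1‖) atTop (𝓝 ‖cis γ - 1‖) :=
  (((continuous_cis.tendsto γ).comp h).sub_const 1).norm

theorem meanNull_one {γ : ℝ} (hγ : cis γ ≠ 1) : MeanNull 1 γ := by
  intro ns γs hns hγs
  have h1 := tendsto_norm_cis_sub_one hγs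
  have h2 : ‖cis γ - 1‖ ≠ 0 := norm_ne_zero_iff.mpr (sub_ne_zero.mpr hγ)
  have h3 : Tendsto (fun k => 2 / ‖cis (γs k) - 1‖) atTop (𝓝 (2 / ‖cis γ - 1‖)) :=
    tendsto_const_nhds.div h1 h2
  refine squeeze_zero' (Eventually.of_forall fun k => by positivity) ?_
    (tendsto_const_div_cast hns h3)
  filter_upwards [h1.eventually_ne h2] with k hk
  gcongr
  simp only [pow_one]
  exact norm_sum_cis_le (fun h => hk (by simp [h])) _

theorem cis_two_mul_ne_one {γ : ℝ} (hγ : Irrational (γ / Real.pi)) {h : ℕ} (hh : 0 < h) :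
    cis (2 * γ * h) ≠ 1 := by
  intro hc
  obtain ⟨m, hm⟩ := (cis_eq_one_iff _).mp hc
  apply hγ
  have hpi := Real.pi_ne_zero
  have hh' : (h : ℝ) ≠ 0 := by positivity
  refine ⟨(m : ℚ) / h, ?_⟩
  push_cast
  rw [div_eq_div_iff hh' hpi]
  linarith

theorem norm_sum_quadratic_sq_le {n H : ℕ} (hH : 1 ≤ H) {γ : ℝ} (η : ℝ)
    (hγ : ∀ h ∈ Finset.Ico 1 H, cis (2 * γ * h) ≠ 1) :
    ‖∑ t ∈ Finset.Icc 1 n, cis (γ * t ^ 2 + η * t)‖ ^ 2 ≤ ((n + H : ℕ) : ℝ) / H *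
      (n + 2 * ∑ h ∈ Finset.Ico 1 H, 2 / ‖cis (2 * γ * h) - 1‖) := by
  set x : ℕ → ℂ := fun t => if t ∈ Finset.Icc 1 n then cis (γ * t ^ 2 + η * t) else 0 with hx
  have hv := van_der_corput (n := n) hH x (by simp [hx]) (fun t ht => by
    simp only [hx, Finset.mem_Icc]; rw [if_neg (by omega)])
  have e1 : ∑ t ∈ Finset.Icc 1 n, x t = ∑ t ∈ Finset.Icc 1 n, cis (γ * t ^ 2 + η * t) :=
    Finset.sum_congr rfl fun t ht => by simp only [hx]; rw [if_pos ht]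
  have e2 : ∑ t ∈ Finset.Icc 1 n, ‖x t‖ ^ 2 = n := by
    have : ∀ t ∈ Finset.Icc 1 n, ‖x t‖ ^ 2 = 1 := fun t ht => by
      simp only [hx]; rw [if_pos ht, norm_cis, one_pow]
    rw [Finset.sum_congr rfl this]; simp
  rw [e1, e2] at hv
  refine hv.trans ?_
  gcongr with h hh
  have hsub : Finset.Icc 1 (n - h) ⊆ Finset.Icc 1 n := Finset.Icc_subset_Icc_right (by omega)
  rw [← Finset.sum_subset hsub (fun t ht ht' => by
    simp only [hx, Finset.mem_Icc] at ht ht' ⊢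
    rw [if_neg (by omega), zero_mul])]
  have e3 : ∀ t ∈ Finset.Icc 1 (n - h), x (t + h) * star (x t)
      = cis (γ * h ^ 2 + η * h) * cis (2 * γ * h * t) := by
    intro t ht
    simp only [Finset.mem_Icc] at ht
    simp only [hx, Finset.mem_Icc]
    rw [if_pos (by omega), if_pos (by omega), cis_mul_star, ← cis_add]
    congr 1; push_cast; ring
  rw [Finset.sum_congr rfl e3, ← Finset.mul_sum, norm_mul, norm_cis, one_mul]
  exact norm_sum_cis_le (hγ h hh) _

/-- For fixed H the lag-h correlations are geometric sums of frequency 2γh, bounded because γ / π is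
irrational. Hence the squared mean is eventually at most 4 / H. The linear coefficients enter only
through unimodular factors and may vary freely. -/
theorem tendsto_mean_quadratic {γ : ℝ} (hγ : Irrational (γ / Real.pi)) {ns : ℕ → ℕ} {γs : ℕ → ℝ}
    (ηs : ℕ → ℝ) (hns : Tendsto ns atTop atTop) (hγs : Tendsto γs atTop (𝓝 γ)) :
    Tendsto (fun k => ‖∑ t ∈ Finset.Icc 1 (ns k), cis (γs k * t ^ 2 + ηs k * t)‖ / ns k)
      atTop (𝓝 0) := by
  rw [Metric.tendsto_nhds]
  intro ε hε
  obtain ⟨H, hH⟩ := exists_nat_gt (4 / ε ^ 2)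
  have hH0 : (0 : ℝ) < H := lt_trans (by positivity) hH
  have hH1 : 1 ≤ H := by exact_mod_cast hH0
  have hγh : ∀ h : ℕ, Tendsto (fun k => 2 * γs k * h) atTop (𝓝 (2 * γ * h)) := fun h =>
    (hγs.const_mul 2).mul_const _
  have hne : ∀ h ∈ Finset.Ico 1 H, ‖cis (2 * γ * h) - 1‖ ≠ 0 := fun h hh =>
    norm_ne_zero_iff.mpr (sub_ne_zero.mpr (cis_two_mul_ne_one hγ (Finset.mem_Ico.mp hh).1))
  have hlim : Tendsto (fun k => (2 * ∑ h ∈ Finset.Ico 1 H, 2 / ‖cis (2 * γs k * h) - 1‖) / ns k)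
      atTop (𝓝 0) :=
    tendsto_const_div_cast hns ((tendsto_finsetSum _ fun h hh =>
      tendsto_const_nhds.div (tendsto_norm_cis_sub_one (hγh h)) (hne h hh)).const_mul 2)
  have hev : ∀ᶠ k in atTop, ∀ h ∈ Finset.Ico 1 H, cis (2 * γs k * h) ≠ 1 := by
    rw [Filter.eventually_all_finset]
    intro h hh
    filter_upwards [(tendsto_norm_cis_sub_one (hγh h)).eventually_ne (hne h hh)] with k hk hc
    exact hk (by simp [hc])
  filter_upwards [hlim.eventually_le_const (one_pos), hev, hns.eventually_ge_atTop H]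
    with k h1 h2 h3
  have hn0 : (0 : ℝ) < ns k := by exact_mod_cast (by omega : 0 < ns k)
  rw [Real.dist_eq, sub_zero, abs_of_nonneg (by positivity), div_lt_iff₀ hn0]
  have h4 := norm_sum_quadratic_sq_le (n := ns k) hH1 (ηs k) h2
  rw [div_le_one hn0] at h1
  have h5 : ((ns k + H : ℕ) : ℝ) ≤ 2 * ns k := by exact_mod_cast (by omega : ns k + H ≤ 2 * ns k)
  apply lt_of_pow_lt_pow_left₀ 2 (by positivity)
  refine h4.trans_lt ?_
  calc _ ≤ (2 * ns k : ℝ) / H * (ns k + ns k) := by gcongr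
    _ = 4 / H * (ns k : ℝ) ^ 2 := by ring
    _ < ε ^ 2 * (ns k : ℝ) ^ 2 := by
        gcongr
        rw [div_lt_iff₀ hH0]
        rw [div_lt_iff₀ (by positivity)] at hH
        linarith
    _ = _ := by ring

theorem meanNull_two {γ : ℝ} (hγ : Irrational (γ / Real.pi)) : MeanNull 2 γ := by
  intro ns γs hns hγs
  simpa using tendsto_mean_quadratic hγ (fun _ => 0) hns hγs

/-- If uniformity failed, choosing an offending η for each bad n would contradict the limit along
arbitrary linear coefficients. -/
theorem eventually_norm_sum_quadratic_le {γ : ℝ} (hγ : Irrational (γ / Real.pi)) {ε : ℝ}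
    (hε : 0 < ε) : ∀ᶠ n : ℕ in atTop, ∀ η : ℝ,
      ‖∑ t ∈ Finset.Icc 1 n, cis (γ * t ^ 2 + η * t)‖ ≤ ε * n := by
  by_contra hcon
  have hex : ∀ n : ℕ, ∃ η : ℝ, ¬ (∀ η : ℝ,
      ‖∑ t ∈ Finset.Icc 1 n, cis (γ * t ^ 2 + η * t)‖ ≤ ε * n) →
      ε * n < ‖∑ t ∈ Finset.Icc 1 n, cis (γ * t ^ 2 + η * t)‖ := by
    intro n
    by_cases h : ∀ η : ℝ, ‖∑ t ∈ Finset.Icc 1 n, cis (γ * t ^ 2 + η * t)‖ ≤ ε * n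
    · exact ⟨0, fun h' => absurd h h'⟩
    · push Not at h
      obtain ⟨η, hη⟩ := h
      exact ⟨η, fun _ => hη⟩
  choose ηs hηs using hex
  have := tendsto_mean_quadratic hγ ηs tendsto_id (tendsto_const_nhds (x := γ))
  apply hcon
  filter_upwards [this.eventually_lt_const hε, eventually_gt_atTop 0] with n hn hn0
  by_contra h
  have h1 := hηs n h
  have hn0' : (0 : ℝ) < n := by exact_mod_cast hn0
  simp only [id] at hn
  rw [div_lt_iff₀ hn0'] at hn
  linarith

/-! ### Fixed signals as null sequences. -/

theorem re_mul_cis (w : ℂ) (x : ℝ) :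
    (((w * cis x).re : ℝ) : ℂ) = (w * cis x + star w * cis (-x)) / 2 := by
  rw [← star_cis]
  have := Complex.add_conj (w * cis x)
  rw [map_mul] at this
  change w * cis x + star w * star (cis x) = _ at this
  rw [this]; push_cast; ring

/-- Multiplication by e^{iγ t} turns the chirp into two exponentials with quadratic coefficients ±β,
and γ enters only the linear term, where uniformity is available. This lets the chirp pass for noise
in the first stage. -/
theorem powerNull_one_chirp {β : ℝ} (hβ : Irrational (β / Real.pi)) (p q : ℝ) :
    PowerNull 1 (trigSignal 2 p q β) := by
  intro ε hε
  set w := amplitude p q with hw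
  have hδ : 0 < ε / (‖w‖ + 1) := by positivity
  have hβ' : Irrational (-β / Real.pi) := by rw [neg_div]; exact hβ.neg
  filter_upwards [eventually_norm_sum_quadratic_le hβ hδ,
    eventually_norm_sum_quadratic_le hβ' hδ] with n h1 h2 γ
  have e : ∀ t : ℕ, (trigSignal 2 p q β t : ℂ) * cis (γ * (t : ℝ) ^ 1)
      = w / 2 * cis (β * t ^ 2 + γ * t) + star w / 2 * cis (-β * t ^ 2 + γ * t) := by
    intro t
    rw [trigSignal_eq_re, re_mul_cis, cis_add, cis_add, neg_mul, pow_one]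
    ring
  rw [Finset.sum_congr rfl fun t _ => e t, Finset.sum_add_distrib, ← Finset.mul_sum,
    ← Finset.mul_sum]
  refine (norm_add_le _ _).trans ?_
  rw [norm_mul, norm_mul, norm_div, norm_div, norm_star]
  have h3 : ‖w‖ * (ε / (‖w‖ + 1) * n) ≤ ε * n := by
    have : ‖w‖ * (ε / (‖w‖ + 1)) ≤ ε := by
      rw [mul_div_assoc', div_le_iff₀ (by positivity)]
      nlinarith [norm_nonneg w]
    calc _ = (‖w‖ * (ε / (‖w‖ + 1))) * n := by ring
      _ ≤ _ := by gcongr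
  have h2n : ‖(2 : ℂ)‖ = 2 := by norm_num
  rw [h2n]
  have h4 := mul_le_mul_of_nonneg_left (h1 γ) (norm_nonneg w)
  have h5 := mul_le_mul_of_nonneg_left (h2 γ) (norm_nonneg w)
  linarith

theorem MeanNull.eventually_le {d : ℕ} {γ : ℝ} (h : MeanNull d γ) {ε : ℝ} (hε : 0 < ε) :
    ∀ᶠ n : ℕ in atTop, ‖∑ t ∈ Finset.Icc 1 n, cis (γ * (t : ℝ) ^ d)‖ ≤ ε * n := by
  have := h id (fun _ => γ) tendsto_id tendsto_const_nhds
  filter_upwards [this.eventually_lt_const hε, eventually_gt_atTop 0] with n hn hn0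
  have hn0' : (0 : ℝ) < n := by exact_mod_cast hn0
  simp only [id] at hn
  rw [div_lt_iff₀ hn0'] at hn
  exact hn.le

theorem nullSums_re {d : ℕ} {γ : ℝ} (h : MeanNull d γ) (w : ℂ) :
    NullSums (fun t => (w * cis (γ * (t : ℝ) ^ d)).re) := by
  intro ε hε
  have hδ : 0 < ε / (‖w‖ + 1) := by positivity
  filter_upwards [h.eventually_le hδ] with n hn
  rw [← Complex.re_sum, ← Finset.mul_sum]
  refine (Complex.abs_re_le_norm _).trans ?_
  rw [norm_mul]
  have : ‖w‖ * (ε / (‖w‖ + 1)) ≤ ε := by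
    rw [mul_div_assoc', div_le_iff₀ (by positivity)]
    nlinarith [norm_nonneg w]
  calc _ ≤ ‖w‖ * (ε / (‖w‖ + 1) * n) := by gcongr
    _ = (‖w‖ * (ε / (‖w‖ + 1))) * n := by ring
    _ ≤ _ := by gcongr

theorem nullSums_trigSignal {d : ℕ} {γ : ℝ} (h : MeanNull d γ) (p q : ℝ) :
    NullSums (trigSignal d p q γ) := by
  have := nullSums_re h (amplitude p q)
  simpa only [← trigSignal_eq_re] using this

theorem nullSums_alternating_trigSignal {d : ℕ} (hd : 0 < d) {γ : ℝ}
    (h : MeanNull d (γ + Real.pi)) (p q : ℝ) :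
    NullSums (fun t => (-1) ^ t * trigSignal d p q γ t) := by
  have := nullSums_re h (amplitude p q)
  convert this using 2 with t
  rw [add_mul, cis_add, cis_pi_mul_pow hd, trigSignal_eq_re, ← mul_assoc, mul_comm (_ * _)
    (((-1) ^ t : ℝ) : ℂ), Complex.re_ofReal_mul]

/-! ### Identification of the parameters from the signal -/

/-- A small mean supplies times t at which u is close to 1 at t, t + 1, 2t, 2t + 1 and 3t; suitable
quotients of these values equal b and e^{iδ} exactly. -/
theorem tendsto_of_mean_norm_sub_one {d : ℕ} (hd : d = 1 ∨ d = 2) {ns : ℕ → ℕ} {b : ℕ → ℂ}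
    {δ : ℕ → ℝ} (hns : Tendsto ns atTop atTop)
    (h : Tendsto (fun k => (∑ t ∈ Finset.Icc 1 (ns k), ‖b k * cis (δ k * (t : ℝ) ^ d) - 1‖ ^ 2)
      / ns k) atTop (𝓝 0)) :
    Tendsto b atTop (𝓝 1) ∧ Tendsto (fun k => cis (δ k)) atTop (𝓝 1) := by
  set u : ℕ → ℕ → ℂ := fun k t => b k * cis (δ k * (t : ℝ) ^ d) with hu
  set κ : ℕ → ℝ := fun k => (∑ t ∈ Finset.Icc 1 (ns k), ‖u k t - 1‖ ^ 2) / ns k with hκ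
  have hex : ∀ k, ∃ t, 8 ≤ ns k → ‖u k t - 1‖ ^ 2 ≤ 80 * κ k ∧ ‖u k (t + 1) - 1‖ ^ 2 ≤ 80 * κ k ∧
      ‖u k (2 * t) - 1‖ ^ 2 ≤ 80 * κ k ∧ ‖u k (2 * t + 1) - 1‖ ^ 2 ≤ 80 * κ k ∧
      ‖u k (3 * t) - 1‖ ^ 2 ≤ 80 * κ k := by
    intro k
    by_cases hk : 8 ≤ ns k
    · obtain ⟨t, -, ht⟩ := exists_small_of_sum_le (v := fun t => ‖u k t - 1‖ ^ 2) (s := 1)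
        (κ := κ k) (fun t => sq_nonneg _) hk (by omega) (by
          rw [hκ]
          have : (ns k : ℝ) ≠ 0 := by exact_mod_cast (by omega : ns k ≠ 0)
          field_simp
          exact le_rfl)
      exact ⟨t, fun _ => ht⟩
    · exact ⟨0, fun h => absurd h hk⟩
  choose t ht using hex
  have hlim : ∀ g : ℕ → ℕ, (∀ k, 8 ≤ ns k → ‖u k (g k) - 1‖ ^ 2 ≤ 80 * κ k) →
      Tendsto (fun k => u k (g k)) atTop (𝓝 1) := by
    intro g hg
    rw [tendsto_iff_norm_sub_tendsto_zero]
    have h1 : Tendsto (fun k => Real.sqrt (80 * κ k)) atTop (𝓝 0) := by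
      have h2 := (h.const_mul 80).sqrt
      rwa [mul_zero, Real.sqrt_zero] at h2
    refine squeeze_zero' (Eventually.of_forall fun k => norm_nonneg _) ?_ h1
    filter_upwards [hns.eventually_ge_atTop 8] with k hk
    exact Real.le_sqrt_of_sq_le (hg k hk)
  have l1 := hlim t fun k hk => (ht k hk).1
  have l2 := hlim (fun k => t k + 1) fun k hk => (ht k hk).2.1
  have l3 := hlim (fun k => 2 * t k) fun k hk => (ht k hk).2.2.1
  have l4 := hlim (fun k => 2 * t k + 1) fun k hk => (ht k hk).2.2.2.1
  have l5 := hlim (fun k => 3 * t k) fun k hk => (ht k hk).2.2.2.2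
  have hb : ∀ᶠ k in atTop, b k ≠ 0 := by
    filter_upwards [l1.eventually_ne one_ne_zero] with k hk hb
    exact hk (by simp [hu, hb])
  rcases hd with rfl | rfl
  · constructor
    · have := (l1.pow 2).div l3 one_ne_zero
      rw [one_pow, div_one] at this
      refine this.congr' ?_
      filter_upwards [hb] with k hk
      have e : cis (δ k * ((2 * t k : ℕ) : ℝ) ^ 1) = cis (δ k * (t k : ℝ) ^ 1) ^ 2 := by
        rw [← cis_nat_mul]; congr 1; push_cast; ring
      have := cis_ne_zero (δ k * (t k : ℝ) ^ 1)
      simp only [hu, Pi.div_apply, e]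
      generalize cis (δ k * (t k : ℝ) ^ 1) = z at this ⊢
      field_simp
    · have := l2.div l1 one_ne_zero
      rw [div_one] at this
      refine this.congr' ?_
      filter_upwards [hb] with k hk
      have e : cis (δ k * ((t k + 1 : ℕ) : ℝ) ^ 1) = cis (δ k * (t k : ℝ) ^ 1) * cis (δ k) := by
        rw [← cis_add]; congr 1; push_cast; ring
      have := cis_ne_zero (δ k * (t k : ℝ) ^ 1)
      simp only [hu, Pi.div_apply, e]
      generalize cis (δ k * (t k : ℝ) ^ 1) = z at this ⊢
      field_simp
  · constructor
    -- The quotient u(t)³ u(3t) / u(2t)³ equals b, since 3 + 9 = 3 · 4 in the phases and 4 - 3 = 1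
    -- in the power of b.
    · have := ((l1.pow 3).mul l5).div (l3.pow 3) (by norm_num)
      rw [one_pow, mul_one, div_one] at this
      refine this.congr' ?_
      filter_upwards [hb] with k hk
      have e : cis (δ k * ((2 * t k : ℕ) : ℝ) ^ 2) = cis (δ k * (t k : ℝ) ^ 2) ^ 4 := by
        rw [← cis_nat_mul]; congr 1; push_cast; ring
      have e' : cis (δ k * ((3 * t k : ℕ) : ℝ) ^ 2) = cis (δ k * (t k : ℝ) ^ 2) ^ 9 := by
        rw [← cis_nat_mul]; congr 1; push_cast; ring
      have := cis_ne_zero (δ k * (t k : ℝ) ^ 2)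
      simp only [hu, Pi.div_apply, e, e']
      field_simp
    · have := (l3.mul (l2.pow 2)).div (l4.mul (l1.pow 2)) (by norm_num)
      rw [one_pow, mul_one, div_one] at this
      refine this.congr' ?_
      filter_upwards [hb] with k hk
      have e : cis (δ k * ((2 * t k : ℕ) : ℝ) ^ 2) * cis (δ k * ((t k + 1 : ℕ) : ℝ) ^ 2) ^ 2
          = cis (δ k) * (cis (δ k * ((2 * t k + 1 : ℕ) : ℝ) ^ 2) *
            cis (δ k * (t k : ℝ) ^ 2) ^ 2) := by
        simp only [← cis_nat_mul, ← cis_add]; congr 1; push_cast; ring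
      have h1 := cis_ne_zero (δ k * (t k : ℝ) ^ 2)
      have h2 := cis_ne_zero (δ k * ((2 * t k + 1 : ℕ) : ℝ) ^ 2)
      simp only [hu, Pi.div_apply]
      rw [div_eq_iff (by positivity)]
      linear_combination (b k) ^ 3 * e

/-- Trades a squared real part for a squared modulus, up to a term Re z² that oscillates and
averages out. -/
theorem norm_sq_eq_re_sq (z : ℂ) : ‖z‖ ^ 2 = 2 * z.re ^ 2 - (z ^ 2).re := by
  rw [← Complex.normSq_eq_norm_sq, Complex.normSq_apply, sq z, Complex.mul_re]; ring

theorem tendsto_re_mean {d : ℕ} {ns : ℕ → ℕ} {γs : ℕ → ℝ} {γ : ℝ} (hG : MeanNull d γ)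
    (hns : Tendsto ns atTop atTop) (hγs : Tendsto γs atTop (𝓝 γ)) {c : ℕ → ℂ} {C : ℝ}
    (hc : ∀ᶠ k in atTop, ‖c k‖ ≤ C) :
    Tendsto (fun k => (∑ t ∈ Finset.Icc 1 (ns k), (c k * cis (γs k * (t : ℝ) ^ d)).re) / ns k)
      atTop (𝓝 0) := by
  have h1 := (hG ns γs hns hγs).const_mul C
  rw [mul_zero] at h1
  refine squeeze_zero_norm' ?_ h1
  filter_upwards [hc] with k hk
  rw [← Complex.re_sum, ← Finset.mul_sum, norm_div, Real.norm_natCast, ← mul_div_assoc]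
  gcongr
  refine (Complex.abs_re_le_norm _).trans ?_
  rw [norm_mul]
  gcongr

/-- Two signals that agree in the mean, with frequencies such that no interference occurs, have
asymptotically the same parameters. -/
theorem tendsto_of_mean_re_sub_sq {d : ℕ} (hd : d = 1 ∨ d = 2) {ns : ℕ → ℕ} {γs : ℕ → ℝ}
    {w : ℕ → ℂ} {γ γ₀ : ℝ} {w₀ : ℂ} {C : ℝ} (hw₀ : w₀ ≠ 0) (hns : Tendsto ns atTop atTop)
    (hγs : Tendsto γs atTop (𝓝 γ)) (hw : ∀ᶠ k in atTop, ‖w k‖ ≤ C) (h1 : MeanNull d (2 * γ))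
    (h2 : MeanNull d (γ + γ₀)) (h3 : MeanNull d (2 * γ₀))
    (h : Tendsto (fun k => (∑ t ∈ Finset.Icc 1 (ns k),
      ((w k * cis (γs k * (t : ℝ) ^ d)).re - (w₀ * cis (γ₀ * (t : ℝ) ^ d)).re) ^ 2) / ns k)
      atTop (𝓝 0)) :
    Tendsto w atTop (𝓝 w₀) ∧ cis (γ - γ₀) = 1 := by
  have hC : ∀ᶠ k in atTop, ‖w k ^ 2‖ ≤ C ^ 2 := by
    filter_upwards [hw] with k hk
    rw [norm_pow]; gcongr
  have hC' : ∀ᶠ k in atTop, ‖(-2) * (w k * w₀)‖ ≤ 2 * (C * ‖w₀‖) := by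
    filter_upwards [hw] with k hk
    rw [norm_mul, norm_mul]
    have : ‖(-2 : ℂ)‖ = 2 := by norm_num
    rw [this]; gcongr
  have m1 := tendsto_re_mean h1 hns (hγs.const_mul 2) hC
  have m2 := tendsto_re_mean h2 hns (hγs.add_const γ₀) hC'
  have m3 := tendsto_re_mean h3 hns (tendsto_const_nhds (x := 2 * γ₀)) (c := fun _ => w₀ ^ 2)
    (C := ‖w₀ ^ 2‖) (Eventually.of_forall fun _ => le_rfl)
  -- With z = w x - w₀ y, the square z² carries exactly the frequencies 2γ, γ + γ₀ and 2γ₀, so the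
  -- mean of |z|² = 2 (Re z)² - Re z² tends to 0.
  have hmean := (((h.const_mul 2).sub m1).sub m2).sub m3
  have hw₀' : ‖w₀‖ ^ 2 ≠ 0 := pow_ne_zero 2 (norm_ne_zero_iff.mpr hw₀)
  have hmean2 := hmean.div_const (‖w₀‖ ^ 2)
  simp only [mul_zero, sub_zero, zero_div] at hmean2
  have key : Tendsto (fun k => (∑ t ∈ Finset.Icc 1 (ns k),
      ‖w k / w₀ * cis ((γs k - γ₀) * (t : ℝ) ^ d) - 1‖ ^ 2) / ns k) atTop (𝓝 0) := by
    refine hmean2.congr fun k => ?_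
    rw [← mul_div_assoc, ← sub_div, ← sub_div, ← sub_div, div_right_comm]
    congr 1
    rw [Finset.mul_sum, ← Finset.sum_sub_distrib, ← Finset.sum_sub_distrib,
      ← Finset.sum_sub_distrib, Finset.sum_div]
    apply Finset.sum_congr rfl
    intro t _
    set x := cis (γs k * (t : ℝ) ^ d) with hx
    set y := cis (γ₀ * (t : ℝ) ^ d) with hy
    have hy0 : y ≠ 0 := cis_ne_zero _
    have hyn : ‖y‖ = 1 := norm_cis _
    have e1 : cis (2 * γs k * (t : ℝ) ^ d) = x ^ 2 := by
      rw [hx, ← cis_nat_mul]; congr 1; push_cast; ring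
    have e2 : cis ((γs k + γ₀) * (t : ℝ) ^ d) = x * y := by
      rw [hx, hy, ← cis_add]; congr 1; ring
    have e3 : cis (2 * γ₀ * (t : ℝ) ^ d) = y ^ 2 := by
      rw [hy, ← cis_nat_mul]; congr 1; push_cast; ring
    have e4 : cis ((γs k - γ₀) * (t : ℝ) ^ d) = x / y := by
      rw [eq_div_iff hy0, hx, hy, ← cis_add]; congr 1; ring
    have e5 : w k / w₀ * (x / y) - 1 = (w k * x - w₀ * y) / (w₀ * y) := by field_simp
    rw [e1, e2, e3, e4, e5, norm_div, norm_mul, hyn, mul_one, div_pow]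
    congr 1
    rw [norm_sq_eq_re_sq (w k * x - w₀ * y), Complex.sub_re]
    have e6 : (w k * x - w₀ * y) ^ 2 = w k ^ 2 * x ^ 2 + -2 * (w k * w₀) * (x * y)
        + w₀ ^ 2 * y ^ 2 := by ring
    rw [e6, Complex.add_re, Complex.add_re]
    ring
  obtain ⟨k1, k2⟩ := tendsto_of_mean_norm_sub_one hd hns key
  constructor
  · have := k1.mul_const w₀
    rw [one_mul] at this
    refine this.congr fun k => ?_
    field_simp
  · exact tendsto_nhds_unique ((continuous_cis.tendsto _).comp (hγs.sub_const γ₀)) k2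

theorem trigSignal_sq (d : ℕ) (p q γ : ℝ) (t : ℕ) : trigSignal d p q γ t ^ 2
    = ((p ^ 2 + q ^ 2) + (amplitude p q ^ 2 * cis (2 * γ * (t : ℝ) ^ d)).re) / 2 := by
  have h := norm_sq_eq_re_sq (amplitude p q * cis (γ * (t : ℝ) ^ d))
  have e1 : cis (2 * γ * (t : ℝ) ^ d) = cis (γ * (t : ℝ) ^ d) ^ 2 := by
    rw [← cis_nat_mul]; congr 1; push_cast; ring
  rw [norm_mul, norm_cis, mul_one, norm_amplitude_sq] at h
  rw [trigSignal_eq_re, e1, ← mul_pow]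
  linarith

theorem trigSignal_mul (d : ℕ) (p q γ p' q' γ' : ℝ) (t : ℕ) :
    trigSignal d p q γ t * trigSignal d p' q' γ' t =
      ((amplitude p q * amplitude p' q' * cis ((γ + γ') * (t : ℝ) ^ d)).re
        + (amplitude p q * star (amplitude p' q') * cis ((γ - γ') * (t : ℝ) ^ d)).re) / 2 := by
  set x := amplitude p q * cis (γ * (t : ℝ) ^ d) with hx
  set y := amplitude p' q' * cis (γ' * (t : ℝ) ^ d) with hy
  have e1 : amplitude p q * amplitude p' q' * cis ((γ + γ') * (t : ℝ) ^ d) = x * y := by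
    rw [add_mul, cis_add, hx, hy]; ring
  have e2 : amplitude p q * star (amplitude p' q') * cis ((γ - γ') * (t : ℝ) ^ d)
      = x * star y := by
    rw [sub_mul, ← cis_mul_star, hx, hy, star_mul]; ring
  have e3 : (x * star y).re = x.re * y.re + x.im * y.im := by
    change (x * (starRingEnd ℂ) y).re = _
    rw [Complex.mul_re, Complex.conj_re, Complex.conj_im]; ring
  rw [e1, e2, trigSignal_eq_re, trigSignal_eq_re, ← hx, ← hy, e3, Complex.mul_re x y]
  ring

theorem tendsto_mean_trigSignal_sq {d : ℕ} {γ₀ : ℝ} (h : MeanNull d (2 * γ₀)) (p q : ℝ)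
    {ns : ℕ → ℕ} (hns : Tendsto ns atTop atTop) :
    Tendsto (fun k => (∑ t ∈ Finset.Icc 1 (ns k), trigSignal d p q γ₀ t ^ 2) / ns k) atTop
      (𝓝 ((p ^ 2 + q ^ 2) / 2)) := by
  have m := tendsto_re_mean h hns (tendsto_const_nhds (x := 2 * γ₀))
    (c := fun _ => amplitude p q ^ 2) (Eventually.of_forall fun _ => le_rfl)
  have := (m.div_const 2).const_add ((p ^ 2 + q ^ 2) / 2)
  rw [zero_div, add_zero] at this
  refine this.congr' ?_
  filter_upwards [hns.eventually_gt_atTop 0] with k hk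
  have hk' : (ns k : ℝ) ≠ 0 := by positivity
  simp only [trigSignal_sq]
  rw [← Finset.sum_div, Finset.sum_add_distrib, Finset.sum_const, Nat.card_Icc, nsmul_eq_mul]
  simp only [add_tsub_cancel_right]
  field_simp

theorem trigSignal_sq_le (d : ℕ) (p q γ : ℝ) (t : ℕ) :
    trigSignal d p q γ t ^ 2 ≤ p ^ 2 + q ^ 2 := by
  rw [trigSignal_eq_re, ← sq_abs, ← norm_amplitude_sq]
  gcongr
  refine (Complex.abs_re_le_norm _).trans ?_
  rw [norm_mul, norm_cis, mul_one]

theorem sum_sub_sq (s : Finset ℕ) (f g : ℕ → ℝ) : ∑ t ∈ s, (f t - g t) ^ 2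
    = ∑ t ∈ s, f t ^ 2 - 2 * ∑ t ∈ s, g t * f t + ∑ t ∈ s, g t ^ 2 := by
  rw [Finset.mul_sum, ← Finset.sum_sub_distrib, ← Finset.sum_add_distrib]
  exact Finset.sum_congr rfl fun t _ => by ring

/-- The frequency `γ₀` can be told apart from all other frequencies in `[0, π]`. -/
structure Identifiable (d : ℕ) (γ₀ : ℝ) : Prop where
  mem : γ₀ ∈ Ioo 0 Real.pi
  self : MeanNull d γ₀
  alternating : MeanNull d (γ₀ + Real.pi)
  double : MeanNull d (2 * γ₀)
  pair : ∀ γ ∈ Icc 0 Real.pi, (MeanNull d (γ - γ₀) ∧ MeanNull d (γ + γ₀)) ∨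
    (MeanNull d (2 * γ) ∧ (MeanNull d (γ + γ₀) ∨ MeanNull d (γ - γ₀)))

/-- Away from the end points the energy bounds the amplitudes. Near them the true signal is almost
orthogonal to the fit, so the squared distance would exceed (W / 4 - W / 8) n, against the assumed W
/ 16 · n. -/
theorem eventually_amplitude_le {d : ℕ} (hd : d = 1 ∨ d = 2) {γ₀ p₀ q₀ : ℝ}
    (hid : Identifiable d γ₀) (hpos : 0 < p₀ ^ 2 + q₀ ^ 2) {θ : ℕ → ℝ × ℝ × ℝ}
    (hmem : ∀ᶠ n in atTop, (θ n).2.2 ∈ Icc 0 Real.pi)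
    (hE : Tendsto (fun n : ℕ => (∑ t ∈ Finset.Icc 1 n, (trigSignal d (θ n).1 (θ n).2.1 (θ n).2.2 t
      - trigSignal d p₀ q₀ γ₀ t) ^ 2) / n) atTop (𝓝 0)) :
    ∃ C, ∀ᶠ n in atTop, ‖amplitude (θ n).1 (θ n).2.1‖ ≤ C := by
  obtain ⟨c, hc, hdich⟩ := exists_energy_lower_bound hd
  set W := p₀ ^ 2 + q₀ ^ 2 with hW
  refine ⟨Real.sqrt (2 * (W / 16 + W) / c), ?_⟩
  have hd0 : 0 < d := by omega
  filter_upwards [hmem, hE.eventually_lt_const (by positivity : 0 < W / 16),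
    (tendsto_mean_trigSignal_sq hid.double p₀ q₀ tendsto_id).eventually_const_lt
      (by rw [← hW]; linarith : W / 4 < (p₀ ^ 2 + q₀ ^ 2) / 2),
    (nullSums_trigSignal hid.self p₀ q₀).near_endpoint hd
      (nullSums_alternating_trigSignal hd0 hid.alternating p₀ q₀) (by positivity : 0 < W / 8),
    eventually_ge_atTop 8] with n h1 h2 h3 h4 h5
  have hn : (0 : ℝ) < n := by exact_mod_cast (by omega : 0 < n)
  simp only [id] at h3
  rw [lt_div_iff₀ hn] at h3
  rw [div_lt_iff₀ hn] at h2
  rcases hdich n h5 _ h1 with hne | hlow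
  · exfalso
    have h6 := h4 _ h1 hne (θ n).1 (θ n).2.1
    rw [sum_sub_sq] at h2
    set S := ∑ t ∈ Finset.Icc 1 n, trigSignal d p₀ q₀ γ₀ t
      * trigSignal d (θ n).1 (θ n).2.1 (θ n).2.2 t
    set E := ∑ t ∈ Finset.Icc 1 n, trigSignal d (θ n).1 (θ n).2.1 (θ n).2.2 t ^ 2
    have hE0 : 0 ≤ E := Finset.sum_nonneg fun _ _ => sq_nonneg _
    have h7 : 2 * S ≤ E + W / 8 * n := by
      apply le_of_sq_le_sq _ (by positivity)
      nlinarith [sq_nonneg (E - W / 8 * n)]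
    nlinarith
  · have h6 := hlow (θ n).1 (θ n).2.1
    rw [← norm_amplitude_sq] at h6
    apply Real.le_sqrt_of_sq_le
    rw [le_div_iff₀ hc]
    have h7 : ∑ t ∈ Finset.Icc 1 n, trigSignal d (θ n).1 (θ n).2.1 (θ n).2.2 t ^ 2
        ≤ ∑ t ∈ Finset.Icc 1 n, 2 * ((trigSignal d (θ n).1 (θ n).2.1 (θ n).2.2 t
          - trigSignal d p₀ q₀ γ₀ t) ^ 2 + W) := by
      apply Finset.sum_le_sum
      intro t _
      have := trigSignal_sq_le d p₀ q₀ γ₀ t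
      nlinarith [sq_nonneg (trigSignal d (θ n).1 (θ n).2.1 (θ n).2.2 t
        - 2 * trigSignal d p₀ q₀ γ₀ t)]
    rw [← Finset.mul_sum, Finset.sum_add_distrib, Finset.sum_const, Nat.card_Icc, nsmul_eq_mul]
      at h7
    simp only [add_tsub_cancel_right] at h7
    have h8 : (n : ℝ) * (‖amplitude (θ n).1 (θ n).2.1‖ ^ 2 * c) ≤ n * (2 * (W / 16 + W)) := by
      nlinarith
    exact le_of_mul_le_mul_left h8 hn

theorem eq_of_cis_sub_eq_one {γ γ₀ : ℝ} (hγ : γ ∈ Icc 0 Real.pi) (hγ₀ : γ₀ ∈ Ioo 0 Real.pi)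
    (h : cis (γ - γ₀) = 1) : γ = γ₀ := by
  obtain ⟨m, hm⟩ := (cis_eq_one_iff _).mp h
  have hpi := Real.pi_pos
  have h1 : (m : ℝ) < 1 := by
    by_contra hcon
    nlinarith [hγ.2, hγ₀.1]
  have h2 : (-1 : ℝ) < m := by
    by_contra hcon
    nlinarith [hγ.1, hγ₀.2]
  have h3 : m = 0 := by
    have h1' : m < 1 := by exact_mod_cast h1
    have h2' : -1 < m := by exact_mod_cast h2
    omega
  rw [h3] at hm
  simp at hm
  linarith

theorem cis_neg_sub_ne_one {γ γ₀ : ℝ} (hγ : γ ∈ Icc 0 Real.pi) (hγ₀ : γ₀ ∈ Ioo 0 Real.pi) :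
    cis (-γ - γ₀) ≠ 1 := by
  intro h
  obtain ⟨m, hm⟩ := (cis_eq_one_iff _).mp h
  have hpi := Real.pi_pos
  have h1 : (m : ℝ) < 0 := by
    by_contra hcon
    nlinarith [hγ.1, hγ₀.1]
  have h2 : (-1 : ℝ) < m := by
    by_contra hcon
    nlinarith [hγ.2, hγ₀.2]
  have h1' : m < 0 := by exact_mod_cast h1
  have h2' : -1 < m := by exact_mod_cast h2
  omega

/-- Amplitudes are eventually bounded and frequencies live in a compact interval, so it suffices to
examine a limit γ of frequencies along a subsequence; the alternatives in `pair` cover all γ. -/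
theorem Identifiable.tendsto {d : ℕ} (hd : d = 1 ∨ d = 2) {γ₀ p₀ q₀ : ℝ}
    (hid : Identifiable d γ₀) (hpos : 0 < p₀ ^ 2 + q₀ ^ 2) {θ : ℕ → ℝ × ℝ × ℝ}
    (hmem : ∀ᶠ n in atTop, (θ n).2.2 ∈ Icc 0 Real.pi)
    (hE : Tendsto (fun n : ℕ => (∑ t ∈ Finset.Icc 1 n, (trigSignal d (θ n).1 (θ n).2.1 (θ n).2.2 t
      - trigSignal d p₀ q₀ γ₀ t) ^ 2) / n) atTop (𝓝 0)) :
    Tendsto θ atTop (𝓝 (p₀, q₀, γ₀)) := by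
  obtain ⟨C, hC⟩ := eventually_amplitude_le hd hid hpos hmem hE
  apply tendsto_of_subseq_tendsto
  intro ms hms
  obtain ⟨γ, hγ, φ, hφ, hlim⟩ := isCompact_Icc.tendsto_subseq' (x := fun k => (θ (ms k)).2.2)
    (hms.eventually hmem).frequently
  refine ⟨φ, ?_⟩
  set ns : ℕ → ℕ := fun k => ms (φ k) with hns_def
  have hns : Tendsto ns atTop atTop := hms.comp hφ.tendsto_atTop
  set γs : ℕ → ℝ := fun k => (θ (ns k)).2.2 with hγs_def
  have hγs : Tendsto γs atTop (𝓝 γ) := hlim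
  set w : ℕ → ℂ := fun k => amplitude (θ (ns k)).1 (θ (ns k)).2.1 with hw_def
  have hw : ∀ᶠ k in atTop, ‖w k‖ ≤ C := hns.eventually hC
  set w₀ := amplitude p₀ q₀ with hw₀_def
  have hw₀ : w₀ ≠ 0 := by
    intro h
    have := norm_amplitude_sq p₀ q₀
    rw [← hw₀_def, h] at this
    simp at this
    linarith
  have hE' := hE.comp hns
  have hE1 : Tendsto (fun k => (∑ t ∈ Finset.Icc 1 (ns k),
      ((w k * cis (γs k * (t : ℝ) ^ d)).re - (w₀ * cis (γ₀ * (t : ℝ) ^ d)).re) ^ 2) / ns k)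
      atTop (𝓝 0) := by
    refine hE'.congr fun k => ?_
    simp only [Function.comp, trigSignal_eq_re, hw_def, hγs_def, hw₀_def]
  have main : MeanNull d (2 * γ) → MeanNull d (γ + γ₀) →
      Tendsto (fun n => θ (ms (φ n))) atTop (𝓝 (p₀, q₀, γ₀)) := by
    intro h1 h2
    obtain ⟨k1, k2⟩ := tendsto_of_mean_re_sub_sq hd hw₀ hns hγs hw h1 h2 hid.double hE1
    have hγ' := eq_of_cis_sub_eq_one hγ hid.mem k2
    rw [hγ'] at hγs
    have r1 := (Complex.continuous_re.tendsto _).comp k1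
    have r2 := ((Complex.continuous_im.tendsto _).comp k1).neg
    have r3 : Tendsto (fun k => (θ (ns k)).1) atTop (𝓝 p₀) := r1
    have r4 : Tendsto (fun k => (θ (ns k)).2.1) atTop (𝓝 q₀) := by
      simpa [hw_def, hw₀_def, amplitude, Function.comp_def] using r2
    exact r3.prodMk_nhds (r4.prodMk_nhds hγs)
  rcases hid.pair γ hγ with ⟨g1, g2⟩ | ⟨g1, g2 | g2⟩
  -- No correlation with the truth: (f - f₀)² ≥ f₀² - 2 f f₀ keeps the limiting mean at least (p₀² +
  -- q₀²) / 2 > 0.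
  · exfalso
    have hc1 : ∀ᶠ k in atTop, ‖w k * w₀‖ ≤ C * ‖w₀‖ := by
      filter_upwards [hw] with k hk
      rw [norm_mul]; gcongr
    have hc2 : ∀ᶠ k in atTop, ‖w k * star w₀‖ ≤ C * ‖w₀‖ := by
      filter_upwards [hw] with k hk
      rw [norm_mul, norm_star]; gcongr
    have m1 := tendsto_re_mean g2 hns (hγs.add_const γ₀) hc1
    have m2 := tendsto_re_mean g1 hns (hγs.sub_const γ₀) hc2
    have m3 := tendsto_mean_trigSignal_sq hid.double p₀ q₀ hns
    have m4 := m3.sub (m1.add m2)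
    rw [add_zero, sub_zero] at m4
    have hle := le_of_tendsto_of_tendsto' m4 hE' fun k => by
      simp only [Function.comp]
      rw [← add_div, ← sub_div]
      apply div_le_div_of_nonneg_right _ (Nat.cast_nonneg _)
      rw [← Finset.sum_add_distrib, ← Finset.sum_sub_distrib]
      apply Finset.sum_le_sum
      intro t _
      have := trigSignal_mul d (θ (ns k)).1 (θ (ns k)).2.1 (γs k) p₀ q₀ γ₀ t
      have h2 : (w k * w₀ * cis ((γs k + γ₀) * (t : ℝ) ^ d)).re
          + (w k * star w₀ * cis ((γs k - γ₀) * (t : ℝ) ^ d)).re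
          = 2 * (trigSignal d (θ (ns k)).1 (θ (ns k)).2.1 (γs k) t * trigSignal d p₀ q₀ γ₀ t) := by
        rw [this]; ring
      rw [h2]
      nlinarith [sq_nonneg (trigSignal d (θ (ns k)).1 (θ (ns k)).2.1 (γs k) t)]
    linarith
  · exact main g1 g2
  -- Conjugation leaves the real signal unchanged and replaces γ by -γ, so γ - γ₀ takes the role of
  -- γ + γ₀. The conclusion would be -γ ≡ γ₀ modulo 2π, impossible for γ₀ inside (0, π).
  · exfalso
    have hE2 : Tendsto (fun k => (∑ t ∈ Finset.Icc 1 (ns k),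
        ((star (w k) * cis (-γs k * (t : ℝ) ^ d)).re - (w₀ * cis (γ₀ * (t : ℝ) ^ d)).re) ^ 2) / ns k)
        atTop (𝓝 0) := by
      refine hE1.congr fun k => ?_
      congr 1
      apply Finset.sum_congr rfl
      intro t _
      congr 2
      rw [neg_mul, ← star_cis, mul_comm (star _), ← star_mul]
      exact (Complex.conj_re _).symm
    obtain ⟨-, k2⟩ := tendsto_of_mean_re_sub_sq hd hw₀ hns hγs.neg
      (w := fun k => star (w k)) (by simpa using hw) (by simpa using g1.neg)
      (by have := g2.neg; rwa [neg_sub, sub_eq_add_neg, add_comm] at this) hid.double hE2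
    exact cis_neg_sub_ne_one hγ hid.mem k2

theorem identifiable_one {γ₀ : ℝ} (h : γ₀ ∈ Ioo 0 Real.pi) : Identifiable 1 γ₀ := by
  have hne : ∀ x : ℝ, 0 < x → x < 2 * Real.pi → cis x ≠ 1 := by
    intro x h0 h1 hx
    obtain ⟨m, hm⟩ := (cis_eq_one_iff _).mp hx
    have hpi := Real.pi_pos
    have h2 : (0 : ℝ) < m := by
      by_contra hcon
      nlinarith
    have h3 : (m : ℝ) < 1 := by
      by_contra hcon
      nlinarith
    have h2' : 0 < m := by exact_mod_cast h2
    have h3' : m < 1 := by exact_mod_cast h3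
    omega
  have hpi := Real.pi_pos
  obtain ⟨h0, h1⟩ := h
  refine ⟨⟨h0, h1⟩, meanNull_one (hne _ (by linarith) (by linarith)),
    meanNull_one (hne _ (by linarith) (by linarith)),
    meanNull_one (hne _ (by linarith) (by linarith)), ?_⟩
  intro γ hγ
  have hadd := meanNull_one (hne (γ + γ₀) (by linarith [hγ.1]) (by linarith [hγ.2]))
  by_cases hc : cis (γ - γ₀) = 1
  · right
    rw [eq_of_cis_sub_eq_one hγ ⟨h0, h1⟩ hc]
    have := meanNull_one (hne (2 * γ₀) (by linarith) (by linarith))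
    exact ⟨this, Or.inl (by rwa [two_mul] at this)⟩
  · exact Or.inl ⟨meanNull_one hc, hadd⟩

/-- At most one of γ ± γ₀ is a rational multiple of π, since they differ by 2γ₀. If one is, then 2γ
is a rational multiple of π plus or minus 2γ₀, hence an irrational multiple. -/
theorem identifiable_two {γ₀ : ℝ} (h : γ₀ ∈ Ioo 0 Real.pi) (hirr : Irrational (γ₀ / Real.pi)) :
    Identifiable 2 γ₀ := by
  have hpi := Real.pi_ne_zero
  have hdouble : Irrational (2 * γ₀ / Real.pi) := by
    rw [mul_div_assoc]
    exact_mod_cast hirr.natCast_mul (m := 2) (by norm_num)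
  refine ⟨h, meanNull_two hirr, meanNull_two ?_, meanNull_two hdouble, ?_⟩
  · rw [add_div, div_self hpi]
    exact_mod_cast hirr.add_natCast 1
  · intro γ hγ
    have hrat : ∀ x y : ℝ, ¬ Irrational (x / Real.pi) → Irrational (y / Real.pi) →
        Irrational ((x + y) / Real.pi) := by
      intro x y hx hy
      rw [Irrational, not_not] at hx
      obtain ⟨r, hr⟩ := hx
      rw [add_div, ← hr]
      exact hy.ratCast_add r
    have hdbl : ∀ x : ℝ, ¬ Irrational (x / Real.pi) → ¬ Irrational (2 * x / Real.pi) := by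
      intro x hx hcon
      rw [Irrational, not_not] at hx
      obtain ⟨r, hr⟩ := hx
      apply hcon
      exact ⟨2 * r, by push_cast; rw [hr]; ring⟩
    by_cases h1 : Irrational ((γ - γ₀) / Real.pi)
    · by_cases h2 : Irrational ((γ + γ₀) / Real.pi)
      · exact Or.inl ⟨meanNull_two h1, meanNull_two h2⟩
      · refine Or.inr ⟨meanNull_two ?_, Or.inr (meanNull_two h1)⟩
        have := hrat (2 * (γ + γ₀)) (-(2 * γ₀)) (hdbl _ h2) (by rw [neg_div]; exact hdouble.neg)
        convert this using 2; ring
    · refine Or.inr ⟨meanNull_two ?_, Or.inl (meanNull_two ?_)⟩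
      · have := hrat _ _ (hdbl _ h1) hdouble
        convert this using 2; ring
      · have := hrat _ _ h1 hdouble
        convert this using 2; ring

/-! ### Least squares estimators -/

theorem transpose_mulVec_residual {n : ℕ} {Z : Matrix (Fin n) (Fin 2) ℝ}
    (h : (Zᵀ * Z).det ≠ 0) (Y : Fin n → ℝ) : Zᵀ *ᵥ (Y - Z *ᵥ linearEst Z Y) = 0 := by
  have hu : IsUnit (Zᵀ * Z).det := isUnit_iff_ne_zero.mpr h
  rw [Matrix.mulVec_sub, linearEst, Matrix.mulVec_mulVec, Matrix.mulVec_mulVec, ← Matrix.mul_assoc,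
    Matrix.mul_nonsing_inv _ hu, Matrix.one_mul, sub_self]

theorem mulVec_dotProduct_residual {n : ℕ} {Z : Matrix (Fin n) (Fin 2) ℝ}
    (h : (Zᵀ * Z).det ≠ 0) (Y : Fin n → ℝ) (μ : Fin 2 → ℝ) :
    (Z *ᵥ μ) ⬝ᵥ (Y - Z *ᵥ linearEst Z Y) = 0 := by
  rw [dotProduct_comm, Matrix.dotProduct_mulVec, ← Matrix.mulVec_transpose,
    transpose_mulVec_residual h, zero_dotProduct]

theorem profileSS_eq {n : ℕ} {Z : Matrix (Fin n) (Fin 2) ℝ} (h : (Zᵀ * Z).det ≠ 0)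
    (Y : Fin n → ℝ) : profileSS Z Y
      = (Y - Z *ᵥ linearEst Z Y) ⬝ᵥ (Y - Z *ᵥ linearEst Z Y) := by
  have e : (1 - Z * (Zᵀ * Z)⁻¹ * Zᵀ) *ᵥ Y = Y - Z *ᵥ linearEst Z Y := by
    rw [Matrix.sub_mulVec, Matrix.one_mulVec, linearEst, Matrix.mulVec_mulVec, Matrix.mul_assoc]
  rw [profileSS, e, sub_dotProduct, mulVec_dotProduct_residual h, sub_zero]

/-- Pythagoras: the residual at the linear estimate is orthogonal to the column space. -/
theorem profileSS_le {n : ℕ} {Z : Matrix (Fin n) (Fin 2) ℝ} (h : (Zᵀ * Z).det ≠ 0)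
    (Y : Fin n → ℝ) (μ : Fin 2 → ℝ) : profileSS Z Y ≤ (Y - Z *ᵥ μ) ⬝ᵥ (Y - Z *ᵥ μ) := by
  rw [profileSS_eq h]
  set r := Y - Z *ᵥ linearEst Z Y with hr
  set g := Z *ᵥ (linearEst Z Y - μ) with hg
  have e : Y - Z *ᵥ μ = r + g := by rw [hr, hg, Matrix.mulVec_sub]; abel
  have h0 : g ⬝ᵥ r = 0 := mulVec_dotProduct_residual h Y _
  have h0' : r ⬝ᵥ g = 0 := by rw [dotProduct_comm, h0]
  have hgg : 0 ≤ g ⬝ᵥ g := Finset.sum_nonneg fun i _ => mul_self_nonneg _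
  rw [e, add_dotProduct, dotProduct_add, dotProduct_add, h0, h0']
  linarith

theorem IsSeparableLSE.errorSS_le {n : ℕ} {Z : ℝ → Matrix (Fin n) (Fin 2) ℝ} {Y : Fin n → ℝ}
    {θ : ℝ × ℝ × ℝ} (h : IsSeparableLSE Z Y θ) {γ₀ : ℝ} (hγ₀ : γ₀ ∈ regularSet Z) (p q : ℝ) :
    errorSS Z Y θ ≤ errorSS Z Y (p, q, γ₀) := by
  have e : errorSS Z Y θ = profileSS (Z θ.2.2) Y := by
    rw [profileSS_eq h.mem.2, errorSS, fitted, h.linear]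
  rw [e]
  exact (h.isMin hγ₀).trans (profileSS_le hγ₀.2 Y _)

/-- The designs `Z n` generate the signals `p cos(γ t^d) + q sin(γ t^d)`, `t = 1, …, n`. -/
def IsPowerDesign (d : ℕ) (Z : (n : ℕ) → ℝ → Matrix (Fin n) (Fin 2) ℝ) : Prop :=
  ∀ n θ i, fitted (Z n) θ i = trigSignal d θ.1 θ.2.1 θ.2.2 ((i : ℕ) + 1)

theorem isPowerDesign_sinusoid : IsPowerDesign 1 sinusoidDesign := by
  intro n θ i
  simp [fitted, sinusoidDesign, Matrix.mulVec, dotProduct, Fin.sum_univ_two, trigSignal]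
  ring

theorem isPowerDesign_chirp : IsPowerDesign 2 chirpDesign := by
  intro n θ i
  simp [fitted, chirpDesign, Matrix.mulVec, dotProduct, Fin.sum_univ_two, trigSignal]
  ring

theorem sum_fin_eq_sum_Icc (n : ℕ) (g : ℕ → ℝ) :
    ∑ i : Fin n, g ((i : ℕ) + 1) = ∑ t ∈ Finset.Icc 1 n, g t := by
  rw [Fin.sum_univ_eq_sum_range (fun i => g (i + 1)) n, Finset.range_eq_Ico,
    Finset.sum_Ico_add' g 0 n 1]
  rfl

/-- An interior frequency eventually leaves the end-point zone, and there the energy bound makes the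
Gram matrix definite. -/
theorem eventually_mem_regularSet {d : ℕ} (hd : d = 1 ∨ d = 2)
    {Z : (n : ℕ) → ℝ → Matrix (Fin n) (Fin 2) ℝ} (hZ : IsPowerDesign d Z) {γ₀ : ℝ}
    (hγ₀ : γ₀ ∈ Ioo 0 Real.pi) : ∀ᶠ n in atTop, γ₀ ∈ regularSet (Z n) := by
  obtain ⟨c, hc, hdich⟩ := exists_energy_lower_bound hd
  have hlarge : ∀ x : ℝ, 0 < x → ∀ᶠ n : ℕ in atTop, 1 / 2 < x * (n : ℝ) ^ d := by
    intro x hx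
    filter_upwards [tendsto_natCast_atTop_atTop.eventually_gt_atTop (1 / 2 / x),
      eventually_ge_atTop 1] with n hn hn1
    rw [div_lt_iff₀ hx] at hn
    have h1 : (1 : ℝ) ≤ n := by exact_mod_cast hn1
    have h2 : (n : ℝ) ≤ (n : ℝ) ^ d := le_self_pow₀ h1 (by omega)
    nlinarith
  filter_upwards [hlarge γ₀ hγ₀.1, hlarge (Real.pi - γ₀) (by linarith [hγ₀.2]),
    eventually_ge_atTop 8] with n h1 h2 hn
  refine ⟨Ioo_subset_Icc_self hγ₀, fun hdet => ?_⟩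
  rcases hdich n hn γ₀ (Ioo_subset_Icc_self hγ₀) with hne | hlow
  · rcases hne with h | h <;> linarith
  · obtain ⟨v, hv0, hv⟩ := Matrix.exists_mulVec_eq_zero_iff.mpr hdet
    have e1 : (Z n γ₀ *ᵥ v) ⬝ᵥ (Z n γ₀ *ᵥ v) = 0 := by
      rw [Matrix.dotProduct_mulVec, ← Matrix.mulVec_transpose, Matrix.mulVec_mulVec, hv,
        zero_dotProduct]
    have e2 : Z n γ₀ *ᵥ v = fitted (Z n) (v 0, v 1, γ₀) := by
      rw [fitted]; congr 1; ext i; fin_cases i <;> rfl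
    have e3 : (Z n γ₀ *ᵥ v) ⬝ᵥ (Z n γ₀ *ᵥ v)
        = ∑ t ∈ Finset.Icc 1 n, trigSignal d (v 0) (v 1) γ₀ t ^ 2 := by
      rw [e2, dotProduct, ← sum_fin_eq_sum_Icc]
      exact Finset.sum_congr rfl fun i _ => by rw [hZ, sq]
    have h3 := hlow (v 0) (v 1)
    rw [← e3, e1] at h3
    have hn0 : (0 : ℝ) < n := by exact_mod_cast (by omega : 0 < n)
    have h4 : v 0 ^ 2 + v 1 ^ 2 ≤ 0 := by
      by_contra hcon
      push Not at hcon
      have : 0 < c * n * (v 0 ^ 2 + v 1 ^ 2) := by positivity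
      linarith
    apply hv0
    ext i
    fin_cases i
    · simpa using by nlinarith [sq_nonneg (v 0), sq_nonneg (v 1)]
    · simpa using by nlinarith [sq_nonneg (v 0), sq_nonneg (v 1)]

theorem two_mul_le_of_sq_le {A s x y : ℝ} (hs : 0 ≤ s) (hx : 0 ≤ x) (hy : 0 ≤ y)
    (h : A ^ 2 ≤ s ^ 2 * x * y) : |2 * A| ≤ s * (x + y) := by
  apply abs_le_of_sq_le_sq _ (by positivity)
  calc (2 * A) ^ 2 = 4 * A ^ 2 := by ring
    _ ≤ 4 * (s ^ 2 * x * y) := by linarith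
    _ ≤ (s * (x + y)) ^ 2 := by nlinarith [mul_nonneg (sq_nonneg s) (sq_nonneg (x - y))]

/-- An estimator that fits the data at least as well as the true parameters recovers the signal in
mean square. -/
theorem tendsto_mean_sq_of_errorSS_le {d : ℕ} (hd : d = 1 ∨ d = 2)
    {Z : (n : ℕ) → ℝ → Matrix (Fin n) (Fin 2) ℝ} (hZ : IsPowerDesign d Z) {p₀ q₀ γ₀ : ℝ}
    (hγ₀ : γ₀ ∈ Icc 0 Real.pi) {r : ℕ → ℝ} (hr : PowerNull d r) {ρ : ℕ → ℕ → ℝ}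
    (hρ : Tendsto (fun n : ℕ => (∑ t ∈ Finset.Icc 1 n, ρ n t ^ 2) / n) atTop (𝓝 0))
    {Y : (n : ℕ) → Fin n → ℝ}
    (hY : ∀ n i, Y n i = trigSignal d p₀ q₀ γ₀ ((i : ℕ) + 1) + r ((i : ℕ) + 1) + ρ n ((i : ℕ) + 1))
    {θ : ℕ → ℝ × ℝ × ℝ} (hmem : ∀ᶠ n in atTop, (θ n).2.2 ∈ Icc 0 Real.pi)
    (hle : ∀ᶠ n in atTop, errorSS (Z n) (Y n) (θ n) ≤ errorSS (Z n) (Y n) (p₀, q₀, γ₀)) :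
    Tendsto (fun n : ℕ => (∑ t ∈ Finset.Icc 1 n, (trigSignal d (θ n).1 (θ n).2.1 (θ n).2.2 t
      - trigSignal d p₀ q₀ γ₀ t) ^ 2) / n) atTop (𝓝 0) := by
  rw [Metric.tendsto_nhds]
  intro ε hε
  set W := p₀ ^ 2 + q₀ ^ 2 with hW
  have hW0 : 0 ≤ W := by positivity
  -- The cross terms total at most s (3n + 3nW + 3D). The bound s ≤ 1 / 6 lets 3 s D be absorbed
  -- into D / 2, leaving D ≤ 6 s (1 + W) n < ε n.
  obtain ⟨s, hs0, hs6, hsε⟩ : ∃ s : ℝ, 0 < s ∧ s ≤ 1 / 6 ∧ 6 * s * (1 + W) < ε := by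
    refine ⟨min (1 / 6) (ε / (12 * (1 + W))), by positivity, min_le_left _ _, ?_⟩
    have : min (1 / 6) (ε / (12 * (1 + W))) ≤ ε / (12 * (1 + W)) := min_le_right _ _
    rw [le_div_iff₀ (by positivity)] at this
    linarith
  have hs2 : 0 < s ^ 2 := by positivity
  filter_upwards [hmem, hle, hr.sum_mul_trigSignal_sq_le hd hs2, hρ.eventually_lt_const hs2,
    eventually_gt_atTop 0] with n h1 h2 h3 h4 h5
  have hn : (0 : ℝ) < n := by exact_mod_cast h5
  set f : ℕ → ℝ := trigSignal d (θ n).1 (θ n).2.1 (θ n).2.2 with hf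
  set f₀ : ℕ → ℝ := trigSignal d p₀ q₀ γ₀ with hf₀
  have herr : ∀ θ' : ℝ × ℝ × ℝ, errorSS (Z n) (Y n) θ' = ∑ t ∈ Finset.Icc 1 n,
      (f₀ t + r t + ρ n t - trigSignal d θ'.1 θ'.2.1 θ'.2.2 t) ^ 2 := by
    intro θ'
    rw [errorSS, dotProduct, ← sum_fin_eq_sum_Icc]
    apply Finset.sum_congr rfl
    intro i _
    rw [Pi.sub_apply, hZ, hY, sq]
  rw [herr, herr] at h2
  set D := ∑ t ∈ Finset.Icc 1 n, (f t - f₀ t) ^ 2 with hD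
  have hD0 : 0 ≤ D := Finset.sum_nonneg fun _ _ => sq_nonneg _
  have hbasic : D ≤ 2 * ∑ t ∈ Finset.Icc 1 n, r t * f t - 2 * ∑ t ∈ Finset.Icc 1 n, r t * f₀ t
      + 2 * ∑ t ∈ Finset.Icc 1 n, ρ n t * (f t - f₀ t) := by
    have e : ∑ t ∈ Finset.Icc 1 n, (f₀ t + r t + ρ n t - f t) ^ 2
        = D - (2 * ∑ t ∈ Finset.Icc 1 n, r t * f t - 2 * ∑ t ∈ Finset.Icc 1 n, r t * f₀ t
      + 2 * ∑ t ∈ Finset.Icc 1 n, ρ n t * (f t - f₀ t))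
        + ∑ t ∈ Finset.Icc 1 n, (f₀ t + r t + ρ n t - f₀ t) ^ 2 := by
      rw [hD, Finset.mul_sum, Finset.mul_sum, Finset.mul_sum, ← Finset.sum_sub_distrib,
        ← Finset.sum_add_distrib, ← Finset.sum_sub_distrib, ← Finset.sum_add_distrib]
      exact Finset.sum_congr rfl fun t _ => by ring
    linarith
  have hEf : ∑ t ∈ Finset.Icc 1 n, f t ^ 2 ≤ 2 * D + 2 * (n * W) := by
    have : ∀ t ∈ Finset.Icc 1 n, f t ^ 2 ≤ 2 * (f t - f₀ t) ^ 2 + 2 * W := by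
      intro t _
      have := trigSignal_sq_le d p₀ q₀ γ₀ t
      nlinarith [sq_nonneg (f t - 2 * f₀ t)]
    refine (Finset.sum_le_sum this).trans (le_of_eq ?_)
    rw [Finset.sum_add_distrib, ← Finset.mul_sum, Finset.sum_const, Nat.card_Icc, nsmul_eq_mul]
    simp only [add_tsub_cancel_right]
    ring
  have hEf₀ : ∑ t ∈ Finset.Icc 1 n, f₀ t ^ 2 ≤ n * W := by
    refine (Finset.sum_le_sum fun t _ => trigSignal_sq_le d p₀ q₀ γ₀ t).trans (le_of_eq ?_)
    simp [hW, mul_add]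
  have hE0 : ∀ g : ℕ → ℝ, 0 ≤ ∑ t ∈ Finset.Icc 1 n, g t ^ 2 := fun g =>
    Finset.sum_nonneg fun _ _ => sq_nonneg _
  have b1 := two_mul_le_of_sq_le hs0.le hn.le (hE0 f) (h3 _ h1 (θ n).1 (θ n).2.1)
  have b2 := two_mul_le_of_sq_le hs0.le hn.le (hE0 f₀) (h3 _ hγ₀ p₀ q₀)
  have b3 := two_mul_le_of_sq_le (A := ∑ t ∈ Finset.Icc 1 n, ρ n t * (f t - f₀ t)) hs0.le hn.le hD0
    (by
      refine (Finset.sum_mul_sq_le_sq_mul_sq _ _ _).trans ?_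
      rw [div_lt_iff₀ hn] at h4
      gcongr)
  have c1 := le_of_abs_le b1
  have c2 := neg_le_of_abs_le b2
  have c3 := le_of_abs_le b3
  have hsn : s * (n + ∑ t ∈ Finset.Icc 1 n, f t ^ 2) ≤ s * (n + (2 * D + 2 * (n * W))) := by gcongr
  have hsn₀ : s * (n + ∑ t ∈ Finset.Icc 1 n, f₀ t ^ 2) ≤ s * (n + n * W) := by gcongr
  have hfin : D ≤ 6 * s * (1 + W) * n := by
    have h6 : D ≤ s * (3 * n + 3 * (n * W) + 3 * D) := by linarith
    nlinarith
  rw [Real.dist_eq, sub_zero, abs_of_nonneg (by positivity), div_lt_iff₀ hn]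
  calc D ≤ 6 * s * (1 + W) * n := hfin
    _ < ε * n := by gcongr

/-! ### Strong consistency -/

/-- The frequency of `θ` lies in `[0, π]`, and `θ` fits the data at least as well as `θ₀`. Both ways
of fitting have this property. -/
structure IsAdmissibleFit {n : ℕ} (Z : ℝ → Matrix (Fin n) (Fin 2) ℝ) (Y : Fin n → ℝ)
    (θ₀ θ : ℝ × ℝ × ℝ) : Prop where
  mem : θ.2.2 ∈ Icc 0 Real.pi
  le : errorSS Z Y θ ≤ errorSS Z Y θ₀

theorem dataVec_apply {Ω : Type*} (A B α C D β : ℝ) (X : ℤ → Ω → ℝ) (n : ℕ) (ω : Ω) (i : Fin n) :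
    dataVec (A, B, α) (C, D, β) X n ω i = trigSignal 1 A B α ((i : ℕ) + 1)
      + trigSignal 2 C D β ((i : ℕ) + 1) + X ((i : ℕ) + 1 : ℕ) ω := by
  simp only [dataVec, chirpLike, trigSignal, pow_one]
  ring

/-- The mean-square recovery `hE₁` of the first signal does not need A² + B² > 0, so the second
stage works even when the first frequency is not identifiable. -/
theorem consistent_of_isAdmissibleFit {Ω : Type*} {X : ℤ → Ω → ℝ} {ω : Ω}
    (hX : QuadraticNull (fun t => X t ω)) {A B α C D β : ℝ} (hα : α ∈ Ioo 0 Real.pi)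
    (hβ : β ∈ Ioo 0 Real.pi) (hirr : Irrational (β / Real.pi)) {T₁ : ℕ → ℝ × ℝ × ℝ}
    (h₁ : ∀ᶠ n in atTop, IsAdmissibleFit (sinusoidDesign n)
      (dataVec (A, B, α) (C, D, β) X n ω) (A, B, α) (T₁ n)) :
    (0 < A ^ 2 + B ^ 2 → Tendsto T₁ atTop (𝓝 (A, B, α))) ∧
    ∀ T₂ : ℕ → ℝ × ℝ × ℝ, (∀ᶠ n in atTop, IsAdmissibleFit (chirpDesign n)
      (dataVec (A, B, α) (C, D, β) X n ω - fitted (sinusoidDesign n) (T₁ n)) (C, D, β) (T₂ n)) →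
      0 < C ^ 2 + D ^ 2 → Tendsto T₂ atTop (𝓝 (C, D, β)) := by
  have hmem₁ : ∀ᶠ n in atTop, (T₁ n).2.2 ∈ Icc 0 Real.pi := h₁.mono fun n h => h.mem
  have hE₁ := tendsto_mean_sq_of_errorSS_le (Or.inl rfl) isPowerDesign_sinusoid
    (p₀ := A) (q₀ := B) (Ioo_subset_Icc_self hα)
    (r := fun t : ℕ => trigSignal 2 C D β t + X t ω)
    ((powerNull_one_chirp hirr C D).add (hX.powerNull (Or.inl rfl))) (ρ := fun _ _ => 0)
    (by simp) (Y := fun n => dataVec (A, B, α) (C, D, β) X n ω)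
    (fun n i => by rw [dataVec_apply]; ring) hmem₁ (h₁.mono fun n h => h.le)
  refine ⟨fun hpos => (identifiable_one hα).tendsto (Or.inl rfl) hpos hmem₁ hE₁,
    fun T₂ h₂ hpos => ?_⟩
  have hmem₂ : ∀ᶠ n in atTop, (T₂ n).2.2 ∈ Icc 0 Real.pi := h₂.mono fun n h => h.mem
  refine (identifiable_two hβ hirr).tendsto (Or.inr rfl) hpos hmem₂ ?_
  refine tendsto_mean_sq_of_errorSS_le (Or.inr rfl) isPowerDesign_chirp
    (Ioo_subset_Icc_self hβ) (hX.powerNull (Or.inr rfl))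
    (ρ := fun n t => trigSignal 1 A B α t - trigSignal 1 (T₁ n).1 (T₁ n).2.1 (T₁ n).2.2 t)
    ?_ (Y := fun n => dataVec (A, B, α) (C, D, β) X n ω - fitted (sinusoidDesign n) (T₁ n))
    (fun n i => ?_) hmem₂ (h₂.mono fun n h => h.le)
  · refine hE₁.congr fun n => ?_
    congr 1
    exact Finset.sum_congr rfl fun t _ => by ring
  · rw [Pi.sub_apply, isPowerDesign_sinusoid, dataVec_apply]
    ring

theorem IsSeparableLSE.isAdmissibleFit {n : ℕ} {Z : ℝ → Matrix (Fin n) (Fin 2) ℝ} {Y : Fin n → ℝ}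
    {θ : ℝ × ℝ × ℝ} (h : IsSeparableLSE Z Y θ) {γ₀ : ℝ} (hγ₀ : γ₀ ∈ regularSet Z) (p q : ℝ) :
    IsAdmissibleFit Z Y (p, q, γ₀) θ :=
  ⟨h.mem.1, h.errorSS_le hγ₀ p q⟩

theorem IsConstrainedLSE.isAdmissibleFit {n : ℕ} {M : ℝ} {Z : ℝ → Matrix (Fin n) (Fin 2) ℝ}
    {Y : Fin n → ℝ} {θ₀ θ : ℝ × ℝ × ℝ} (h : IsConstrainedLSE M Z Y θ) (hθ₀ : θ₀ ∈ blockSpace M) :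
    IsAdmissibleFit Z Y θ₀ θ :=
  ⟨h.mem.2.2, h.isMin hθ₀⟩

theorem mem_Ioo_of_mem_interior_blockSpace {M A B α : ℝ}
    (h : (A, B, α) ∈ interior (blockSpace M)) : α ∈ Ioo 0 Real.pi := by
  rw [blockSpace, interior_prod_eq, interior_prod_eq, interior_Icc, interior_Icc] at h
  exact h.2.2

theorem theorem3 {Ω : Type*} [MeasurableSpace Ω] (P : Measure Ω) [IsProbabilityMeasure P]
    (σ : ℝ) (a : ℤ → ℝ) (e X : ℤ → Ω → ℝ) (hX : IsLinearProcess P σ a e X)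
    (M : ℝ) (hM : 0 < M) (A₀ B₀ α₀ C₀ D₀ β₀ : ℝ)
    (hθ : ((A₀, B₀, α₀), (C₀, D₀, β₀)) ∈ interior (blockSpace M ×ˢ blockSpace M))
    (hβ : Irrational (β₀ / Real.pi))
    (Y : (n : ℕ) → Ω → Fin n → ℝ) (hY : Y = dataVec (A₀, B₀, α₀) (C₀, D₀, β₀) X) :
    -- estimators obtained by separable regression
    (∀ T₁ : ℕ → Ω → ℝ × ℝ × ℝ,
      (∀ᵐ ω ∂P, ∀ᶠ n in atTop, IsSeparableLSE (sinusoidDesign n) (Y n ω) (T₁ n ω)) →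
      (0 < A₀ ^ 2 + B₀ ^ 2 →
        ∀ᵐ ω ∂P, Tendsto (fun n => T₁ n ω) atTop (𝓝 (A₀, B₀, α₀))) ∧
      ∀ T₂ : ℕ → Ω → ℝ × ℝ × ℝ,
        (∀ᵐ ω ∂P, ∀ᶠ n in atTop, IsSeparableLSE (chirpDesign n)
          (Y n ω - fitted (sinusoidDesign n) (T₁ n ω)) (T₂ n ω)) →
        0 < C₀ ^ 2 + D₀ ^ 2 →
          ∀ᵐ ω ∂P, Tendsto (fun n => T₂ n ω) atTop (𝓝 (C₀, D₀, β₀))) ∧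
    -- estimators obtained by minimising over the compact parameter space
    (∀ T₁ : ℕ → Ω → ℝ × ℝ × ℝ,
      (∀ᵐ ω ∂P, ∀ᶠ n in atTop, IsConstrainedLSE M (sinusoidDesign n) (Y n ω) (T₁ n ω)) →
      (0 < A₀ ^ 2 + B₀ ^ 2 →
        ∀ᵐ ω ∂P, Tendsto (fun n => T₁ n ω) atTop (𝓝 (A₀, B₀, α₀))) ∧
      ∀ T₂ : ℕ → Ω → ℝ × ℝ × ℝ,
        (∀ᵐ ω ∂P, ∀ᶠ n in atTop, IsConstrainedLSE M (chirpDesign n)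
          (Y n ω - fitted (sinusoidDesign n) (T₁ n ω)) (T₂ n ω)) →
        0 < C₀ ^ 2 + D₀ ^ 2 →
          ∀ᵐ ω ∂P, Tendsto (fun n => T₂ n ω) atTop (𝓝 (C₀, D₀, β₀))) := by
  subst hY
  rw [interior_prod_eq] at hθ
  obtain ⟨hθ₁, hθ₂⟩ := hθ
  have hα := mem_Ioo_of_mem_interior_blockSpace hθ₁
  have hβ' := mem_Ioo_of_mem_interior_blockSpace hθ₂
  have reg₁ := eventually_mem_regularSet (Or.inl rfl) isPowerDesign_sinusoid hα
  have reg₂ := eventually_mem_regularSet (Or.inr rfl) isPowerDesign_chirp hβ'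
  refine ⟨fun T₁ h₁ => ⟨fun hpos => ?_, fun T₂ h₂ hpos => ?_⟩,
    fun T₁ h₁ => ⟨fun hpos => ?_, fun T₂ h₂ hpos => ?_⟩⟩
  · filter_upwards [h₁, hX.quadraticNull] with ω k₁ hnull
    exact (consistent_of_isAdmissibleFit hnull hα hβ' hβ ((k₁.and reg₁).mono fun n h =>
      h.1.isAdmissibleFit h.2 A₀ B₀)).1 hpos
  · filter_upwards [h₁, h₂, hX.quadraticNull] with ω k₁ k₂ hnull
    exact (consistent_of_isAdmissibleFit hnull hα hβ' hβ ((k₁.and reg₁).mono fun n h =>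
      h.1.isAdmissibleFit h.2 A₀ B₀)).2 _ ((k₂.and reg₂).mono fun n h =>
      h.1.isAdmissibleFit h.2 C₀ D₀) hpos
  · filter_upwards [h₁, hX.quadraticNull] with ω k₁ hnull
    exact (consistent_of_isAdmissibleFit hnull hα hβ' hβ (k₁.mono fun n h =>
      h.isAdmissibleFit (interior_subset hθ₁))).1 hpos
  · filter_upwards [h₁, h₂, hX.quadraticNull] with ω k₁ k₂ hnull
    exact (consistent_of_isAdmissibleFit hnull hα hβ' hβ (k₁.mono fun n h =>
      h.isAdmissibleFit (interior_subset hθ₁))).2 _ (k₂.mono fun n h =>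
      h.isAdmissibleFit (interior_subset hθ₂)) hpos
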